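/- Let $\mathbb B$ be a (real or complex) Banach space, $n\ge 1$ an integer, $1<q<\infty$ and $\alpha>0$. For $t>0$ let $$\mathcal P_tf(x)=\frac{\Gamma(\frac{n+1}2)}{\pi^{(n+1)/2}}\int_{\mathbb R^n}\frac{t}{(t^2+|x-y|^2)^{(n+1)/2}}\,f(y)\,dy$$ be the classical Poisson semigroup on $\mathbb R^n$, acting on $\mathbb B$-valued functions. Let $m$ be the smallest integer strictly larger than $\alpha$, and put $$\partial_t^\alpha\mathcal P_tf(x)=\frac{e^{-i\pi(m-\alpha)}}{\Gamma(m-\alpha)}\int_0^\infty\partial_t^m\mathcal P_{t+s}f(x)\,s^{m-\alpha-1}\,ds$$ (if $\mathbb B$ is real, the unimodular factor $e^{-i\pi(m-\alpha)}$ is omitted). Define the fractional Littlewood--Paley $g$-function and the fractional area function by $$g_\alpha^q(f)(x)=\Big(\int_0^\infty\|t^\alpha\partial_t^\alpha\mathcal P_tf(x)\|_{\mathbb B}^q\,\frac{dt}t\Big)^{1/q},\qquad S_\alpha^q(f)(x)=\Big(\iint_{\{(y,t):\,t>0,\ |x-y|<t\}}\|t^\alpha\partial_t^\alpha\mathcal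 P_tf(y)\|_{\mathbb B}^q\,\frac{dy\,dt}{t^{n+1}}\Big)^{1/q}.$$ Let $U$ be either $g_\alpha^q$ or $S_\alpha^q$. Then the following statements are equivalent: 1. $U$ maps $L^\infty_{c,\mathbb B}(\mathbb R^n)$ boundedly into $BMO(\mathbb R^n)$; 2. $U$ maps $H^1_{\mathbb B}(\mathbb R^n)$ boundedly into $L^1(\mathbb R^n)$; 3. for every $p\in(1,\infty)$, $U$ maps $L^p_{\mathbb B}(\mathbb R^n)$ boundedly into $L^p(\mathbb R^n)$; 4. for some $p\in(1,\infty)$, $U$ maps $L^p_{\mathbb B}(\mathbb R^n)$ boundedly into $L^p(\mathbb R^n)$; 5. $U$ maps $BMO_{c,\mathbb B}(\mathbb R^n)$ boundedly into $BMO(\mathbb R^n)$; 6. $U$ maps $L^1_{\mathbb B}(\mathbb R^n)$ boundedly into weak $L^1(\mathbb R^n)$. Here $L^\infty_{c,\mathbb B}$ and $BMO_{c,\mathbb B}$ are the compactly supported functions in $L^\infty_{\mathbb B}$ and $BMO_{\mathbb B}$, where $BMO_{\mathbb B}$ consists of the locally integrable $f$ with $\|f\|_{BMO_{\mathbb B}}=\sup_Q\frac1{|Q|}\int_Q\big\|f-\frac1{|Q|}\int_Qf\big\|_{\mathbb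 B}<\infty$ (supremum over cubes $Q$). An atom is a function $a\in L^\infty_{\mathbb B}$ supported in a cube $Q$ with $\|a\|_\infty\le|Q|^{-1}$ and $\int_Qa=0$; $H^1_{\mathbb B}$ consists of the sums $f=\sum_i\lambda_ia_i$ (convergence in $L^1_{\mathbb B}$) with atoms $a_i$ and scalars with $\sum_i|\lambda_i|<\infty$, and $\|f\|_{H^1_{\mathbb B}}$ is the infimum of $\sum_i|\lambda_i|$ over all such representations. "$U$ maps $X$ boundedly into $Y$" means that there is a constant $C$ such that for all $f\in X$ one has $U(f)\in Y$ (in particular $U(f)<\infty$ almost everywhere) and $\|U(f)\|_Y\le C\|f\|_X$, where $\|h\|_{L^{1,\infty}}=\sup_{s>0}s\,|\{h>s\}|$ for weak $L^1$. -/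

import Mathlib

open MeasureTheory Set Filter Topology
open scoped ENNReal NNReal

namespace FracLP

noncomputable section

/-- Euclidean space `ℝⁿ`. -/
abbrev Rn (n : ℕ) : Type := EuclideanSpace ℝ (Fin n)

/-- The closed cube of `ℝⁿ` with centre `c` and side length `2 * r`, sides parallel to the axes.
It is used only for `0 < r`. -/
def cube {n : ℕ} (c : Rn n) (r : ℝ) : Set (Rn n) :=
  {x | ∀ i, |x i - c i| ≤ r}

/-! ### The Poisson semigroup and its fractional derivatives -/

/-- The Poisson kernel
`P_t(x) = Γ((n+1)/2) π^{-(n+1)/2} t (t² + |x|²)^{-(n+1)/2}` of `ℝⁿ`, for `t > 0`. -/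
def poissonKer (n : ℕ) (t : ℝ) (x : Rn n) : ℝ :=
  Real.Gamma (((n : ℝ) + 1) / 2) / Real.pi ^ (((n : ℝ) + 1) / 2) *
    (t / (t ^ 2 + ‖x‖ ^ 2) ^ (((n : ℝ) + 1) / 2))

/-- The Poisson semigroup `𝒫_t f (x) = ∫ P_t(x - y) f(y) dy` acting on vector-valued functions. -/
def poisson {n : ℕ} {B : Type*} [NormedAddCommGroup B] [NormedSpace ℝ B]
    (f : Rn n → B) (t : ℝ) (x : Rn n) : B :=
  ∫ y, poissonKer n t (x - y) • f y

/-- The smallest integer that strictly exceeds `α` (for `α ≥ 0`). -/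
def order (α : ℝ) : ℕ := ⌊α⌋₊ + 1

/-- The unimodular factor `exp (-iπ(m - α))`, `m` the smallest integer that exceeds `α`.
For a real Banach space (`𝕜 = ℝ`), where there is no imaginary unit, `RCLike.I = 0` and the factor
is `1`. -/
def phase (𝕜 : Type*) [RCLike 𝕜] (α : ℝ) : 𝕜 :=
  NormedSpace.exp (-((RCLike.I : 𝕜) * ((Real.pi * ((order α : ℝ) - α) : ℝ) : 𝕜)))

/-- The fractional derivative
`∂_t^α 𝒫_t f (x) = e^{-iπ(m-α)} / Γ(m-α) ∫_0^∞ (∂_t^m 𝒫_{t+s} f)(x) s^{m-α-1} ds`,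
`m` the smallest integer that exceeds `α`. -/
def fracDeriv (𝕜 : Type*) [RCLike 𝕜] {n : ℕ} {B : Type*} [NormedAddCommGroup B]
    [NormedSpace 𝕜 B] [NormedSpace ℝ B]
    (α : ℝ) (f : Rn n → B) (t : ℝ) (x : Rn n) : B :=
  phase 𝕜 α • ((1 / Real.Gamma ((order α : ℝ) - α)) •
    ∫ s in Ioi (0 : ℝ), s ^ ((order α : ℝ) - α - 1) •
      iteratedDeriv (order α) (fun τ : ℝ => poisson f τ x) (t + s))

/-! ### The square functions -/

/-- The fractional Littlewood--Paley function
`g_α^q(f)(x) = (∫_0^∞ ‖t^α ∂_t^α 𝒫_t f(x)‖^q dt/t)^{1/q}`, with values in `[0, ∞]`. -/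
def gFun (𝕜 : Type*) [RCLike 𝕜] {n : ℕ} {B : Type*} [NormedAddCommGroup B]
    [NormedSpace 𝕜 B] [NormedSpace ℝ B]
    (q α : ℝ) (f : Rn n → B) (x : Rn n) : ℝ≥0∞ :=
  (∫⁻ t in Ioi (0 : ℝ),
    ‖t ^ α • fracDeriv 𝕜 α f t x‖ₑ ^ q * ENNReal.ofReal (1 / t)) ^ (1 / q)

/-- The cone `Γ(x) = {(y, t) : t > 0, |x - y| < t}`. -/
def cone {n : ℕ} (x : Rn n) : Set (Rn n × ℝ) :=
  {z | 0 < z.2 ∧ ‖x - z.1‖ < z.2}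

/-- The fractional area function
`S_α^q(f)(x) = (∬_{Γ(x)} ‖t^α ∂_t^α 𝒫_t f(y)‖^q dy dt / t^{n+1})^{1/q}`, with values in `[0, ∞]`. -/
def areaFun (𝕜 : Type*) [RCLike 𝕜] {n : ℕ} {B : Type*} [NormedAddCommGroup B]
    [NormedSpace 𝕜 B] [NormedSpace ℝ B]
    (q α : ℝ) (f : Rn n → B) (x : Rn n) : ℝ≥0∞ :=
  (∫⁻ z in cone x,
    ‖z.2 ^ α • fracDeriv 𝕜 α f z.2 z.1‖ₑ ^ q * ENNReal.ofReal (1 / z.2 ^ (n + 1))) ^ (1 / q)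

/-! ### BMO and the atomic Hardy space -/

/-- The BMO seminorm `sup_Q |Q|⁻¹ ∫_Q ‖f - f_Q‖`, the supremum being over all cubes. It is meant
for locally integrable functions. -/
def bmoSeminorm {n : ℕ} {F : Type*} [NormedAddCommGroup F] [NormedSpace ℝ F]
    (f : Rn n → F) : ℝ≥0∞ :=
  ⨆ (c : Rn n) (r : ℝ) (_ : 0 < r),
    (volume (cube c r))⁻¹ * ∫⁻ x in cube c r, ‖f x - ⨍ y in cube c r, f y‖ₑ

/-- Membership in `BMO`. -/
def MemBMO {n : ℕ} {F : Type*} [NormedAddCommGroup F] [NormedSpace ℝ F]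
    (f : Rn n → F) : Prop :=
  LocallyIntegrable f ∧ bmoSeminorm f < ∞

/-- Vector-valued atoms: bounded functions supported in a cube `Q`, with `‖a‖_∞ ≤ |Q|⁻¹` and
`∫_Q a = 0`. -/
def IsAtom {n : ℕ} {B : Type*} [NormedAddCommGroup B] [NormedSpace ℝ B]
    (a : Rn n → B) : Prop :=
  AEStronglyMeasurable a ∧ ∃ (c : Rn n) (r : ℝ), 0 < r ∧
    Function.support a ⊆ cube c r ∧
    eLpNorm a ∞ volume ≤ (volume (cube c r))⁻¹ ∧
    ∫ x in cube c r, a x = 0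

/-- `f = ∑ i, c i • a i` is an atomic decomposition of `f`: the `a i` are atoms, `∑ ‖c i‖ < ∞`, and
the series converges to `f` in `L¹`. -/
def IsAtomicDecomp {𝕜 : Type*} [RCLike 𝕜] {n : ℕ} {B : Type*} [NormedAddCommGroup B]
    [NormedSpace 𝕜 B] [NormedSpace ℝ B]
    (f : Rn n → B) (c : ℕ → 𝕜) (a : ℕ → Rn n → B) : Prop :=
  (∀ i, IsAtom (a i)) ∧ Summable (fun i => ‖c i‖) ∧
    Tendsto (fun N => eLpNorm (fun x => f x - ∑ i ∈ Finset.range N, c i • a i x) 1 volume)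
      atTop (𝓝 0)

/-- Membership in the atomic Hardy space `H¹_B(ℝⁿ)`. -/
def MemH1 (𝕜 : Type*) [RCLike 𝕜] {n : ℕ} {B : Type*} [NormedAddCommGroup B]
    [NormedSpace 𝕜 B] [NormedSpace ℝ B] (f : Rn n → B) : Prop :=
  AEStronglyMeasurable f ∧
    ∃ (c : ℕ → 𝕜) (a : ℕ → Rn n → B), IsAtomicDecomp f c a

/-- The norm of `H¹_B(ℝⁿ)`: the infimum of `∑ ‖c i‖` over all atomic decompositions. -/
def h1Norm (𝕜 : Type*) [RCLike 𝕜] {n : ℕ} {B : Type*} [NormedAddCommGroup B]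
    [NormedSpace 𝕜 B] [NormedSpace ℝ B] (f : Rn n → B) : ℝ≥0∞ :=
  ⨅ (c : ℕ → 𝕜) (a : ℕ → Rn n → B) (_ : IsAtomicDecomp f c a), ∑' i, ‖c i‖ₑ

/-! ### Mapping properties of an operator `U` from `B`-valued to `[0, ∞]`-valued functions -/

/-- The `[0, ∞]`-valued function `h` is (almost everywhere equal to) a real-valued function in
`BMO`, of seminorm at most `K`. -/
def InBMOWithBound {n : ℕ} (h : Rn n → ℝ≥0∞) (K : ℝ≥0∞) : Prop :=
  (∀ᵐ x, h x < ∞) ∧ MemBMO (fun x => (h x).toReal) ∧ bmoSeminorm (fun x => (h x).toReal) ≤ K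

section Mapping

variable {n : ℕ} {B : Type*} [NormedAddCommGroup B]

/-- `U` maps `L^∞_{c,B}` (bounded functions with compact support) boundedly into `BMO`. -/
def MapsLinftycToBMO (U : (Rn n → B) → Rn n → ℝ≥0∞) : Prop :=
  ∃ C : ℝ≥0, ∀ f : Rn n → B, MemLp f ∞ volume → HasCompactSupport f →
    InBMOWithBound (U f) (C * eLpNorm f ∞ volume)

/-- `U` maps `H¹_B` boundedly into `L¹`. -/
def MapsH1ToL1 (𝕜 : Type*) [RCLike 𝕜] [NormedSpace 𝕜 B] [NormedSpace ℝ B]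
    (U : (Rn n → B) → Rn n → ℝ≥0∞) : Prop :=
  ∃ C : ℝ≥0, ∀ f : Rn n → B, MemH1 𝕜 f →
    MemLp (U f) 1 volume ∧ eLpNorm (U f) 1 volume ≤ C * h1Norm 𝕜 f

/-- `U` maps `L^p_B` boundedly into `L^p`. -/
def MapsLpToLp (U : (Rn n → B) → Rn n → ℝ≥0∞) (p : ℝ) : Prop :=
  ∃ C : ℝ≥0, ∀ f : Rn n → B, MemLp f (ENNReal.ofReal p) volume →
    MemLp (U f) (ENNReal.ofReal p) volume ∧
      eLpNorm (U f) (ENNReal.ofReal p) volume ≤ C * eLpNorm f (ENNReal.ofReal p) volume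

/-- `U` maps `BMO_{c,B}` (functions in `BMO` with compact support) boundedly into `BMO`. -/
def MapsBMOcToBMO [NormedSpace ℝ B] (U : (Rn n → B) → Rn n → ℝ≥0∞) : Prop :=
  ∃ C : ℝ≥0, ∀ f : Rn n → B, MemBMO f → HasCompactSupport f →
    InBMOWithBound (U f) (C * bmoSeminorm f)

/-- `U` maps `L¹_B` boundedly into weak `L¹`. -/
def MapsL1ToWeakL1 (U : (Rn n → B) → Rn n → ℝ≥0∞) : Prop :=
  ∃ C : ℝ≥0, ∀ f : Rn n → B, MemLp f 1 volume →
    AEMeasurable (U f) volume ∧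
      ∀ s : ℝ≥0, 0 < s → (s : ℝ≥0∞) * volume {x | (s : ℝ≥0∞) < U f x} ≤ C * eLpNorm f 1 volume

end Mapping

end

end FracLP

/-! ### Kernel estimates: from the Poisson kernel to square functions of Calderón–Zygmund type. -/

namespace FracLP

noncomputable section

/-! ### Homogeneous radial functions -/

/-! Both square functions are L^q norms of (w, t) ↦ K_t f(x - w) against a measure on the cone |w| ≤
t whose t-marginal is at most a multiple of dt/t: δ₀ ⊗ dt/t for g, and 1_{|w|<t} dw dt / t^{n+1} for
the area function. Up to a unimodular factor, K_t is convolution with the kernel of t^α ∂_t^α P_t.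
This kernel is radial, of size t^α (t+ρ)^{-n-α}, and its increments in ρ decay by one power more.
Minkowski, Fatou and these two bounds give `exists_isCZ`: U is sublinear, translation invariant and
lower semicontinuous, with size, regularity and cancellation estimates. Everything afterwards uses
only `IsCZ`; the geometry of B plays no role.

All six statements are tied to one local condition, `WeakOnBounded`: if ‖f‖ ≤ M and f lives in a box
Q, then U f exceeds s on a subset of Q of measure at most C (M/s)|Q|. Chebyshev derives it from a
strong or weak type bound. A BMO bound for U f determines U f only up to a constant, and an H¹ bound
applies only to functions of mean zero. Both defects are repaired with a second box of the same
size, at distance comparable to its side, where the size estimate controls U. The BMO-to-BMO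
statement contains the L^∞-to-BMO one.

Conversely, a Calderón–Zygmund decomposition upgrades `WeakOnBounded` to `SmallOnIntegrable`: if the
mean of ‖f‖ on Q is at most λ, then U f > Kλ only on a fraction ε of Q. Now cut a general f into a
part near a box and a far part g. Regularity makes U g almost constant on the box, so U f differs
from a constant by more than Kλ only on a small fraction of the box. Here λ is a bound for the
maximal function of f at one point of the box, or for the BMO seminorm of f.

The dyadic inequality `good_lambda` turns such local oscillation bounds into global ones. Relative
to the maximal function it gives weak type (1,1) and strong type (p,p). When the oscillation is
controlled on every box it gives geometric decay of distribution functions, as in the John–Strömberg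
theorem, hence a BMO bound. The H¹ estimate follows from the L² bound near an atom and cancellation
far from it. -/

/-- `IsHomog d F`: the function `F t ρ` is a finite sum of monomials `c t^a (t² + ρ²)^{-b}`, `b ≥ 0`,
of degree `a - 2b = d`. -/
inductive IsHomog : ℝ → (ℝ → ℝ → ℝ) → Prop
  | mono {d : ℝ} (c b : ℝ) (a : ℕ) (hb : 0 ≤ b) (hd : d = a - 2 * b) :
      IsHomog d (fun t ρ => c * (t ^ a * (t ^ 2 + ρ ^ 2) ^ (-b)))
  | add {d : ℝ} {F G : ℝ → ℝ → ℝ} (hF : IsHomog d F) (hG : IsHomog d G) :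
      IsHomog d (fun t ρ => F t ρ + G t ρ)

theorem hasDerivAt_monomial (c b : ℝ) (a : ℕ) {t : ℝ} (ht : 0 < t) (ρ : ℝ) :
    HasDerivAt (fun t : ℝ => c * (t ^ a * (t ^ 2 + ρ ^ 2) ^ (-b)))
      (c * ((a * t ^ (a - 1)) * (t ^ 2 + ρ ^ 2) ^ (-b) +
        t ^ a * ((2 * t) * (-b) * (t ^ 2 + ρ ^ 2) ^ (-b - 1)))) t := by
  have hpos : t ^ 2 + ρ ^ 2 ≠ 0 := by positivity
  have h1 : HasDerivAt (fun t : ℝ => t ^ 2 + ρ ^ 2) (2 * t) t := by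
    simpa using (hasDerivAt_pow 2 t).add_const (ρ ^ 2)
  exact ((hasDerivAt_pow a t).mul (h1.rpow_const (p := -b) (Or.inl hpos))).const_mul c

/-- The class is closed under ∂_t because differentiating t^a or (t²+ρ²)^{-b} produces monomials of
the same kind, with the degree a - 2b lowered by one. -/
theorem IsHomog.exists_deriv {d : ℝ} {F : ℝ → ℝ → ℝ} (hF : IsHomog d F) :
    ∃ F' : ℝ → ℝ → ℝ, IsHomog (d - 1) F' ∧
      ∀ t, 0 < t → ∀ ρ, HasDerivAt (fun t => F t ρ) (F' t ρ) t := by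
  induction hF with
  | mono c b a hb hd =>
    -- When the exponent of t is zero only the second factor contributes, and a single monomial
    -- suffices.
    rcases a with _ | a
    · refine ⟨_, IsHomog.mono (-2 * b * c) (b + 1) 1 (by linarith) (by subst hd; push_cast; ring),
        fun t ht ρ => ?_⟩
      convert hasDerivAt_monomial c b 0 ht ρ using 1
      rw [neg_add']
      push_cast
      ring
    · refine ⟨_, (IsHomog.mono (c * (a + 1)) b a hb (by subst hd; push_cast; ring)).add
        (IsHomog.mono (-2 * b * c) (b + 1) (a + 2) (by linarith)
          (by subst hd; push_cast; ring)), fun t ht ρ => ?_⟩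
      convert hasDerivAt_monomial c b (a + 1) ht ρ using 1
      rw [neg_add']
      push_cast
      ring
  | add hF hG ihF ihG =>
    obtain ⟨F', hF', hdF⟩ := ihF
    obtain ⟨G', hG', hdG⟩ := ihG
    exact ⟨_, hF'.add hG', fun t ht ρ => (hdF t ht ρ).add (hdG t ht ρ)⟩

theorem rpow_sq_add_sq_le {t ρ b : ℝ} (ht : 0 < t) (hρ : 0 ≤ ρ) (hb : 0 ≤ b) :
    (t ^ 2 + ρ ^ 2) ^ (-b) ≤ 2 ^ b * (t + ρ) ^ (-2 * b) := by
  have h0 : 0 < t + ρ := by linarith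
  have h1 : (t + ρ) ^ 2 / 2 ≤ t ^ 2 + ρ ^ 2 := by nlinarith [sq_nonneg (t - ρ)]
  calc (t ^ 2 + ρ ^ 2) ^ (-b) ≤ ((t + ρ) ^ 2 / 2) ^ (-b) :=
        Real.rpow_le_rpow_of_nonpos (by positivity) h1 (by linarith)
    _ = 2 ^ b * (t + ρ) ^ (-2 * b) := by
        rw [Real.div_rpow (by positivity) (by norm_num), Real.rpow_neg (by norm_num : (0:ℝ) ≤ 2),
          div_inv_eq_mul, mul_comm, ← Real.rpow_natCast (t + ρ) 2, ← Real.rpow_mul h0.le]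
        congr 2
        push_cast; ring

/-- Since t ≤ t + ρ and t² + ρ² is comparable to (t+ρ)², only the degree of a monomial matters for
its size. -/
theorem IsHomog.exists_bound {d : ℝ} {F : ℝ → ℝ → ℝ} (hF : IsHomog d F) :
    ∃ C : ℝ, 0 ≤ C ∧ ∀ t, 0 < t → ∀ ρ, 0 ≤ ρ → |F t ρ| ≤ C * (t + ρ) ^ d := by
  induction hF with
  | mono c b a hb hd =>
    refine ⟨|c| * 2 ^ b, by positivity, fun t ht ρ hρ => ?_⟩
    have h0 : 0 < t + ρ := by linarith
    rw [abs_mul, abs_of_nonneg (by positivity : 0 ≤ t ^ a * (t ^ 2 + ρ ^ 2) ^ (-b)), mul_assoc]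
    refine mul_le_mul_of_nonneg_left ?_ (abs_nonneg c)
    calc t ^ a * (t ^ 2 + ρ ^ 2) ^ (-b) ≤ (t + ρ) ^ a * (2 ^ b * (t + ρ) ^ (-2 * b)) := by
          gcongr
          · linarith
          · exact rpow_sq_add_sq_le ht hρ hb
      _ = 2 ^ b * (t + ρ) ^ d := by
          rw [mul_left_comm, ← Real.rpow_natCast, ← Real.rpow_add h0, hd]
          congr 2; ring
  | add hF hG ihF ihG =>
    obtain ⟨C, hC, hF⟩ := ihF
    obtain ⟨D, hD, hG⟩ := ihG
    refine ⟨C + D, by positivity, fun t ht ρ hρ => (abs_add_le _ _).trans ?_⟩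
    rw [add_mul]
    exact add_le_add (hF t ht ρ hρ) (hG t ht ρ hρ)

/-- Mean value theorem in ρ. The restriction |ρ - ρ'| ≤ (t+ρ)/2 keeps t + σ comparable to t + ρ for
every σ between ρ and ρ', so one derivative costs exactly one power of t + ρ. -/
theorem IsHomog.exists_lipschitz {d : ℝ} {F : ℝ → ℝ → ℝ} (hF : IsHomog d F) :
    ∃ C : ℝ, 0 ≤ C ∧ ∀ t, 0 < t → ∀ ρ, 0 ≤ ρ → ∀ ρ', 0 ≤ ρ' → |ρ - ρ'| ≤ (t + ρ) / 2 →
      |F t ρ - F t ρ'| ≤ C * |ρ - ρ'| * (t + ρ) ^ (d - 1) := by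
  induction hF with
  | mono c b a hb hd =>
    set A : ℝ := |c| * (2 * b * 2 ^ (a + 1) * 2 ^ (b + 1) * 2 ^ (2 * b + 2)) with hA
    refine ⟨A, by positivity, fun t ht ρ hρ ρ' hρ' h => ?_⟩
    have h0 : 0 < t + ρ := by linarith
    -- The interval is cut off at 0, since the size bounds hold for nonnegative radii only.
    set S : Set ℝ := Icc (max 0 (ρ - (t + ρ) / 2)) (ρ + (t + ρ) / 2) with hS
    have hρS : ρ ∈ S := ⟨max_le hρ (by linarith), by linarith⟩
    have hρS' : ρ' ∈ S := by
      rw [abs_le] at h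
      exact ⟨max_le hρ' (by linarith), by linarith⟩
    have hder : ∀ σ ∈ S, HasDerivWithinAt (fun σ : ℝ => c * (t ^ a * (t ^ 2 + σ ^ 2) ^ (-b)))
        (c * (t ^ a * ((2 * σ) * (-b) * (t ^ 2 + σ ^ 2) ^ (-b - 1)))) S σ := by
      intro σ _
      have hpos : t ^ 2 + σ ^ 2 ≠ 0 := by positivity
      have h1 : HasDerivAt (fun σ : ℝ => t ^ 2 + σ ^ 2) (2 * σ) σ := by
        simpa using (hasDerivAt_pow 2 σ).const_add (t ^ 2)
      exact (((h1.rpow_const (p := -b) (Or.inl hpos)).const_mul (t ^ a)).const_mul c).hasDerivWithinAt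
    have hbd : ∀ σ ∈ S, ‖c * (t ^ a * ((2 * σ) * (-b) * (t ^ 2 + σ ^ 2) ^ (-b - 1)))‖ ≤
        A * (t + ρ) ^ (d - 1) := by
      intro σ hσ
      have hσ0 : 0 ≤ σ := (le_max_left _ _).trans hσ.1
      have hσ1 : (t + ρ) / 2 ≤ t + σ := by
        have := (le_max_right _ _).trans hσ.1
        linarith
      have hσ2 : t + σ ≤ 2 * (t + ρ) := by
        have := hσ.2
        linarith
      have h2 : (t ^ 2 + σ ^ 2) ^ (-b - 1) ≤ 2 ^ (b + 1) * ((t + ρ) / 2) ^ (-2 * (b + 1)) := by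
        rw [← neg_add']
        refine (rpow_sq_add_sq_le ht hσ0 (by linarith)).trans ?_
        gcongr 2 ^ (b + 1) * ?_
        exact Real.rpow_le_rpow_of_nonpos (by positivity) hσ1 (by nlinarith)
      have h3 : ‖c * (t ^ a * ((2 * σ) * (-b) * (t ^ 2 + σ ^ 2) ^ (-b - 1)))‖ =
          |c| * (2 * b * (t ^ a * σ) * (t ^ 2 + σ ^ 2) ^ (-b - 1)) := by
        rw [Real.norm_eq_abs, abs_mul]
        congr 1
        rw [show t ^ a * ((2 * σ) * (-b) * (t ^ 2 + σ ^ 2) ^ (-b - 1)) =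
          - (2 * b * (t ^ a * σ) * (t ^ 2 + σ ^ 2) ^ (-b - 1)) by ring, abs_neg,
          abs_of_nonneg (by positivity)]
      rw [h3, hA, mul_assoc |c|]
      refine mul_le_mul_of_nonneg_left ?_ (abs_nonneg c)
      have h4 : t ^ a * σ ≤ (2 * (t + ρ)) ^ (a + 1) := by
        rw [pow_succ]
        gcongr
        · linarith
        · linarith
      calc 2 * b * (t ^ a * σ) * (t ^ 2 + σ ^ 2) ^ (-b - 1)
          ≤ 2 * b * (2 * (t + ρ)) ^ (a + 1) * (2 ^ (b + 1) * ((t + ρ) / 2) ^ (-2 * (b + 1))) := by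
            gcongr
        _ = 2 * b * 2 ^ (a + 1) * 2 ^ (b + 1) * 2 ^ (2 * b + 2) * (t + ρ) ^ (d - 1) := by
            rw [mul_pow, Real.div_rpow h0.le (by norm_num),
              show -2 * (b + 1) = -(2 * b + 2) by ring, Real.rpow_neg (by norm_num : (0:ℝ) ≤ 2),
              div_inv_eq_mul, show d - 1 = ((a + 1 : ℕ) : ℝ) + -(2 * b + 2) by
                subst hd; push_cast; ring, Real.rpow_add h0, Real.rpow_natCast]
            ring
    have := (convex_Icc _ _).norm_image_sub_le_of_norm_hasDerivWithin_le hder hbd hρS' hρS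
    rw [Real.norm_eq_abs, Real.norm_eq_abs] at this
    refine this.trans (le_of_eq ?_)
    ring
  | @add F G hF hG ihF ihG =>
    obtain ⟨C, hC, hF⟩ := ihF
    obtain ⟨D, hD, hG⟩ := ihG
    refine ⟨C + D, by positivity, fun t ht ρ hρ ρ' hρ' h => ?_⟩
    rw [show F t ρ + G t ρ - (F t ρ' + G t ρ') = (F t ρ - F t ρ') + (G t ρ - G t ρ') by ring,
      add_mul, add_mul]
    exact (abs_add_le _ _).trans (add_le_add (hF t ht ρ hρ ρ' hρ' h) (hG t ht ρ hρ ρ' hρ' h))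

theorem IsHomog.measurable {d : ℝ} {F : ℝ → ℝ → ℝ} (hF : IsHomog d F) :
    Measurable (fun z : ℝ × ℝ => F z.1 z.2) := by
  induction hF with
  | mono c b a hb hd => fun_prop
  | add hF hG ihF ihG => exact ihF.add ihG

/-! ### An elementary integral -/

/-- Split at s = R: below, the second factor is at most R^{-b}; above, it is at most s^{-b}. The two
pieces give the terms 1/a and 1/(b-a). -/
theorem integrableOn_rpow_mul_add_rpow {a b R : ℝ} (ha : 0 < a) (hab : a < b) (hR : 0 < R) :
    IntegrableOn (fun s : ℝ => s ^ (a - 1) * (R + s) ^ (-b)) (Ioi 0) ∧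
    ∫ s in Ioi (0 : ℝ), s ^ (a - 1) * (R + s) ^ (-b) ≤ (1 / a + 1 / (b - a)) * R ^ (a - b) := by
  have hmeas : Measurable (fun s : ℝ => s ^ (a - 1) * (R + s) ^ (-b)) := by fun_prop
  have hi1 : IntegrableOn (fun s : ℝ => s ^ (a - 1) * R ^ (-b)) (Ioc 0 R) := by
    have := (intervalIntegral.intervalIntegrable_rpow' (a := 0) (b := R) (r := a - 1)
      (by linarith)).mul_const (R ^ (-b))
    rwa [intervalIntegrable_iff_integrableOn_Ioc_of_le hR.le] at this
  have hi2 : IntegrableOn (fun s : ℝ => s ^ (a - b - 1)) (Ioi R) :=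
    integrableOn_Ioi_rpow_of_lt (by linarith) hR
  have hle1 : ∀ s ∈ Ioc 0 R, s ^ (a - 1) * (R + s) ^ (-b) ≤ s ^ (a - 1) * R ^ (-b) := by
    intro s hs
    have : 0 < s := hs.1
    gcongr ?_ * ?_
    exact Real.rpow_le_rpow_of_nonpos hR (by linarith) (by linarith)
  have hle2 : ∀ s ∈ Ioi R, s ^ (a - 1) * (R + s) ^ (-b) ≤ s ^ (a - b - 1) := by
    intro s hs
    have hs' : R < s := hs
    have : 0 < s := hR.trans hs'
    calc s ^ (a - 1) * (R + s) ^ (-b) ≤ s ^ (a - 1) * s ^ (-b) := by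
          gcongr ?_ * ?_
          exact Real.rpow_le_rpow_of_nonpos this (by linarith) (by linarith)
      _ = s ^ (a - b - 1) := by
          rw [← Real.rpow_add this]; congr 1; ring
  have hnn : ∀ s : ℝ, 0 < s → 0 ≤ s ^ (a - 1) * (R + s) ^ (-b) := fun s hs => by positivity
  have hj1 : IntegrableOn (fun s : ℝ => s ^ (a - 1) * (R + s) ^ (-b)) (Ioc 0 R) := by
    refine Integrable.mono' hi1 hmeas.aestronglyMeasurable ?_
    refine (ae_restrict_iff' measurableSet_Ioc).2 (Eventually.of_forall fun s hs => ?_)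
    rw [Real.norm_of_nonneg (hnn s hs.1)]
    exact hle1 s hs
  have hj2 : IntegrableOn (fun s : ℝ => s ^ (a - 1) * (R + s) ^ (-b)) (Ioi R) := by
    refine Integrable.mono' hi2 hmeas.aestronglyMeasurable ?_
    refine (ae_restrict_iff' measurableSet_Ioi).2 (Eventually.of_forall fun s hs => ?_)
    rw [Real.norm_of_nonneg (hnn s (hR.trans hs))]
    exact hle2 s hs
  rw [← Ioc_union_Ioi_eq_Ioi hR.le]
  refine ⟨hj1.union hj2, ?_⟩
  rw [setIntegral_union (Ioc_disjoint_Ioi le_rfl) measurableSet_Ioi hj1 hj2, add_mul]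
  refine add_le_add ?_ ?_
  · refine (setIntegral_mono_on hj1 hi1 measurableSet_Ioc hle1).trans (le_of_eq ?_)
    rw [integral_mul_const, ← intervalIntegral.integral_of_le hR.le,
      integral_rpow (Or.inl (by linarith)), show a - 1 + 1 = a by ring,
      Real.zero_rpow ha.ne', sub_zero, show a - b = a + -b by ring, Real.rpow_add hR]
    ring
  · refine (setIntegral_mono_on hj2 hi2 measurableSet_Ioi hle2).trans (le_of_eq ?_)
    rw [integral_Ioi_rpow_of_lt (by linarith) hR, show a - b - 1 + 1 = a - b by ring,
      show a - b = -(b - a) by ring]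
    rw [neg_div_neg_eq]
    ring

theorem lintegral_rpow_mul_add_rpow_le {a b R : ℝ} (ha : 0 < a) (hab : a < b) (hR : 0 < R) :
    ∫⁻ s in Ioi (0 : ℝ), ENNReal.ofReal (s ^ (a - 1) * (R + s) ^ (-b)) ≤
      ENNReal.ofReal ((1 / a + 1 / (b - a)) * R ^ (a - b)) := by
  obtain ⟨h1, h2⟩ := integrableOn_rpow_mul_add_rpow ha hab hR
  rw [← ofReal_integral_eq_lintegral_ofReal h1]
  · exact ENNReal.ofReal_le_ofReal h2
  · refine (ae_restrict_iff' measurableSet_Ioi).2 (Eventually.of_forall fun s hs => ?_)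
    have : 0 < s := hs
    have : 0 < R + s := by linarith
    simp only [Pi.zero_apply]
    positivity

/-! ### The kernel of the fractional derivative -/

/-- `t^α / Γ(a) ∫_0^∞ s^{a-1} F(t+s, ρ) ds`. -/
def fracKer (α a : ℝ) (F : ℝ → ℝ → ℝ) (t ρ : ℝ) : ℝ :=
  t ^ α * ((1 / Real.Gamma a) * ∫ s in Ioi (0 : ℝ), s ^ (a - 1) * F (t + s) ρ)

theorem integrableOn_rpow_mul_shift {a b : ℝ} {F : ℝ → ℝ → ℝ} (hF : IsHomog (-b) F) (ha : 0 < a)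
    (hab : a < b) {t ρ : ℝ} (ht : 0 < t) (hρ : 0 ≤ ρ) :
    IntegrableOn (fun s : ℝ => s ^ (a - 1) * F (t + s) ρ) (Ioi 0) := by
  obtain ⟨C, hC, hF'⟩ := hF.exists_bound
  have hR : 0 < t + ρ := by linarith
  refine Integrable.mono' ((integrableOn_rpow_mul_add_rpow ha hab hR).1.const_mul C) ?_ ?_
  · have h1 : Measurable (fun s : ℝ => F (t + s) ρ) :=
      hF.measurable.comp (f := fun s : ℝ => (t + s, ρ)) (by fun_prop)
    exact (Measurable.mul (by fun_prop) h1).aestronglyMeasurable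
  · refine (ae_restrict_iff' measurableSet_Ioi).2 (Eventually.of_forall fun s hs => ?_)
    have hs' : 0 < s := hs
    rw [norm_mul, Real.norm_of_nonneg (by positivity), Real.norm_eq_abs, mul_left_comm]
    gcongr
    have := hF' (t + s) (by linarith) ρ hρ
    rwa [show t + ρ + s = t + s + ρ by ring]

/-- Averaging against s^{a-1} costs a powers of decay. With a = m - α and b = n + m this leaves the
exponent -(n+α) for the size and -(n+α+1) for increments. -/
theorem fracKer_bound {a b : ℝ} {F : ℝ → ℝ → ℝ} (hF : IsHomog (-b) F) (ha : 0 < a)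
    (hab : a < b) (α : ℝ) :
    ∃ C : ℝ, 0 ≤ C ∧ (∀ t, 0 < t → ∀ ρ, 0 ≤ ρ →
      |fracKer α a F t ρ| ≤ C * (t ^ α * (t + ρ) ^ (a - b))) ∧
      ∀ t, 0 < t → ∀ ρ, 0 ≤ ρ → ∀ ρ', 0 ≤ ρ' → |ρ - ρ'| ≤ (t + ρ) / 2 →
      |fracKer α a F t ρ - fracKer α a F t ρ'| ≤
        C * |ρ - ρ'| * (t ^ α * (t + ρ) ^ (a - b - 1)) := by
  obtain ⟨C₁, hC₁, h₁⟩ := hF.exists_bound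
  obtain ⟨C₂, hC₂, h₂⟩ := hF.exists_lipschitz
  have hG : 0 < Real.Gamma a := Real.Gamma_pos_of_pos ha
  -- One estimate serves twice: β = b for the size and β = b + 1 for the increments.
  have key : ∀ (β : ℝ), a < β → ∃ D : ℝ, 0 ≤ D ∧ ∀ t, 0 < t → ∀ ρ, 0 ≤ ρ → ∀ M : ℝ, 0 ≤ M →
      ∀ H : ℝ → ℝ, (∀ s, 0 < s → |H s| ≤ M * (t + s + ρ) ^ (-β)) →
      |t ^ α * ((1 / Real.Gamma a) * ∫ s in Ioi (0 : ℝ), s ^ (a - 1) * H s)| ≤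
        D * M * (t ^ α * (t + ρ) ^ (a - β)) := by
    intro β hβ
    have : 0 < β - a := by linarith
    refine ⟨1 / Real.Gamma a * (1 / a + 1 / (β - a)), by positivity,
      fun t ht ρ hρ M hM H hH => ?_⟩
    obtain ⟨hi, hle⟩ := integrableOn_rpow_mul_add_rpow ha hβ (by linarith : 0 < t + ρ)
    have hn : ‖∫ s in Ioi (0 : ℝ), s ^ (a - 1) * H s‖ ≤
        ∫ s in Ioi (0 : ℝ), M * (s ^ (a - 1) * (t + ρ + s) ^ (-β)) := by
      refine norm_integral_le_of_norm_le (hi.const_mul M) ?_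
      refine (ae_restrict_iff' measurableSet_Ioi).2 (Eventually.of_forall fun s hs => ?_)
      have hs' : 0 < s := hs
      rw [norm_mul, Real.norm_of_nonneg (by positivity), Real.norm_eq_abs, mul_left_comm]
      gcongr
      have := hH s hs'
      rwa [show t + ρ + s = t + s + ρ by ring]
    rw [integral_const_mul, Real.norm_eq_abs] at hn
    rw [abs_mul, abs_mul, abs_of_nonneg (by positivity : 0 ≤ t ^ α),
      abs_of_nonneg (by positivity : 0 ≤ 1 / Real.Gamma a)]
    calc t ^ α * (1 / Real.Gamma a * |∫ s in Ioi (0 : ℝ), s ^ (a - 1) * H s|)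
        ≤ t ^ α * (1 / Real.Gamma a * (M * ((1 / a + 1 / (β - a)) * (t + ρ) ^ (a - β)))) := by
          gcongr
          exact hn.trans (by gcongr)
      _ = _ := by ring
  obtain ⟨D₁, hD₁, k₁⟩ := key b hab
  obtain ⟨D₂, hD₂, k₂⟩ := key (b + 1) (by linarith)
  refine ⟨D₁ * C₁ + D₂ * C₂, by positivity, fun t ht ρ hρ => ?_, fun t ht ρ hρ ρ' hρ' h => ?_⟩
  · have hR : 0 < t + ρ := by linarith
    refine (k₁ t ht ρ hρ C₁ hC₁ (fun s => F (t + s) ρ)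
      (fun s hs => h₁ (t + s) (by linarith) ρ hρ)).trans ?_
    gcongr
    have : 0 ≤ D₂ * C₂ := by positivity
    linarith
  · have hR : 0 < t + ρ := by linarith
    have hsub : fracKer α a F t ρ - fracKer α a F t ρ' = t ^ α * ((1 / Real.Gamma a) *
        ∫ s in Ioi (0 : ℝ), s ^ (a - 1) * (F (t + s) ρ - F (t + s) ρ')) := by
      simp only [fracKer, mul_sub]
      rw [integral_sub (integrableOn_rpow_mul_shift hF ha hab ht hρ)
        (integrableOn_rpow_mul_shift hF ha hab ht hρ')]
      ring
    rw [hsub]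
    refine (k₂ t ht ρ hρ (C₂ * |ρ - ρ'|) (by positivity) _ (fun s hs => ?_)).trans ?_
    · have := h₂ (t + s) (by linarith) ρ hρ ρ' hρ' (by linarith)
      rwa [show -(b + 1) = -b - 1 by ring]
    · rw [show a - (b + 1) = a - b - 1 by ring, ← mul_assoc D₂]
      gcongr
      have : 0 ≤ D₁ * C₁ := by positivity
      linarith

theorem measurable_fracKer {d : ℝ} {F : ℝ → ℝ → ℝ} (hF : IsHomog d F) (α a : ℝ) :
    Measurable (fun z : ℝ × ℝ => fracKer α a F z.1 z.2) := by
  unfold fracKer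
  have h : StronglyMeasurable (fun z : ℝ × ℝ =>
      ∫ s in Ioi (0 : ℝ), s ^ (a - 1) * F (z.1 + s) z.2) := by
    refine StronglyMeasurable.integral_prod_right (f := fun (z : ℝ × ℝ) (s : ℝ) =>
      s ^ (a - 1) * F (z.1 + s) z.2) ?_
    have h1 : Measurable (fun p : (ℝ × ℝ) × ℝ => F (p.1.1 + p.2) p.1.2) :=
      hF.measurable.comp (f := fun p : (ℝ × ℝ) × ℝ => (p.1.1 + p.2, p.1.2)) (by fun_prop)
    exact (Measurable.mul (by fun_prop) h1).stronglyMeasurable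
  have h2 := h.measurable
  fun_prop

/-- The successive `t`-derivatives of the Poisson kernel, as functions of `t` and `ρ = |x|`. -/
theorem exists_poissonKer_derivs (n : ℕ) : ∃ D : ℕ → ℝ → ℝ → ℝ,
    (∀ t (x : Rn n), poissonKer n t x = D 0 t ‖x‖) ∧
    (∃ C : ℝ, 0 ≤ C ∧ ∀ t, 0 < t → ∀ ρ, 0 ≤ ρ → |D 0 t ρ| ≤ C * t * (t + ρ) ^ (-((n : ℝ) + 1))) ∧
    (∀ j : ℕ, IsHomog (-((n : ℝ) + j)) (D j)) ∧
    ∀ (j : ℕ) (t : ℝ), 0 < t → ∀ ρ, HasDerivAt (fun t => D j t ρ) (D (j + 1) t ρ) t := by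
  set c : ℝ := Real.Gamma (((n : ℝ) + 1) / 2) / Real.pi ^ (((n : ℝ) + 1) / 2) with hc
  set b : ℝ := ((n : ℝ) + 1) / 2 with hb
  have hb0 : 0 ≤ b := by positivity
  have h0 : IsHomog (-((n : ℝ) + (0 : ℕ))) (fun t ρ => c * (t ^ 1 * (t ^ 2 + ρ ^ 2) ^ (-b))) :=
    IsHomog.mono c b 1 hb0 (by rw [hb]; push_cast; ring)
  -- Homogeneity is bundled with the function so that the choice of a derivative can be iterated.
  have hstep : ∀ (j : ℕ) (F : {F : ℝ → ℝ → ℝ // IsHomog (-((n : ℝ) + j)) F}),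
      ∃ F' : {F : ℝ → ℝ → ℝ // IsHomog (-((n : ℝ) + (j + 1 : ℕ))) F},
        ∀ t, 0 < t → ∀ ρ, HasDerivAt (fun t => F.1 t ρ) (F'.1 t ρ) t := by
    rintro j ⟨F, hF⟩
    obtain ⟨F', hF', hd⟩ := hF.exists_deriv
    refine ⟨⟨F', ?_⟩, hd⟩
    convert hF' using 1
    push_cast; ring
  choose next hnext using hstep
  let D : ∀ j : ℕ, {F : ℝ → ℝ → ℝ // IsHomog (-((n : ℝ) + j)) F} :=
    fun j => Nat.rec ⟨_, h0⟩ (fun j F => next j F) j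
  refine ⟨fun j => (D j).1, fun t x => ?_, ⟨|c| * 2 ^ b, by positivity, fun t ht ρ hρ => ?_⟩,
    fun j => (D j).2, fun j t ht ρ => hnext j (D j) t ht ρ⟩
  · change _ = c * (t ^ 1 * (t ^ 2 + ‖x‖ ^ 2) ^ (-b))
    rw [poissonKer, ← hb, ← hc, pow_one, Real.rpow_neg (by positivity), div_eq_mul_inv t]
  · change |c * (t ^ 1 * (t ^ 2 + ρ ^ 2) ^ (-b))| ≤ _
    rw [abs_mul, abs_of_nonneg (by positivity : 0 ≤ t ^ 1 * (t ^ 2 + ρ ^ 2) ^ (-b)), pow_one]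
    have := rpow_sq_add_sq_le ht hρ hb0
    rw [show -2 * b = -((n : ℝ) + 1) by rw [hb]; ring] at this
    calc |c| * (t * (t ^ 2 + ρ ^ 2) ^ (-b))
        ≤ |c| * (t * (2 ^ b * (t + ρ) ^ (-((n : ℝ) + 1)))) := by gcongr
      _ = _ := by ring

end

end FracLP

namespace FracLP

noncomputable section

/-! ### Admissible functions and convolution with radial kernels -/

variable {n : ℕ} {B : Type*} [NormedAddCommGroup B]

/-- The weight `(1 + |y|)^{-(n+δ)}`. -/
def wgt (n : ℕ) (δ : ℝ) (y : Rn n) : ℝ := (1 + ‖y‖) ^ (-((n : ℝ) + δ))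

/-- Functions that are integrable against the weight `wgt n δ`. -/
def Adm (δ : ℝ) (f : Rn n → B) : Prop :=
  AEStronglyMeasurable f volume ∧ ∫⁻ y, ‖f y‖ₑ * ENNReal.ofReal (wgt n δ y) < ∞

theorem wgt_nonneg (n : ℕ) (δ : ℝ) (y : Rn n) : 0 ≤ wgt n δ y := by
  unfold wgt; positivity

theorem wgt_le_one {δ : ℝ} (hδ : 0 ≤ δ) (y : Rn n) : wgt n δ y ≤ 1 := by
  unfold wgt
  apply Real.rpow_le_one_of_one_le_of_nonpos
  · linarith [norm_nonneg y]
  · have : (0 : ℝ) ≤ n := by positivity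
    linarith

theorem measurable_wgt (n : ℕ) (δ : ℝ) : Measurable (wgt n δ) := by
  unfold wgt; fun_prop

theorem lintegral_wgt_le {δ : ℝ} (hδ : 0 ≤ δ) (f : Rn n → B) :
    ∫⁻ y, ‖f y‖ₑ * ENNReal.ofReal (wgt n δ y) ≤ ∫⁻ y, ‖f y‖ₑ := by
  refine lintegral_mono fun y => ?_
  calc ‖f y‖ₑ * ENNReal.ofReal (wgt n δ y) ≤ ‖f y‖ₑ * 1 := by
        gcongr
        exact ENNReal.ofReal_le_one.2 (wgt_le_one hδ y)
    _ = ‖f y‖ₑ := mul_one _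

theorem _root_.MeasureTheory.Integrable.adm {δ : ℝ} (hδ : 0 ≤ δ) {f : Rn n → B} (hf : Integrable f) :
    Adm δ f :=
  ⟨hf.1, (lintegral_wgt_le hδ f).trans_lt hf.2⟩

theorem memLp_wgt {δ : ℝ} (hδ : 0 < δ) (p : ℝ≥0∞) (hp : 1 ≤ p) : MemLp (wgt n δ) p volume := by
  have h1 : MemLp (wgt n δ) 1 volume := by
    rw [memLp_one_iff_integrable]
    exact integrable_one_add_norm (by simp [hδ])
  have h2 : MemLp (wgt n δ) ∞ volume := by
    refine memLp_top_of_bound (measurable_wgt n δ).aestronglyMeasurable 1 ?_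
    refine Eventually.of_forall fun y => ?_
    rw [Real.norm_of_nonneg (wgt_nonneg n δ y)]
    exact wgt_le_one hδ.le y
  rcases eq_or_ne p ∞ with rfl | hp'
  · exact h2
  refine ⟨(measurable_wgt n δ).aestronglyMeasurable, ?_⟩
  rw [eLpNorm_lt_top_iff_lintegral_rpow_enorm_lt_top (by positivity) hp']
  refine lt_of_le_of_lt (lintegral_mono fun y => ?_)
    ((memLp_one_iff_integrable.1 h1).2)
  have h1p : 1 ≤ p.toReal := by
    rw [← ENNReal.toReal_one]
    exact ENNReal.toReal_mono hp' hp
  have : ‖wgt n δ y‖ₑ ≤ 1 := by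
    rw [Real.enorm_of_nonneg (wgt_nonneg n δ y)]
    exact ENNReal.ofReal_le_one.2 (wgt_le_one hδ.le y)
  calc ‖wgt n δ y‖ₑ ^ p.toReal ≤ ‖wgt n δ y‖ₑ ^ (1 : ℝ) :=
        ENNReal.rpow_le_rpow_of_exponent_ge this h1p
    _ = ‖wgt n δ y‖ₑ := ENNReal.rpow_one _

/-- Hölder against the weight, which lies in every L^{p'}. The case p = ∞ is included, so constants
are admissible; the BMO argument needs this. -/
theorem _root_.MeasureTheory.MemLp.adm {δ : ℝ} (hδ : 0 < δ) {f : Rn n → B} {p : ℝ≥0∞} (hp : 1 ≤ p)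
    (hf : MemLp f p volume) : Adm δ f := by
  refine ⟨hf.1, ?_⟩
  have hpq : ENNReal.HolderConjugate p (ENNReal.conjExponent p) := .conjExponent hp
  have := (memLp_wgt (n := n) hδ (ENNReal.conjExponent p) hpq.symm.one_le).integrable_mul
    (p := ENNReal.conjExponent p) (q := p) hf.norm
  refine lt_of_eq_of_lt (lintegral_congr fun y => ?_) this.2
  rw [Pi.mul_apply, enorm_mul, enorm_norm, mul_comm, Real.enorm_of_nonneg (wgt_nonneg n δ y)]

theorem Adm.add {δ : ℝ} {f g : Rn n → B} (hf : Adm δ f) (hg : Adm δ g) :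
    Adm δ (fun y => f y + g y) := by
  refine ⟨hf.1.add hg.1, ?_⟩
  have hm : AEMeasurable (fun y : Rn n => ‖f y‖ₑ * ENNReal.ofReal (wgt n δ y)) volume :=
    hf.1.enorm.mul (measurable_wgt n δ).ennreal_ofReal.aemeasurable
  refine lt_of_le_of_lt (lintegral_mono fun y => ?_)
    ((lintegral_add_left' hm _).trans_lt (ENNReal.add_lt_top.2 ⟨hf.2, hg.2⟩))
  rw [← add_mul]
  gcongr
  exact enorm_add_le _ _

theorem Adm.congr {δ : ℝ} {f g : Rn n → B} (hf : Adm δ f) (hfg : f =ᵐ[volume] g) : Adm δ g := by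
  refine ⟨hf.1.congr hfg, ?_⟩
  convert hf.2 using 1
  refine lintegral_congr_ae ?_
  filter_upwards [hfg] with y hy
  rw [hy]

variable [NormedSpace ℝ B]

theorem Adm.smul_bound {δ : ℝ} {f : Rn n → B} (hf : Adm δ f) {h : Rn n → ℝ} (hh : Measurable h)
    {C : ℝ} (hC : ∀ y, |h y| ≤ C * wgt n δ y) :
    Integrable (fun y => h y • f y) ∧
      ‖∫ y, h y • f y‖ₑ ≤ ENNReal.ofReal C * ∫⁻ y, ‖f y‖ₑ * ENNReal.ofReal (wgt n δ y) := by
  have hle : ∫⁻ y, ‖h y • f y‖ₑ ≤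
      ENNReal.ofReal C * ∫⁻ y, ‖f y‖ₑ * ENNReal.ofReal (wgt n δ y) := by
    rw [← lintegral_const_mul' _ _ ENNReal.ofReal_ne_top]
    refine lintegral_mono fun y => ?_
    rw [enorm_smul, mul_comm ‖f y‖ₑ, ← mul_assoc, ← ENNReal.ofReal_mul' (wgt_nonneg n δ y)]
    gcongr
    rw [Real.enorm_eq_ofReal_abs]
    exact ENNReal.ofReal_le_ofReal (hC y)
  exact ⟨⟨hh.aestronglyMeasurable.smul hf.1,
    hle.trans_lt (ENNReal.mul_lt_top ENNReal.ofReal_lt_top hf.2)⟩,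
    (enorm_integral_le_lintegral_enorm _).trans hle⟩

/-- Weights centred at `x` of width `t` are dominated by `wgt`. -/
theorem exists_rpow_le_wgt {δ β t : ℝ} (hδ : 0 ≤ δ) (hβ : (n : ℝ) + δ ≤ β) (ht : 0 < t)
    (x : Rn n) : ∃ C : ℝ, 0 ≤ C ∧ ∀ y, (t + ‖x - y‖) ^ (-β) ≤ C * wgt n δ y := by
  -- Chosen so that 1 + |y| ≤ c (t + |x - y|).
  set c : ℝ := (1 + 1 / t) * (1 + ‖x‖) with hc
  have hc0 : 0 < c := by positivity
  have hn : (0 : ℝ) ≤ n := by positivity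
  refine ⟨c ^ β, by positivity, fun y => ?_⟩
  have h1 : 1 + ‖y‖ ≤ c * (t + ‖x - y‖) := by
    have h2 : ‖y‖ ≤ ‖x‖ + ‖x - y‖ := by
      have := norm_sub_le x (x - y)
      simpa using this
    have h3 : c * (t + ‖x - y‖) = (1 + ‖x‖) * (t + 1 + ‖x - y‖ + ‖x - y‖ / t) := by
      rw [hc]; field_simp; ring
    rw [h3]
    have h4 : 0 ≤ ‖x - y‖ / t := by positivity
    nlinarith [norm_nonneg x, norm_nonneg (x - y)]
  have h0 : 0 < 1 + ‖y‖ := by positivity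
  have h5 : 0 < t + ‖x - y‖ := by positivity
  calc (t + ‖x - y‖) ^ (-β) ≤ (c⁻¹ * (1 + ‖y‖)) ^ (-β) := by
        refine Real.rpow_le_rpow_of_nonpos (by positivity) ?_ (by linarith)
        rw [inv_mul_le_iff₀ hc0]
        exact h1
    _ = c ^ β * (1 + ‖y‖) ^ (-β) := by
        rw [Real.mul_rpow (by positivity) h0.le, Real.inv_rpow hc0.le, Real.rpow_neg hc0.le,
          inv_inv]
    _ ≤ c ^ β * wgt n δ y := by
        gcongr
        unfold wgt
        exact Real.rpow_le_rpow_of_exponent_le (by linarith [norm_nonneg y]) (by linarith)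

/-- Convolution with the radial kernels `κ t`. -/
def kerOp (κ : ℝ → ℝ → ℝ) (f : Rn n → B) (t : ℝ) (x : Rn n) : B :=
  ∫ y, κ t ‖x - y‖ • f y

theorem measurable_kernel_slice {κ : ℝ → ℝ → ℝ} (hκ : Measurable (fun z : ℝ × ℝ => κ z.1 z.2))
    (t : ℝ) (x : Rn n) : Measurable (fun y : Rn n => κ t ‖x - y‖) :=
  hκ.comp (f := fun y : Rn n => (t, ‖x - y‖)) (by fun_prop)

/-- The `t`-derivatives of the Poisson integral may be computed under the integral sign. -/
theorem iteratedDeriv_poisson {D : ℕ → ℝ → ℝ → ℝ}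
    (hD0 : ∀ t (x : Rn n), poissonKer n t x = D 0 t ‖x‖)
    (hDb : ∃ C : ℝ, 0 ≤ C ∧ ∀ t, 0 < t → ∀ ρ, 0 ≤ ρ →
      |D 0 t ρ| ≤ C * t * (t + ρ) ^ (-((n : ℝ) + 1)))
    (hDh : ∀ j : ℕ, IsHomog (-((n : ℝ) + j)) (D j))
    (hDd : ∀ (j : ℕ) (t : ℝ), 0 < t → ∀ ρ, HasDerivAt (fun t => D j t ρ) (D (j + 1) t ρ) t)
    {δ : ℝ} (hδ : 0 ≤ δ) (hδ1 : δ ≤ 1) {f : Rn n → B} (hf : Adm δ f) (x : Rn n) (j : ℕ) :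
    ∀ t, 0 < t → iteratedDeriv j (fun τ => poisson f τ x) t = kerOp (D j) f t x := by
  have hint : ∀ (j : ℕ) (t : ℝ), 0 < t → Integrable (fun y => D j t ‖x - y‖ • f y) := by
    intro j t ht
    have hm := measurable_kernel_slice (hDh j).measurable t x
    -- For j = 0 homogeneity yields only decay of order n. The separate bound of order n + 1 on the
    -- Poisson kernel itself is needed, and this is where δ ≤ 1 enters.
    rcases j with _ | j
    · obtain ⟨C, hC, hb⟩ := hDb
      obtain ⟨C', hC', hw⟩ := exists_rpow_le_wgt (n := n) (β := (n : ℝ) + 1) hδ (by linarith) ht x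
      refine (hf.smul_bound hm (C := C * t * C') fun y => ?_).1
      refine (hb t ht _ (norm_nonneg _)).trans ?_
      rw [mul_assoc (C * t)]
      gcongr
      exact hw y
    · obtain ⟨C, hC, hb⟩ := (hDh (j + 1)).exists_bound
      obtain ⟨C', hC', hw⟩ := exists_rpow_le_wgt (n := n) (β := (n : ℝ) + (j + 1 : ℕ)) hδ
        (by push_cast; nlinarith [(Nat.cast_nonneg j : (0:ℝ) ≤ j)]) ht x
      refine (hf.smul_bound hm (C := C * C') fun y => ?_).1
      refine (hb t ht _ (norm_nonneg _)).trans ?_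
      rw [mul_assoc C]
      gcongr
      exact hw y
  induction j with
  | zero =>
    intro t ht
    simp only [iteratedDeriv_zero, poisson, kerOp, hD0]
  | succ j ih =>
    intro t ht
    rw [iteratedDeriv_succ]
    have hev : iteratedDeriv j (fun τ => poisson f τ x) =ᶠ[𝓝 t] fun t => kerOp (D j) f t x := by
      filter_upwards [Ioi_mem_nhds ht] with s hs using ih s hs
    rw [hev.deriv_eq]
    obtain ⟨C, hC, hb⟩ := (hDh (j + 1)).exists_bound
    -- On the neighbourhood s > t/2 of t, the derivatives are dominated by their bound at t/2.
    have ht2 : 0 < t / 2 := by linarith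
    obtain ⟨C', hC', hw⟩ := exists_rpow_le_wgt (n := n) (β := (n : ℝ) + (j + 1 : ℕ)) hδ
        (by push_cast; nlinarith [(Nat.cast_nonneg j : (0:ℝ) ≤ j)]) ht2 x
    have hbound : Integrable (fun y => (C * (C' * wgt n δ y)) * ‖f y‖) := by
      have := (hf.smul_bound (h := fun y => C * (C' * wgt n δ y)) (C := C * C')
        (((measurable_wgt n δ).const_mul C').const_mul C) (fun y => ?_)).1.norm
      · refine this.congr (Eventually.of_forall fun y => ?_)
        have := wgt_nonneg n δ y
        simp only [norm_smul]
        rw [Real.norm_of_nonneg (by positivity)]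
      · have := wgt_nonneg n δ y
        rw [abs_of_nonneg (by positivity), mul_assoc]
    refine (hasDerivAt_integral_of_dominated_loc_of_deriv_le (μ := volume)
      (F := fun t y => D j t ‖x - y‖ • f y) (F' := fun t y => D (j + 1) t ‖x - y‖ • f y)
      (bound := fun y => (C * (C' * wgt n δ y)) * ‖f y‖)
      (Ioi_mem_nhds (by linarith : t / 2 < t)) ?_ (hint j t ht) (hint (j + 1) t ht).1 ?_ hbound
      ?_).2.deriv
    · filter_upwards [Ioi_mem_nhds ht] with s hs using (hint j s hs).1
    · refine Eventually.of_forall fun y s hs => ?_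
      have hs' : t / 2 < s := hs
      rw [norm_smul]
      gcongr
      rw [Real.norm_eq_abs]
      refine (hb s (by linarith) _ (norm_nonneg _)).trans ?_
      gcongr
      refine le_trans ?_ (hw y)
      have := norm_nonneg (x - y)
      refine Real.rpow_le_rpow_of_nonpos (by positivity) (by linarith) ?_
      have : (0 : ℝ) ≤ n := by positivity
      push_cast
      nlinarith [(Nat.cast_nonneg j : (0:ℝ) ≤ j)]
    · refine Eventually.of_forall fun y s hs => ?_
      have hs' : t / 2 < s := hs
      exact (hDd j s (by linarith) _).smul_const (f y)

/-- Fubini's theorem: averaging in `s` the convolution with `F (t + s)` is convolution with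
`fracKer`. -/
theorem integral_kerOp_shift [CompleteSpace B] {F : ℝ → ℝ → ℝ} {a b α δ : ℝ} (hF : IsHomog (-b) F) (ha : 0 < a)
    (hb : (n : ℝ) + δ ≤ b - a) (hab : a < b) (hδ : 0 ≤ δ) {f : Rn n → B} (hf : Adm δ f) {t : ℝ}
    (ht : 0 < t) (x : Rn n) :
    t ^ α • ((1 / Real.Gamma a) • ∫ s in Ioi (0 : ℝ), s ^ (a - 1) • kerOp F f (t + s) x) =
      kerOp (fracKer α a F) f t x := by
  obtain ⟨C, hC, hbd⟩ := hF.exists_bound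
  have hgF : AEStronglyMeasurable (fun p : ℝ × Rn n => (p.1 ^ (a - 1) * F (t + p.1) ‖x - p.2‖) • f p.2)
      ((volume.restrict (Ioi (0:ℝ))).prod volume) := by
    have h1 : Measurable (fun p : ℝ × Rn n => F (t + p.1) ‖x - p.2‖) :=
      hF.measurable.comp (f := fun p : ℝ × Rn n => (t + p.1, ‖x - p.2‖)) (by fun_prop)
    have h2 : Measurable (fun p : ℝ × Rn n => p.1 ^ (a - 1) * F (t + p.1) ‖x - p.2‖) :=
      Measurable.mul (by fun_prop) h1
    exact h2.aestronglyMeasurable.smul hf.1.comp_snd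
  have hint : Integrable (fun p : ℝ × Rn n => (p.1 ^ (a - 1) * F (t + p.1) ‖x - p.2‖) • f p.2)
      ((volume.restrict (Ioi (0:ℝ))).prod volume) := by
    rw [integrable_prod_iff' hgF]
    refine ⟨Eventually.of_forall fun y =>
      (integrableOn_rpow_mul_shift hF ha hab ht (norm_nonneg (x - y))).smul_const (f y), ?_⟩
    obtain ⟨C', hC', hw⟩ := exists_rpow_le_wgt (n := n) (β := b - a) hδ hb ht x
    set c : ℝ := 1 / a + 1 / (b - a) with hc
    have hc0 : 0 ≤ c := by
      have : 0 < b - a := by linarith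
      positivity
    have hbound : Integrable (fun y => (C * (c * (C' * wgt n δ y))) * ‖f y‖) := by
      have := (hf.smul_bound (h := fun y => C * (c * (C' * wgt n δ y))) (C := C * (c * C'))
        ((((measurable_wgt n δ).const_mul C').const_mul c).const_mul C) (fun y => ?_)).1.norm
      · refine this.congr (Eventually.of_forall fun y => ?_)
        have := wgt_nonneg n δ y
        simp only [norm_smul]
        rw [Real.norm_of_nonneg (by positivity)]
      · have := wgt_nonneg n δ y
        rw [abs_of_nonneg (by positivity)]
        exact le_of_eq (by ring)
    refine hbound.mono' hgF.prod_swap.norm.integral_prod_right' ?_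
    refine Eventually.of_forall fun y => ?_
    rw [Real.norm_of_nonneg (integral_nonneg fun _ => norm_nonneg _)]
    simp only [norm_smul]
    rw [integral_mul_const]
    gcongr
    have hR : 0 < t + ‖x - y‖ := by positivity
    obtain ⟨hi, hle⟩ := integrableOn_rpow_mul_add_rpow ha hab hR
    calc ∫ s in Ioi (0 : ℝ), ‖s ^ (a - 1) * F (t + s) ‖x - y‖‖
        ≤ ∫ s in Ioi (0 : ℝ), C * (s ^ (a - 1) * (t + ‖x - y‖ + s) ^ (-b)) := by
          refine setIntegral_mono_on
            (integrableOn_rpow_mul_shift hF ha hab ht (norm_nonneg _)).norm (hi.const_mul C)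
            measurableSet_Ioi fun s hs => ?_
          have hs' : 0 < s := hs
          rw [norm_mul, Real.norm_of_nonneg (by positivity), Real.norm_eq_abs, mul_left_comm]
          gcongr
          have := hbd (t + s) (by linarith) _ (norm_nonneg (x - y))
          rwa [show t + ‖x - y‖ + s = t + s + ‖x - y‖ by ring]
      _ ≤ C * (c * (C' * wgt n δ y)) := by
          rw [integral_const_mul]
          gcongr
          refine hle.trans ?_
          gcongr
          rw [show a - b = -(b - a) by ring]
          exact hw y
  have hswap := integral_integral_swap (f := fun (s : ℝ) (y : Rn n) =>
    (s ^ (a - 1) * F (t + s) ‖x - y‖) • f y) hint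
  have h1 : ∫ s in Ioi (0 : ℝ), s ^ (a - 1) • kerOp F f (t + s) x =
      ∫ y, (∫ s in Ioi (0 : ℝ), s ^ (a - 1) * F (t + s) ‖x - y‖) • f y := by
    simp only [kerOp, ← integral_smul, smul_smul]
    rw [hswap]
    refine integral_congr_ae (Eventually.of_forall fun y => ?_)
    exact integral_smul_const _ _
  rw [h1]
  simp only [kerOp, fracKer, ← integral_smul, smul_smul]

end

end FracLP

namespace FracLP

noncomputable section

variable {n : ℕ} {B : Type*} [NormedAddCommGroup B]

/-! ### Square functions of Calderón--Zygmund type -/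

/-- The properties of the square functions on which the real-variable theory rests: sublinearity,
translation invariance, lower semicontinuity, and the size and regularity estimates inherited from
the kernel. -/
structure IsCZ (𝕜 : Type*) [RCLike 𝕜] [NormedSpace 𝕜 B] [NormedSpace ℝ B] (δ : ℝ) (C : ℝ≥0)
    (U : (Rn n → B) → Rn n → ℝ≥0∞) : Prop where
  measurable : ∀ f, Adm δ f → Measurable (U f)
  congr : ∀ f g, Adm δ f → f =ᵐ[volume] g → U f = U g
  add_le : ∀ f g, Adm δ f → Adm δ g → ∀ x, U (fun y => f y + g y) x ≤ U f x + U g x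
  smul : ∀ (c : 𝕜) f, Adm δ f → ∀ x, U (fun y => c • f y) x = ‖c‖ₑ * U f x
  translate : ∀ f, Integrable f → ∀ h x, U (fun y => f (y + h)) x = U f (x + h)
  lsc : ∀ (f : Rn n → B) (F : ℕ → Rn n → B), Adm δ f → (∀ k, Adm δ (F k)) →
    Tendsto (fun k => ∫⁻ y, ‖F k y - f y‖ₑ * ENNReal.ofReal (wgt n δ y)) atTop (𝓝 0) →
    ∀ x, U f x ≤ liminf (fun k => U (F k) x) atTop
  size : ∀ f, Integrable f → ∀ x ρ, 0 < ρ → (∀ y, f y ≠ 0 → ρ ≤ ‖x - y‖) →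
    U f x ≤ C * ENNReal.ofReal (ρ ^ (-(n : ℝ))) * ∫⁻ y, ‖f y‖ₑ
  reg : ∀ f, Integrable f → ∀ x h r, 0 < r → ‖h‖ ≤ r → (∀ y, f y ≠ 0 → 2 * r ≤ ‖x - y‖) →
    U (fun y => f y - f (y + h)) x ≤ C * ENNReal.ofReal (r ^ (1 / 2 : ℝ)) *
      ∫⁻ y, ‖f y‖ₑ * ENNReal.ofReal (‖x - y‖ ^ (-((n : ℝ) + 1 / 2)))
  cancel : ∀ f, Integrable f → ∀ x c r, 0 < r → (∀ y, f y ≠ 0 → ‖y - c‖ ≤ r) →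
    ∫ y, f y = 0 → 2 * r ≤ ‖x - c‖ →
    U f x ≤ C * ENNReal.ofReal (r * ‖x - c‖ ^ (-((n : ℝ) + 1))) * ∫⁻ y, ‖f y‖ₑ

/-- Size and smoothness of a family of radial kernels, at the scale of `t^α ∂_t^α P_t`. -/
structure KerBounds (n : ℕ) (α C : ℝ) (κ : ℝ → ℝ → ℝ) : Prop where
  nonneg : 0 ≤ C
  meas : Measurable (fun z : ℝ × ℝ => κ z.1 z.2)
  size : ∀ t, 0 < t → ∀ ρ, 0 ≤ ρ → |κ t ρ| ≤ C * (t ^ α * (t + ρ) ^ (-((n : ℝ) + α)))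
  lip : ∀ t, 0 < t → ∀ ρ, 0 ≤ ρ → ∀ ρ', 0 ≤ ρ' → |ρ - ρ'| ≤ (t + ρ) / 2 →
    |κ t ρ - κ t ρ'| ≤ C * |ρ - ρ'| * (t ^ α * (t + ρ) ^ (-((n : ℝ) + α + 1)))

/-- A measure on `ℝⁿ × (0, ∞)` that is carried by the cone `{|w| ≤ t}` and whose `t`-marginal is
dominated by `dt / t`. -/
structure ConeMeasure (ν : Measure (Rn n × ℝ)) (c : ℝ≥0) : Prop where
  sfinite : SFinite ν
  carried : ∀ᵐ z ∂ν, 0 < z.2 ∧ ‖z.1‖ ≤ z.2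
  marginal : ∀ φ : ℝ → ℝ≥0∞, Measurable φ →
    ∫⁻ z, φ z.2 ∂ν ≤ c * ∫⁻ t in Ioi (0 : ℝ), φ t * ENNReal.ofReal (1 / t)

/-- The square function associated with the kernels `κ` and the measure `ν`. -/
def sqFun [NormedSpace ℝ B] (κ : ℝ → ℝ → ℝ) (ν : Measure (Rn n × ℝ)) (q : ℝ) (f : Rn n → B)
    (x : Rn n) : ℝ≥0∞ :=
  (∫⁻ z, ‖kerOp κ f z.2 (x - z.1)‖ₑ ^ q ∂ν) ^ (1 / q)

/-- The majorant depends on t alone, so the marginal condition reduces everything to ∫ (t^α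
(t+ρ)^{-b})^q dt/t. This converges at 0 because α > 0 and at ∞ because b > α, and it scales like
ρ^{(α-b)q}. -/
theorem ConeMeasure.lintegral_le {ν : Measure (Rn n × ℝ)} {c : ℝ≥0} (hν : ConeMeasure ν c)
    {q α b : ℝ} (hq : 1 < q) (hα : 0 < α) (hb : α < b) :
    ∃ C : ℝ≥0, ∀ (G : Rn n × ℝ → ℝ≥0∞) (A : ℝ≥0∞) (ρ : ℝ), 0 < ρ →
      (∀ z, 0 < z.2 → ‖z.1‖ ≤ z.2 → G z ≤ A * ENNReal.ofReal (z.2 ^ α * (z.2 + ρ) ^ (-b))) →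
      (∫⁻ z, G z ^ q ∂ν) ^ (1 / q) ≤ C * A * ENNReal.ofReal (ρ ^ (α - b)) := by
  have hq0 : 0 < q := by linarith
  have hbα : 0 < b * q - α * q := by nlinarith
  set k : ℝ := 1 / (α * q) + 1 / (b * q - α * q) with hk
  have hk0 : 0 ≤ k := by positivity
  refine ⟨(c * k.toNNReal) ^ (1 / q), fun G A ρ hρ hG => ?_⟩
  have h1 : ∫⁻ z, G z ^ q ∂ν ≤
      ∫⁻ z, (A * ENNReal.ofReal (z.2 ^ α * (z.2 + ρ) ^ (-b))) ^ q ∂ν := by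
    refine lintegral_mono_ae ?_
    filter_upwards [hν.carried] with z hz
    exact ENNReal.rpow_le_rpow (hG z hz.1 hz.2) hq0.le
  have h2 := hν.marginal (fun t => (A * ENNReal.ofReal (t ^ α * (t + ρ) ^ (-b))) ^ q) (by fun_prop)
  have h3 : ∫⁻ t in Ioi (0 : ℝ), (A * ENNReal.ofReal (t ^ α * (t + ρ) ^ (-b))) ^ q *
      ENNReal.ofReal (1 / t) ≤ A ^ q * ENNReal.ofReal (k * ρ ^ (α * q - b * q)) := by
    have := lintegral_rpow_mul_add_rpow_le (a := α * q) (b := b * q) (by positivity)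
      (by nlinarith) hρ
    calc _ = ∫⁻ t in Ioi (0 : ℝ), A ^ q *
          ENNReal.ofReal (t ^ (α * q - 1) * (ρ + t) ^ (-(b * q))) := by
          refine setLIntegral_congr_fun measurableSet_Ioi fun t ht => ?_
          have ht' : 0 < t := ht
          rw [ENNReal.mul_rpow_of_nonneg _ _ hq0.le, mul_assoc, ENNReal.ofReal_rpow_of_nonneg
            (by positivity) hq0.le, ← ENNReal.ofReal_mul (by positivity)]
          congr 2
          rw [Real.mul_rpow (by positivity) (by positivity), ← Real.rpow_mul ht'.le,
            ← Real.rpow_mul (by positivity), Real.rpow_sub_one ht'.ne', add_comm ρ t, neg_mul]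
          ring
      _ = A ^ q * ∫⁻ t in Ioi (0 : ℝ),
          ENNReal.ofReal (t ^ (α * q - 1) * (ρ + t) ^ (-(b * q))) :=
          lintegral_const_mul _ (by fun_prop)
      _ ≤ _ := by gcongr
  calc (∫⁻ z, G z ^ q ∂ν) ^ (1 / q)
      ≤ (c * (A ^ q * ENNReal.ofReal (k * ρ ^ (α * q - b * q)))) ^ (1 / q) := by
        refine ENNReal.rpow_le_rpow (h1.trans (h2.trans ?_)) (by positivity)
        gcongr
    _ = ((c * k.toNNReal : ℝ≥0) : ℝ≥0∞) ^ (1 / q) * A * ENNReal.ofReal (ρ ^ (α - b)) := by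
        rw [ENNReal.ofReal_mul hk0, show (c : ℝ≥0∞) * (A ^ q * (ENNReal.ofReal k *
          ENNReal.ofReal (ρ ^ (α * q - b * q)))) = ((c * k.toNNReal : ℝ≥0) : ℝ≥0∞) * A ^ q *
          ENNReal.ofReal (ρ ^ (α * q - b * q)) by
            rw [ENNReal.coe_mul]; change _ = (c : ℝ≥0∞) * ENNReal.ofReal k * _ * _; ring]
        rw [ENNReal.mul_rpow_of_nonneg _ _ (by positivity),
          ENNReal.mul_rpow_of_nonneg _ _ (by positivity), ← ENNReal.rpow_mul,
          mul_one_div_cancel hq0.ne', ENNReal.rpow_one,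
          ENNReal.ofReal_rpow_of_nonneg (by positivity) (by positivity), ← Real.rpow_mul hρ.le]
        congr 3
        field_simp
    _ = _ := by
        rw [ENNReal.coe_rpow_of_nonneg _ (by positivity)]

theorem lintegral_ofReal_mul_enorm_le {H : Rn n → ℝ} {f : Rn n → B} {M : ℝ≥0∞} {φ : Rn n → ℝ≥0∞}
    (h : ∀ y, f y ≠ 0 → ENNReal.ofReal (H y) ≤ M * φ y) (hM : M ≠ ∞) :
    ∫⁻ y, ENNReal.ofReal (H y) * ‖f y‖ₑ ≤ M * ∫⁻ y, ‖f y‖ₑ * φ y := by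
  rw [← lintegral_const_mul' _ _ hM]
  refine lintegral_mono fun y => ?_
  by_cases hy : f y = 0
  · simp [hy]
  · calc ENNReal.ofReal (H y) * ‖f y‖ₑ ≤ M * φ y * ‖f y‖ₑ := by gcongr; exact h y hy
      _ = M * (‖f y‖ₑ * φ y) := by ring

variable [NormedSpace ℝ B]

theorem KerBounds.exists_bound {α C δ : ℝ} {κ : ℝ → ℝ → ℝ} (hκ : KerBounds n α C κ)
    (hδ : 0 ≤ δ) (hδα : δ ≤ α) {t : ℝ} (ht : 0 < t) (x : Rn n) :
    ∃ D : ℝ, ∀ f : Rn n → B, Adm δ f → Integrable (fun y => κ t ‖x - y‖ • f y) ∧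
      ‖kerOp κ f t x‖ₑ ≤ ENNReal.ofReal D * ∫⁻ y, ‖f y‖ₑ * ENNReal.ofReal (wgt n δ y) := by
  obtain ⟨C', hC', hw⟩ := exists_rpow_le_wgt (n := n) (β := (n : ℝ) + α) hδ (by linarith) ht x
  refine ⟨C * (t ^ α * C'), fun f hf =>
    hf.smul_bound (measurable_kernel_slice hκ.meas t x) fun y => ?_⟩
  refine (hκ.size t ht _ (norm_nonneg _)).trans ?_
  rw [mul_assoc C, mul_assoc (t ^ α)]
  have := hκ.nonneg
  gcongr
  exact hw y

theorem KerBounds.stronglyMeasurable {α C : ℝ} {κ : ℝ → ℝ → ℝ} (hκ : KerBounds n α C κ)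
    {f : Rn n → B} (hf : AEStronglyMeasurable f volume) :
    StronglyMeasurable (fun p : Rn n × (Rn n × ℝ) => kerOp κ f p.2.2 (p.1 - p.2.1)) := by
  have heq : (fun p : Rn n × (Rn n × ℝ) => kerOp κ f p.2.2 (p.1 - p.2.1)) =
      fun p => ∫ y, κ p.2.2 ‖p.1 - p.2.1 - y‖ • hf.mk f y := by
    funext p
    refine integral_congr_ae ?_
    filter_upwards [hf.ae_eq_mk] with y hy
    rw [hy]
  rw [heq]
  refine StronglyMeasurable.integral_prod_right (f := fun (p : Rn n × (Rn n × ℝ)) (y : Rn n) =>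
    κ p.2.2 ‖p.1 - p.2.1 - y‖ • hf.mk f y) ?_
  have h1 : Measurable (fun z : (Rn n × (Rn n × ℝ)) × Rn n =>
      κ z.1.2.2 ‖z.1.1 - z.1.2.1 - z.2‖) :=
    hκ.meas.comp (f := fun z : (Rn n × (Rn n × ℝ)) × Rn n =>
      (z.1.2.2, ‖z.1.1 - z.1.2.1 - z.2‖)) (by fun_prop)
  exact h1.stronglyMeasurable.smul
    (hf.stronglyMeasurable_mk.comp_measurable measurable_snd)

theorem norm_sub_le_add_norm {t : ℝ} {x w y : Rn n} (hw : ‖w‖ ≤ t) :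
    ‖x - y‖ ≤ t + ‖x - w - y‖ := by
  have := norm_add_le (x - w - y) w
  rw [show x - w - y + w = x - y by abel] at this
  linarith

/-- If `|w| ≤ t`, the distances of `x` and `x - w` to a point are comparable up to `t`. -/
theorem add_norm_div_two_le {t : ℝ} {x w y : Rn n} (hw : ‖w‖ ≤ t) :
    (t + ‖x - y‖) / 2 ≤ t + ‖x - w - y‖ := by
  have h := norm_sub_le_add_norm (x := x) (y := y) hw
  have := norm_nonneg (x - w - y)
  linarith

theorem rpow_neg_le_of_half_le {a b s : ℝ} (ha : 0 < a) (h : a / 2 ≤ b) (hs : 0 ≤ s) :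
    b ^ (-s) ≤ 2 ^ s * a ^ (-s) := by
  calc b ^ (-s) ≤ (a / 2) ^ (-s) :=
        Real.rpow_le_rpow_of_nonpos (by positivity) h (by linarith)
    _ = 2 ^ s * a ^ (-s) := by
        rw [Real.div_rpow ha.le (by norm_num), Real.rpow_neg (by norm_num : (0:ℝ) ≤ 2),
          div_inv_eq_mul, mul_comm]

variable {κ : ℝ → ℝ → ℝ} {α C δ q : ℝ} {ν : Measure (Rn n × ℝ)} {c : ℝ≥0}

theorem enorm_integral_smul_le (h : Rn n → ℝ) (f : Rn n → B) :
    ‖∫ y, h y • f y‖ₑ ≤ ∫⁻ y, ENNReal.ofReal |h y| * ‖f y‖ₑ := by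
  refine (enorm_integral_le_lintegral_enorm _).trans (le_of_eq (lintegral_congr fun y => ?_))
  rw [enorm_smul, Real.enorm_eq_ofReal_abs]

/-- On the cone |w| ≤ t the quantity t + |x - w - y| is at least (t + |x - y|)/2, so the shift by w
is harmless. The estimate is the one-dimensional integral with b = n + α, which exceeds α because n
> 0. -/
theorem sqFun_size (hκ : KerBounds n α C κ) (hν : ConeMeasure ν c) (hq : 1 < q) (hα : 0 < α)
    (hn : 0 < n) : ∃ D : ℝ≥0, ∀ f : Rn n → B, ∀ x ρ, 0 < ρ → (∀ y, f y ≠ 0 → ρ ≤ ‖x - y‖) →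
      sqFun κ ν q f x ≤ D * ENNReal.ofReal (ρ ^ (-(n : ℝ))) * ∫⁻ y, ‖f y‖ₑ := by
  have hn' : (0 : ℝ) < n := by exact_mod_cast hn
  obtain ⟨D, hD⟩ := hν.lintegral_le (b := n + α) hq hα (by linarith)
  have hC := hκ.nonneg
  refine ⟨D * (C * 2 ^ ((n : ℝ) + α)).toNNReal, fun f x ρ hρ hf => ?_⟩
  refine (hD (fun z => ‖kerOp κ f z.2 (x - z.1)‖ₑ)
    (ENNReal.ofReal (C * 2 ^ ((n : ℝ) + α)) * ∫⁻ y, ‖f y‖ₑ) ρ hρ fun z hz hw => ?_).trans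
    (le_of_eq ?_)
  · refine (enorm_integral_smul_le _ f).trans ?_
    refine (lintegral_ofReal_mul_enorm_le (M := ENNReal.ofReal (C * 2 ^ ((n : ℝ) + α)) *
      ENNReal.ofReal (z.2 ^ α * (z.2 + ρ) ^ (-((n : ℝ) + α)))) (φ := fun _ => 1)
      (fun y hy => ?_) (ENNReal.mul_ne_top ENNReal.ofReal_ne_top ENNReal.ofReal_ne_top)).trans
      (le_of_eq ?_)
    · rw [mul_one, ← ENNReal.ofReal_mul (by positivity)]
      refine ENNReal.ofReal_le_ofReal ((hκ.size _ hz _ (norm_nonneg _)).trans ?_)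
      rw [mul_assoc C, mul_left_comm (2 ^ ((n : ℝ) + α))]
      gcongr
      refine rpow_neg_le_of_half_le (by positivity) ?_ (by positivity)
      have := add_norm_div_two_le (x := x) (y := y) hw
      have := hf y hy
      linarith
    · simp only [mul_one]
      ring
  · rw [show α - (n + α) = -(n : ℝ) by ring, ENNReal.coe_mul]
    change _ = D * ENNReal.ofReal (C * 2 ^ ((n : ℝ) + α)) * _ * _
    ring

/-- The translation is moved from f to the kernel, where smoothness is available. -/
theorem kerOp_sub_translate (hκ : KerBounds n α C κ) (hα : 0 ≤ α) {f : Rn n → B}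
    (hf : Integrable f) {t : ℝ} (ht : 0 < t) (x h : Rn n) :
    kerOp κ (fun y => f y - f (y + h)) t x = ∫ y, (κ t ‖x - y‖ - κ t ‖x + h - y‖) • f y := by
  have hi : ∀ x : Rn n, ∀ g : Rn n → B, Integrable g → Integrable (fun y => κ t ‖x - y‖ • g y) := by
    intro x g hg
    obtain ⟨D, hD⟩ := hκ.exists_bound (B := B) hα le_rfl ht x
    exact (hD g (hg.adm hα)).1
  have h1 : ∫ y, κ t ‖x - y‖ • f (y + h) = ∫ y, κ t ‖x + h - y‖ • f y := by
    rw [← integral_add_right_eq_self (fun y => κ t ‖x + h - y‖ • f y) h]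
    refine integral_congr_ae (Eventually.of_forall fun y => ?_)
    simp only
    rw [show x + h - (y + h) = x - y by abel]
  simp only [kerOp, smul_sub, sub_smul]
  rw [integral_sub (hi x f hf) (hi x _ (hf.comp_add_right h)), h1,
    integral_sub (hi x f hf) (hi (x + h) f hf)]

/-- The decay exponent n + α + 1 is divided as (α + 1/2) + (n + 1/2). The first share exceeds α, so
the t-integral converges; the second exceeds n, so the remaining weight is integrable at infinity.
The gain is (|h|-scale)^{1/2} instead of a full power. -/
theorem sqFun_reg (hκ : KerBounds n α C κ) (hν : ConeMeasure ν c) (hq : 1 < q) (hα : 0 < α) :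
    ∃ D : ℝ≥0, ∀ f : Rn n → B, Integrable f → ∀ x h r, 0 < r → ‖h‖ ≤ r →
      (∀ y, f y ≠ 0 → 2 * r ≤ ‖x - y‖) →
      sqFun κ ν q (fun y => f y - f (y + h)) x ≤ D * ENNReal.ofReal (r ^ (1 / 2 : ℝ)) *
        ∫⁻ y, ‖f y‖ₑ * ENNReal.ofReal (‖x - y‖ ^ (-((n : ℝ) + 1 / 2))) := by
  obtain ⟨D, hD⟩ := hν.lintegral_le (b := α + 1 / 2) hq hα (by linarith)
  have hC := hκ.nonneg
  set A : ℝ := C * 2 ^ ((n : ℝ) + α + 1) with hA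
  have hA0 : 0 ≤ A := by positivity
  refine ⟨D * A.toNNReal, fun f hfi x h r hr hh hf => ?_⟩
  refine (hD (fun z => ‖kerOp κ (fun y => f y - f (y + h)) z.2 (x - z.1)‖ₑ)
    (ENNReal.ofReal (A * r) *
      ∫⁻ y, ‖f y‖ₑ * ENNReal.ofReal (‖x - y‖ ^ (-((n : ℝ) + 1 / 2)))) r hr
    fun z hz hw => ?_).trans (le_of_eq ?_)
  · rw [kerOp_sub_translate hκ hα.le hfi hz]
    refine (enorm_integral_smul_le _ f).trans ?_
    refine (lintegral_ofReal_mul_enorm_le (M := ENNReal.ofReal (A * r) *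
      ENNReal.ofReal (z.2 ^ α * (z.2 + r) ^ (-(α + 1 / 2))))
      (φ := fun y => ENNReal.ofReal (‖x - y‖ ^ (-((n : ℝ) + 1 / 2))))
      (fun y hy => ?_) (ENNReal.mul_ne_top ENNReal.ofReal_ne_top ENNReal.ofReal_ne_top)).trans
      (le_of_eq ?_)
    · rw [← ENNReal.ofReal_mul (by positivity), ← ENNReal.ofReal_mul (by positivity)]
      refine ENNReal.ofReal_le_ofReal ?_
      have hxy := hf y hy
      have hxy0 : 0 < ‖x - y‖ := by linarith
      have hcmp := add_norm_div_two_le (x := x) (y := y) hw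
      have hcmp' := norm_sub_le_add_norm (x := x) (y := y) hw
      have hdist : |‖x - z.1 - y‖ - ‖x - z.1 + h - y‖| ≤ r := by
        refine (abs_norm_sub_norm_le _ _).trans ?_
        rw [show x - z.1 - y - (x - z.1 + h - y) = -h by abel, norm_neg]
        exact hh
      refine (hκ.lip _ hz _ (norm_nonneg _) _ (norm_nonneg _) (by linarith)).trans ?_
      have h3 : (z.2 + ‖x - z.1 - y‖) ^ (-((n : ℝ) + α + 1)) ≤ 2 ^ ((n : ℝ) + α + 1) *
          ((z.2 + r) ^ (-(α + 1 / 2)) * ‖x - y‖ ^ (-((n : ℝ) + 1 / 2))) := by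
        refine (rpow_neg_le_of_half_le (by positivity) hcmp (by positivity)).trans ?_
        gcongr
        rw [show -((n : ℝ) + α + 1) = -(α + 1 / 2) + -((n : ℝ) + 1 / 2) by ring,
          Real.rpow_add (by positivity)]
        gcongr ?_ * ?_
        · exact Real.rpow_le_rpow_of_nonpos (by positivity) (by linarith) (by linarith)
        · refine Real.rpow_le_rpow_of_nonpos (by positivity) (by linarith) ?_
          have : (0 : ℝ) ≤ n := by positivity
          linarith
      calc C * |‖x - z.1 - y‖ - ‖x - z.1 + h - y‖| *
            (z.2 ^ α * (z.2 + ‖x - z.1 - y‖) ^ (-((n : ℝ) + α + 1)))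
          ≤ C * r * (z.2 ^ α * (2 ^ ((n : ℝ) + α + 1) *
            ((z.2 + r) ^ (-(α + 1 / 2)) * ‖x - y‖ ^ (-((n : ℝ) + 1 / 2))))) := by gcongr
        _ = _ := by rw [hA]; ring
    · ring
  · have : ENNReal.ofReal (A * r) * ENNReal.ofReal (r ^ (α - (α + 1 / 2))) =
        ENNReal.ofReal A * ENNReal.ofReal (r ^ (1 / 2 : ℝ)) := by
      rw [← ENNReal.ofReal_mul (by positivity), ← ENNReal.ofReal_mul (by positivity), mul_assoc]
      congr 2
      rw [← Real.rpow_one_add' hr.le (by norm_num)]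
      congr 1; ring
    calc _ = D * (ENNReal.ofReal (A * r) * ENNReal.ofReal (r ^ (α - (α + 1 / 2)))) *
          ∫⁻ y, ‖f y‖ₑ * ENNReal.ofReal (‖x - y‖ ^ (-((n : ℝ) + 1 / 2))) := by ring
      _ = _ := by
          rw [this, ENNReal.coe_mul]
          change _ = D * ENNReal.ofReal A * _ * _
          ring

/-- Because f has mean zero, the value of the kernel at z₀ may be subtracted, and the Lipschitz
bound gains the factor r. Here all the extra decay stays in one exponent, b = n + α + 1. -/
theorem sqFun_cancel [CompleteSpace B] (hκ : KerBounds n α C κ) (hν : ConeMeasure ν c) (hq : 1 < q)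
    (hα : 0 < α) :
    ∃ D : ℝ≥0, ∀ f : Rn n → B, Integrable f → ∀ x z₀ r, 0 < r → (∀ y, f y ≠ 0 → ‖y - z₀‖ ≤ r) →
      ∫ y, f y = 0 → 2 * r ≤ ‖x - z₀‖ →
      sqFun κ ν q f x ≤ D * ENNReal.ofReal (r * ‖x - z₀‖ ^ (-((n : ℝ) + 1))) * ∫⁻ y, ‖f y‖ₑ := by
  have hn' : (0 : ℝ) ≤ n := by positivity
  obtain ⟨D, hD⟩ := hν.lintegral_le (b := n + α + 1) hq hα (by linarith)
  have hC := hκ.nonneg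
  set A : ℝ := C * 2 ^ ((n : ℝ) + α + 1) with hA
  have hA0 : 0 ≤ A := by positivity
  refine ⟨D * A.toNNReal, fun f hfi x z₀ r hr hf h0 hx => ?_⟩
  have hx0 : 0 < ‖x - z₀‖ := by linarith
  refine (hD (fun z => ‖kerOp κ f z.2 (x - z.1)‖ₑ)
    (ENNReal.ofReal (A * r) * ∫⁻ y, ‖f y‖ₑ) _ hx0 fun z hz hw => ?_).trans (le_of_eq ?_)
  · have hsub : kerOp κ f z.2 (x - z.1) =
        ∫ y, (κ z.2 ‖x - z.1 - y‖ - κ z.2 ‖x - z.1 - z₀‖) • f y := by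
      obtain ⟨E, hE⟩ := hκ.exists_bound (B := B) hα.le le_rfl hz (x - z.1)
      simp only [sub_smul]
      rw [integral_sub (g := fun y => κ z.2 ‖x - z.1 - z₀‖ • f y) (hE f (hfi.adm hα.le)).1
        (hfi.smul _), integral_smul, h0, smul_zero,
        sub_zero, kerOp]
    rw [hsub]
    refine (enorm_integral_smul_le _ f).trans ?_
    refine (lintegral_ofReal_mul_enorm_le (M := ENNReal.ofReal (A * r) *
      ENNReal.ofReal (z.2 ^ α * (z.2 + ‖x - z₀‖) ^ (-((n : ℝ) + α + 1)))) (φ := fun _ => 1)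
      (fun y hy => ?_) (ENNReal.mul_ne_top ENNReal.ofReal_ne_top ENNReal.ofReal_ne_top)).trans
      (le_of_eq ?_)
    · rw [mul_one, ← ENNReal.ofReal_mul (by positivity)]
      refine ENNReal.ofReal_le_ofReal ?_
      have hcmp := add_norm_div_two_le (x := x) (y := z₀) hw
      have hcmp' := norm_sub_le_add_norm (x := x) (y := z₀) hw
      have hdist : |‖x - z.1 - z₀‖ - ‖x - z.1 - y‖| ≤ r := by
        refine (abs_norm_sub_norm_le _ _).trans ?_
        rw [show x - z.1 - z₀ - (x - z.1 - y) = y - z₀ by abel]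
        exact hf y hy
      -- The Lipschitz bound is based at z₀. Its range condition holds because t + |x - w - z₀| ≥ |x
      -- - z₀| ≥ 2r.
      rw [abs_sub_comm]
      refine (hκ.lip _ hz _ (norm_nonneg _) _ (norm_nonneg _) (by linarith)).trans ?_
      have h3 := rpow_neg_le_of_half_le (by positivity) hcmp
        (by positivity : 0 ≤ (n : ℝ) + α + 1)
      calc C * |‖x - z.1 - z₀‖ - ‖x - z.1 - y‖| *
            (z.2 ^ α * (z.2 + ‖x - z.1 - z₀‖) ^ (-((n : ℝ) + α + 1)))
          ≤ C * r * (z.2 ^ α * (2 ^ ((n : ℝ) + α + 1) *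
            (z.2 + ‖x - z₀‖) ^ (-((n : ℝ) + α + 1)))) := by gcongr
        _ = _ := by rw [hA]; ring
    · simp only [mul_one]
      ring
  · rw [show α - (n + α + 1) = -((n : ℝ) + 1) by ring, ENNReal.ofReal_mul hA0,
      ENNReal.ofReal_mul hr.le, ENNReal.coe_mul]
    change _ = D * ENNReal.ofReal A * _ * _
    ring

theorem kerOp_congr {f g : Rn n → B} (h : f =ᵐ[volume] g) (t : ℝ) (x : Rn n) :
    kerOp κ f t x = kerOp κ g t x := by
  refine integral_congr_ae ?_
  filter_upwards [h] with y hy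
  rw [hy]

theorem kerOp_add (hκ : KerBounds n α C κ) (hδ : 0 ≤ δ) (hδα : δ ≤ α) {f g : Rn n → B}
    (hf : Adm δ f) (hg : Adm δ g) {t : ℝ} (ht : 0 < t) (x : Rn n) :
    kerOp κ (fun y => f y + g y) t x = kerOp κ f t x + kerOp κ g t x := by
  obtain ⟨D, hD⟩ := hκ.exists_bound (B := B) hδ hδα ht x
  simp only [kerOp, smul_add]
  exact integral_add (hD f hf).1 (hD g hg).1

/-- Sublinearity is Minkowski's inequality in L^q(ν). Lower semicontinuity is Fatou's lemma:
convergence in the weighted L¹ norm forces pointwise convergence of every K_t f, as each kernel is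
dominated by the weight. -/
theorem isCZ_sqFun {𝕜 : Type*} [RCLike 𝕜] [NormedSpace 𝕜 B] [IsScalarTower ℝ 𝕜 B]
    [CompleteSpace B] (hκ : KerBounds n α C κ) (hν : ConeMeasure ν c) (hq : 1 < q) (hα : 0 < α)
    (hn : 0 < n) (hδ : 0 < δ) (hδα : δ ≤ α) :
    ∃ D : ℝ≥0, IsCZ 𝕜 δ D (sqFun (B := B) κ ν q) := by
  obtain ⟨D₁, h₁⟩ := sqFun_size (B := B) hκ hν hq hα hn
  obtain ⟨D₂, h₂⟩ := sqFun_reg (B := B) hκ hν hq hα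
  obtain ⟨D₃, h₃⟩ := sqFun_cancel (B := B) hκ hν hq hα
  have hq0 : 0 < q := by linarith
  have hsf := hν.sfinite
  have hmeas : ∀ f : Rn n → B, AEStronglyMeasurable f volume → ∀ x,
      StronglyMeasurable (fun z : Rn n × ℝ => kerOp κ f z.2 (x - z.1)) := fun f hf x =>
    (hκ.stronglyMeasurable hf).comp_measurable (g := fun z : Rn n × ℝ => (x, z)) (by fun_prop)
  have hle1 : D₁ ≤ D₁ + D₂ + D₃ := by rw [add_assoc]; exact le_self_add
  have hle2 : D₂ ≤ D₁ + D₂ + D₃ := by rw [add_comm D₁, add_assoc]; exact le_self_add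
  have hle3 : D₃ ≤ D₁ + D₂ + D₃ := le_add_self
  refine ⟨D₁ + D₂ + D₃, ?_, ?_, ?_, ?_, ?_, ?_, ?_, ?_, ?_⟩
  · intro f hf
    refine Measurable.pow_const ?_ _
    exact Measurable.lintegral_prod_right' (f := fun p : Rn n × (Rn n × ℝ) =>
      ‖kerOp κ f p.2.2 (p.1 - p.2.1)‖ₑ ^ q) ((hκ.stronglyMeasurable hf.1).enorm.pow_const q)
  · intro f g _ hfg
    funext x
    simp only [sqFun, kerOp_congr hfg]
  · intro f g hf hg x
    refine le_trans ?_ (ENNReal.lintegral_Lp_add_le (hmeas f hf.1 x).enorm.aemeasurable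
      (hmeas g hg.1 x).enorm.aemeasurable hq.le)
    refine ENNReal.rpow_le_rpow (lintegral_mono_ae ?_) (by positivity)
    filter_upwards [hν.carried] with z hz
    refine ENNReal.rpow_le_rpow ?_ hq0.le
    rw [kerOp_add hκ hδ.le hδα hf hg hz.1]
    exact enorm_add_le _ _
  · intro a f _ x
    have h : ∀ t x, kerOp κ (fun y => a • f y) t x = a • kerOp κ f t x := by
      intro t x
      simp only [kerOp, ← integral_smul]
      refine integral_congr_ae (Eventually.of_forall fun y => ?_)
      exact smul_comm _ _ _
    simp only [sqFun, h, enorm_smul]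
    simp_rw [ENNReal.mul_rpow_of_nonneg _ _ hq0.le]
    rw [lintegral_const_mul' _ _ (ENNReal.rpow_ne_top_of_nonneg hq0.le enorm_ne_top),
      ENNReal.mul_rpow_of_nonneg _ _ (by positivity), ← ENNReal.rpow_mul,
      mul_one_div_cancel hq0.ne', ENNReal.rpow_one]
  · intro f _ h x
    have h1 : ∀ t x, kerOp κ (fun y => f (y + h)) t x = kerOp κ f t (x + h) := by
      intro t x
      simp only [kerOp]
      rw [← integral_add_right_eq_self (fun y => κ t ‖x + h - y‖ • f y) h]
      refine integral_congr_ae (Eventually.of_forall fun y => ?_)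
      simp only
      rw [show x + h - (y + h) = x - y by abel]
    simp only [sqFun, h1, sub_add_eq_add_sub]
  · intro f F hf hF hlim x
    have hpt : ∀ z : Rn n × ℝ, 0 < z.2 →
        Tendsto (fun k => kerOp κ (F k) z.2 (x - z.1)) atTop (𝓝 (kerOp κ f z.2 (x - z.1))) := by
      intro z hz
      obtain ⟨E, hE⟩ := hκ.exists_bound (B := B) hδ.le hδα hz (x - z.1)
      rw [tendsto_iff_edist_tendsto_0]
      have h0 : Tendsto (fun k => ENNReal.ofReal E *
          ∫⁻ y, ‖F k y - f y‖ₑ * ENNReal.ofReal (wgt n δ y)) atTop (𝓝 0) := by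
        simpa using ENNReal.Tendsto.const_mul hlim (Or.inr ENNReal.ofReal_ne_top)
      have hneg : Adm δ (fun y => - f y) := ⟨hf.1.neg, by simpa using hf.2⟩
      refine tendsto_of_tendsto_of_tendsto_of_le_of_le tendsto_const_nhds h0
        (fun _ => zero_le) fun k => ?_
      have hsub : kerOp κ (F k) z.2 (x - z.1) - kerOp κ f z.2 (x - z.1) =
          kerOp κ (fun y => F k y - f y) z.2 (x - z.1) := by
        simp only [kerOp, smul_sub]
        exact (integral_sub (hE _ (hF k)).1 (hE _ hf).1).symm
      rw [edist_eq_enorm_sub, hsub]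
      have := (hE _ ((hF k).add hneg)).2
      simpa only [← sub_eq_add_neg] using this
    have hfat : ∫⁻ z, ‖kerOp κ f z.2 (x - z.1)‖ₑ ^ q ∂ν ≤
        liminf (fun k => ∫⁻ z, ‖kerOp κ (F k) z.2 (x - z.1)‖ₑ ^ q ∂ν) atTop := by
      refine le_trans (le_of_eq (lintegral_congr_ae ?_)) (lintegral_liminf_le' fun k =>
        ((hmeas _ (hF k).1 x).enorm.pow_const q).aemeasurable)
      filter_upwards [hν.carried] with z hz
      have := (ENNReal.continuous_rpow_const (y := q)).continuousAt.tendsto.comp (hpt z hz.1).enorm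
      exact this.liminf_eq.symm
    have hmono : Monotone (fun a : ℝ≥0∞ => a ^ (1 / q)) :=
      ENNReal.monotone_rpow_of_nonneg (by positivity)
    refine (hmono hfat).trans (le_of_eq ?_)
    exact hmono.map_liminf_of_continuousAt _ ENNReal.continuous_rpow_const.continuousAt
  · intro f _ x ρ hρ hf
    refine (h₁ f x ρ hρ hf).trans ?_
    gcongr
  · intro f hfi x h r hr hh hf
    refine (h₂ f hfi x h r hr hh hf).trans ?_
    gcongr
  · intro f hfi x z₀ r hr hf h0 hx
    refine (h₃ f hfi x z₀ r hr hf h0 hx).trans ?_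
    gcongr

end

end FracLP

namespace FracLP

noncomputable section

variable {n : ℕ} {B : Type*} [NormedAddCommGroup B]

/-! ### The fractional square functions are of Calderón--Zygmund type -/

/-- The exponent is skew-adjoint, so its exponential is unitary. The argument covers the real case,
where I = 0. -/
theorem norm_phase (𝕜 : Type*) [RCLike 𝕜] (α : ℝ) : ‖phase 𝕜 α‖ = 1 := by
  unfold phase
  set θ : ℝ := Real.pi * ((order α : ℝ) - α) with hθ
  have hstar : star (-((RCLike.I : 𝕜) * (θ : 𝕜))) = -(-((RCLike.I : 𝕜) * (θ : 𝕜))) := by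
    simp [RCLike.conj_I]
  have h1 : star (NormedSpace.exp (-((RCLike.I : 𝕜) * (θ : 𝕜)))) *
      NormedSpace.exp (-((RCLike.I : 𝕜) * (θ : 𝕜))) = 1 := by
    rw [NormedSpace.star_exp, hstar]
    let : NormedAlgebra ℚ 𝕜 := NormedAlgebra.restrictScalars ℚ ℝ 𝕜
    rw [← NormedSpace.exp_add_of_commute (Commute.neg_left (Commute.refl _)), neg_add_cancel,
      NormedSpace.exp_zero]
  have h2 := congrArg norm h1
  rw [norm_mul, norm_star, norm_one] at h2
  nlinarith [norm_nonneg (NormedSpace.exp (-((RCLike.I : 𝕜) * (θ : 𝕜))))]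

theorem order_sub_pos (α : ℝ) : 0 < (order α : ℝ) - α := by
  have := Nat.lt_floor_add_one α
  unfold order
  push_cast
  linarith

theorem Adm.const_smul {𝕜 : Type*} [RCLike 𝕜] [NormedSpace 𝕜 B] {δ : ℝ} {f : Rn n → B}
    (hf : Adm δ f) (a : 𝕜) : Adm δ (fun y => a • f y) := by
  refine ⟨hf.1.const_smul a, ?_⟩
  simp only [enorm_smul, mul_assoc]
  rw [lintegral_const_mul' _ _ enorm_ne_top]
  exact ENNReal.mul_lt_top enorm_lt_top hf.2

theorem Adm.sub {δ : ℝ} {f g : Rn n → B} (hf : Adm δ f) (hg : Adm δ g) :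
    Adm δ (fun y => f y - g y) := by
  have hneg : Adm δ (fun y => - g y) := ⟨hg.1.neg, by simpa using hg.2⟩
  simpa only [sub_eq_add_neg] using hf.add hneg

variable [NormedSpace ℝ B]

/-- Each axiom tests the operator on admissible functions only, so agreement there is enough. -/
theorem IsCZ.of_eqOn {𝕜 : Type*} [RCLike 𝕜] [NormedSpace 𝕜 B] {δ : ℝ} {C : ℝ≥0}
    {U V : (Rn n → B) → Rn n → ℝ≥0∞} (hV : IsCZ 𝕜 δ C V) (hδ : 0 ≤ δ)
    (h : ∀ f, Adm δ f → U f = V f) : IsCZ 𝕜 δ C U where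
  measurable f hf := by rw [h f hf]; exact hV.measurable f hf
  congr f g hf hfg := by rw [h f hf, h g (hf.congr hfg)]; exact hV.congr f g hf hfg
  add_le f g hf hg x := by
    rw [h f hf, h g hg, h _ (hf.add hg)]; exact hV.add_le f g hf hg x
  smul a f hf x := by rw [h f hf, h _ (hf.const_smul a)]; exact hV.smul a f hf x
  translate f hf u x := by
    rw [h f (hf.adm hδ), h _ ((hf.comp_add_right u).adm hδ)]; exact hV.translate f hf u x
  lsc f F hf hF hlim x := by
    rw [h f hf]
    simp only [h _ (hF _)]
    exact hV.lsc f F hf hF hlim x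
  size f hf := by rw [h f (hf.adm hδ)]; exact hV.size f hf
  reg f hf x u r := by
    rw [h (fun y => f y - f (y + u)) ((hf.sub (hf.comp_add_right u)).adm hδ)]
    exact hV.reg f hf x u r
  cancel f hf := by rw [h f (hf.adm hδ)]; exact hV.cancel f hf

variable {𝕜 : Type*} [RCLike 𝕜] [NormedSpace 𝕜 B]

/-- `t^α ∂_t^α P_t` is, up to a unimodular factor, convolution with kernels that satisfy
`KerBounds`. -/
theorem exists_kernel_fracDeriv [CompleteSpace B] (n : ℕ) {α δ : ℝ} (hα : 0 < α) (hδ : 0 ≤ δ)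
    (hδα : δ ≤ α) (hδ1 : δ ≤ 1) : ∃ (κ : ℝ → ℝ → ℝ) (C : ℝ), KerBounds n α C κ ∧
      ∀ f : Rn n → B, Adm δ f → ∀ t, 0 < t → ∀ x,
        ‖t ^ α • fracDeriv 𝕜 α f t x‖ₑ = ‖kerOp κ f t x‖ₑ := by
  obtain ⟨D, hD0, hDb, hDh, hDd⟩ := exists_poissonKer_derivs n
  have ha := order_sub_pos α
  have hn : (0 : ℝ) ≤ n := by positivity
  have hab : (order α : ℝ) - α < (n : ℝ) + order α := by linarith
  obtain ⟨C, hC, hsize, hlip⟩ := fracKer_bound (hDh (order α)) ha hab α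
  refine ⟨fracKer α ((order α : ℝ) - α) (D (order α)), C,
    ⟨hC, measurable_fracKer (hDh _) _ _, fun t ht ρ hρ => ?_, fun t ht ρ hρ ρ' hρ' h => ?_⟩,
    fun f hf t ht x => ?_⟩
  · convert hsize t ht ρ hρ using 4
    ring
  · convert hlip t ht ρ hρ ρ' hρ' h using 4
    ring
  · have hint : ∫ s in Ioi (0 : ℝ), s ^ ((order α : ℝ) - α - 1) •
        iteratedDeriv (order α) (fun τ : ℝ => poisson f τ x) (t + s) =
        ∫ s in Ioi (0 : ℝ), s ^ ((order α : ℝ) - α - 1) • kerOp (D (order α)) f (t + s) x := by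
      refine setIntegral_congr_fun measurableSet_Ioi fun s hs => ?_
      have hs' : 0 < s := hs
      rw [iteratedDeriv_poisson hD0 hDb hDh hDd hδ hδ1 hf x (order α) (t + s) (by linarith)]
    rw [← integral_kerOp_shift (hDh _) ha (by linarith : (n : ℝ) + δ ≤ _) hab hδ hf ht x,
      fracDeriv, hint, enorm_smul, enorm_smul, enorm_smul (t ^ α)]
    have : ‖phase 𝕜 α‖ₑ = 1 := by
      rw [← ofReal_norm, norm_phase, ENNReal.ofReal_one]
    rw [this, one_mul]

/-- The measure `δ₀ ⊗ dt/t`. -/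
def radialMeasure (n : ℕ) : Measure (Rn n × ℝ) :=
  Measure.map (fun t => ((0 : Rn n), t))
    ((volume.restrict (Ioi (0 : ℝ))).withDensity fun t => ENNReal.ofReal (1 / t))

theorem lintegral_radialMeasure {G : Rn n × ℝ → ℝ≥0∞} (hG : Measurable G) :
    ∫⁻ z, G z ∂(radialMeasure n) = ∫⁻ t in Ioi (0 : ℝ), G (0, t) * ENNReal.ofReal (1 / t) := by
  rw [radialMeasure, lintegral_map hG (by fun_prop),
    lintegral_withDensity_eq_lintegral_mul _ (by fun_prop) (by fun_prop)]
  refine lintegral_congr fun t => ?_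
  rw [Pi.mul_apply, mul_comm]

theorem coneMeasure_radialMeasure (n : ℕ) : ConeMeasure (radialMeasure n) 1 where
  sfinite := by unfold radialMeasure; infer_instance
  carried := by
    have hm : MeasurableSet {z : Rn n × ℝ | 0 < z.2 ∧ ‖z.1‖ ≤ z.2} := by
      rw [ofPred_and]
      exact (measurableSet_lt (by fun_prop) (by fun_prop)).inter
        (measurableSet_le (by fun_prop) (by fun_prop))
    rw [radialMeasure, ae_map_iff (by fun_prop) hm]
    refine (withDensity_absolutelyContinuous _ _).ae_le ?_
    refine (ae_restrict_iff' measurableSet_Ioi).2 (Eventually.of_forall fun t ht => ?_)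
    have ht' : 0 < t := ht
    exact ⟨ht', by simpa using ht'.le⟩
  marginal φ hφ := by
    rw [lintegral_radialMeasure (by fun_prop), ENNReal.coe_one, one_mul]

/-- The measure `1_{|w| < t} dw dt / t^{n+1}`. -/
def areaMeasure (n : ℕ) : Measure (Rn n × ℝ) :=
  (volume.restrict {z : Rn n × ℝ | 0 < z.2 ∧ ‖z.1‖ < z.2}).withDensity
    fun z => ENNReal.ofReal (1 / z.2 ^ (n + 1))

theorem measurableSet_openCone (n : ℕ) : MeasurableSet {z : Rn n × ℝ | 0 < z.2 ∧ ‖z.1‖ < z.2} := by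
  rw [ofPred_and]
  exact (measurableSet_lt (by fun_prop) (by fun_prop)).inter
    (measurableSet_lt (by fun_prop) (by fun_prop))

theorem lintegral_areaMeasure {G : Rn n × ℝ → ℝ≥0∞} (hG : Measurable G) :
    ∫⁻ z, G z ∂(areaMeasure n) = ∫⁻ z in {z : Rn n × ℝ | 0 < z.2 ∧ ‖z.1‖ < z.2},
      G z * ENNReal.ofReal (1 / z.2 ^ (n + 1)) := by
  rw [areaMeasure, lintegral_withDensity_eq_lintegral_mul _ (by fun_prop) hG]
  refine lintegral_congr fun t => ?_
  rw [Pi.mul_apply, mul_comm]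

/-- The slice of the cone at height t is a ball of volume t^n |B(0,1)|, which turns t^{-n-1} into
1/t. -/
theorem coneMeasure_areaMeasure (n : ℕ) :
    ConeMeasure (areaMeasure n) (volume (Metric.ball (0 : Rn n) 1)).toNNReal where
  sfinite := by unfold areaMeasure; infer_instance
  carried := by
    refine (withDensity_absolutelyContinuous _ _).ae_le ?_
    exact (ae_restrict_iff' (measurableSet_openCone n)).2
      (Eventually.of_forall fun z hz => ⟨hz.1, hz.2.le⟩)
  marginal φ hφ := by
    rw [lintegral_areaMeasure (by fun_prop), ← lintegral_indicator (measurableSet_openCone n),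
      Measure.volume_eq_prod, lintegral_prod_symm' _
        (Measurable.indicator (by fun_prop) (measurableSet_openCone n)),
      ENNReal.coe_toNNReal measure_ball_lt_top.ne, ← lintegral_const_mul _ (by fun_prop),
      ← lintegral_indicator measurableSet_Ioi]
    refine lintegral_mono fun t => ?_
    by_cases ht : t ∈ Ioi (0 : ℝ)
    · have ht' : 0 < t := ht
      rw [indicator_of_mem ht]
      have : ∀ w : Rn n, {z : Rn n × ℝ | 0 < z.2 ∧ ‖z.1‖ < z.2}.indicator
          (fun z => φ z.2 * ENNReal.ofReal (1 / z.2 ^ (n + 1))) (w, t) =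
          (Metric.ball (0 : Rn n) t).indicator
            (fun _ => φ t * ENNReal.ofReal (1 / t ^ (n + 1))) w := by
        intro w
        by_cases hw : ‖w‖ < t
        · rw [indicator_of_mem (by exact ⟨ht', hw⟩), indicator_of_mem (by simpa using hw)]
        · rw [indicator_of_notMem (fun h => hw h.2), indicator_of_notMem (by simpa using hw)]
      simp only [this]
      rw [lintegral_indicator_const Metric.isOpen_ball.measurableSet,
        Measure.addHaar_ball_of_pos _ _ ht', finrank_euclideanSpace, Fintype.card_fin]
      refine le_of_eq ?_
      rw [show φ t * ENNReal.ofReal (1 / t ^ (n + 1)) *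
        (ENNReal.ofReal (t ^ n) * volume (Metric.ball (0 : Rn n) 1)) =
        volume (Metric.ball (0 : Rn n) 1) *
          (φ t * (ENNReal.ofReal (1 / t ^ (n + 1)) * ENNReal.ofReal (t ^ n))) by ring,
        ← ENNReal.ofReal_mul (by positivity)]
      rw [show 1 / t ^ (n + 1) * t ^ n = 1 / t by
        field_simp; ring]
    · refine le_of_eq_of_le ?_ zero_le
      refine lintegral_eq_zero_of_ae_eq_zero (Eventually.of_forall fun w => ?_)
      exact indicator_of_notMem (fun h => ht h.1) _

theorem gFun_eq_sqFun {α q : ℝ} {κ : ℝ → ℝ → ℝ} {C : ℝ} (hκ : KerBounds n α C κ)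
    {f : Rn n → B} (hf : AEStronglyMeasurable f volume)
    (h : ∀ t, 0 < t → ∀ x, ‖t ^ α • fracDeriv 𝕜 α f t x‖ₑ = ‖kerOp κ f t x‖ₑ) :
    gFun 𝕜 q α f = sqFun κ (radialMeasure n) q f := by
  funext x
  have hm : Measurable (fun z : Rn n × ℝ => ‖kerOp κ f z.2 (x - z.1)‖ₑ ^ q) :=
    ((hκ.stronglyMeasurable hf).comp_measurable (g := fun z : Rn n × ℝ => (x, z))
      (by fun_prop)).enorm.pow_const q
  rw [gFun, sqFun, lintegral_radialMeasure hm]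
  congr 1
  refine setLIntegral_congr_fun measurableSet_Ioi fun t ht => ?_
  simp only [sub_zero]
  rw [h t ht x]

/-- The reflection y ↦ x - y preserves the measure and carries the cone at x to the cone at the
origin. -/
theorem areaFun_eq_sqFun {α q : ℝ} {κ : ℝ → ℝ → ℝ} {C : ℝ} (hκ : KerBounds n α C κ)
    {f : Rn n → B} (hf : AEStronglyMeasurable f volume)
    (h : ∀ t, 0 < t → ∀ x, ‖t ^ α • fracDeriv 𝕜 α f t x‖ₑ = ‖kerOp κ f t x‖ₑ) :
    areaFun 𝕜 q α f = sqFun κ (areaMeasure n) q f := by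
  funext x
  have hm : Measurable (fun z : Rn n × ℝ => ‖kerOp κ f z.2 (x - z.1)‖ₑ ^ q) :=
    ((hκ.stronglyMeasurable hf).comp_measurable (g := fun z : Rn n × ℝ => (x, z))
      (by fun_prop)).enorm.pow_const q
  rw [areaFun, sqFun, lintegral_areaMeasure hm]
  congr 1
  have hpres : MeasurePreserving (fun z : Rn n × ℝ => (x - z.1, z.2)) volume volume :=
    (Measure.measurePreserving_sub_left volume x).prod (MeasurePreserving.id volume)
  have hemb : MeasurableEmbedding (fun z : Rn n × ℝ => (x - z.1, z.2)) :=
    ((MeasurableEquiv.subLeft x).prodCongr (MeasurableEquiv.refl ℝ)).measurableEmbedding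
  have hset : (fun z : Rn n × ℝ => (x - z.1, z.2)) ⁻¹' cone x =
      {z : Rn n × ℝ | 0 < z.2 ∧ ‖z.1‖ < z.2} := by
    ext z
    simp [cone]
  rw [← hpres.setLIntegral_comp_preimage_emb hemb, hset]
  refine setLIntegral_congr_fun (measurableSet_openCone n) fun z hz => ?_
  simp only
  rw [h z.2 hz.1]

/-- The weight exponent is δ = min(α, 1): the kernel of the fractional derivative decays with order
n + α, and the Poisson kernel with order n + 1. -/
theorem exists_isCZ [IsScalarTower ℝ 𝕜 B] [CompleteSpace B] (hn : 0 < n) {q α : ℝ} (hq : 1 < q)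
    (hα : 0 < α) {U : (Rn n → B) → Rn n → ℝ≥0∞}
    (hU : U = gFun 𝕜 q α ∨ U = areaFun 𝕜 q α) :
    ∃ δ : ℝ, 0 < δ ∧ ∃ C : ℝ≥0, IsCZ 𝕜 δ C U := by
  have hδ : 0 < min α 1 := lt_min hα one_pos
  obtain ⟨κ, C, hκ, hf⟩ := exists_kernel_fracDeriv (𝕜 := 𝕜) (B := B) n hα hδ.le
    (min_le_left α 1) (min_le_right α 1)
  refine ⟨min α 1, hδ, ?_⟩
  rcases hU with rfl | rfl
  · obtain ⟨D, hD⟩ := isCZ_sqFun (B := B) (𝕜 := 𝕜) hκ (coneMeasure_radialMeasure n) hq hα hn hδ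
      (min_le_left α 1)
    exact ⟨D, hD.of_eqOn hδ.le fun f hfa => gFun_eq_sqFun hκ hfa.1 (hf f hfa)⟩
  · obtain ⟨D, hD⟩ := isCZ_sqFun (B := B) (𝕜 := 𝕜) hκ (coneMeasure_areaMeasure n) hq hα hn hδ
      (min_le_left α 1)
    exact ⟨D, hD.of_eqOn hδ.le fun f hfa => areaFun_eq_sqFun hκ hfa.1 (hf f hfa)⟩

end

end FracLP

/-! ### Real-variable tools: dyadic cells, good-λ, maximal function, Calderón–Zygmund decomposition.
-/

namespace FracLP

noncomputable section

variable {n : ℕ}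

/-! ### Boxes and dyadic cells -/

/-- The half-open cube with lower corner `a` and side length `L`. -/
def hbox (a : Rn n) (L : ℝ) : Set (Rn n) := {y | ∀ i, a i ≤ y i ∧ y i < a i + L}

theorem abs_apply_le_norm (x : Rn n) (i : Fin n) : |x i| ≤ ‖x‖ := PiLp.norm_apply_le x i

theorem norm_le_mul_of_abs_apply_le {x : Rn n} {r : ℝ} (hr : 0 ≤ r) (h : ∀ i, |x i| ≤ r) :
    ‖x‖ ≤ n * r := by
  refine abs_le_of_sq_le_sq' ?_ (by positivity) |>.2
  rw [EuclideanSpace.norm_sq_eq]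
  calc ∑ i, ‖x i‖ ^ 2 ≤ ∑ _i : Fin n, r ^ 2 := by
        refine Finset.sum_le_sum fun i _ => ?_
        have := h i
        rw [Real.norm_eq_abs]
        gcongr
    _ = n * r ^ 2 := by simp
    _ ≤ (n * r) ^ 2 := by
        rw [mul_pow]
        have : (n : ℝ) ≤ (n : ℝ) ^ 2 := by exact_mod_cast Nat.le_self_pow two_ne_zero n
        gcongr

theorem hbox_eq_preimage (a : Rn n) (L : ℝ) :
    hbox a L = WithLp.ofLp ⁻¹' (Set.pi univ fun i => Ico (a i) (a i + L)) := by
  ext y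
  simp [hbox]

theorem cube_eq_preimage (c : Rn n) (r : ℝ) :
    cube c r = WithLp.ofLp ⁻¹' (Icc (fun i => c i - r) (fun i => c i + r)) := by
  ext y
  simp only [cube, mem_ofPred_eq, mem_preimage, mem_Icc, Pi.le_def, abs_le, ← forall_and]
  refine forall_congr' fun i => ?_
  constructor <;> rintro ⟨h1, h2⟩ <;> constructor <;> linarith

theorem measurableSet_hbox (a : Rn n) (L : ℝ) : MeasurableSet (hbox a L) := by
  rw [hbox_eq_preimage]
  exact (MeasurableSet.univ_pi fun i => measurableSet_Ico).preimage
    (PiLp.volume_preserving_ofLp (Fin n)).measurable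

theorem volume_hbox (a : Rn n) {L : ℝ} (hL : 0 ≤ L) :
    volume (hbox a L) = ENNReal.ofReal (L ^ n) := by
  rw [hbox_eq_preimage, (PiLp.volume_preserving_ofLp (Fin n)).measure_preimage
    (MeasurableSet.univ_pi fun i => measurableSet_Ico).nullMeasurableSet, Real.volume_pi_Ico]
  simp [ENNReal.ofReal_pow hL]

theorem isClosed_cube (c : Rn n) (r : ℝ) : IsClosed (cube c r) := by
  rw [cube_eq_preimage]
  exact isClosed_Icc.preimage (PiLp.continuous_ofLp 2 _)

theorem volume_cube (c : Rn n) {r : ℝ} (hr : 0 ≤ r) :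
    volume (cube c r) = ENNReal.ofReal ((2 * r) ^ n) := by
  rw [cube_eq_preimage, (PiLp.volume_preserving_ofLp (Fin n)).measure_preimage
    measurableSet_Icc.nullMeasurableSet, Real.volume_Icc_pi,
    ENNReal.ofReal_pow (by positivity)]
  simp only [add_sub_sub_cancel, ← two_mul, Finset.prod_const, Finset.card_univ, Fintype.card_fin]

theorem ball_subset_cube (c : Rn n) (r : ℝ) : Metric.closedBall c r ⊆ cube c r := by
  intro y hy i
  rw [Metric.mem_closedBall, dist_eq_norm] at hy
  exact (abs_apply_le_norm (y - c) i).trans hy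

theorem cube_subset_closedBall (c : Rn n) {r : ℝ} (hr : 0 ≤ r) :
    cube c r ⊆ Metric.closedBall c (n * r) := by
  intro y hy
  rw [Metric.mem_closedBall, dist_eq_norm]
  exact norm_le_mul_of_abs_apply_le hr hy

/-- The centre of `hbox a L`. -/
def boxCenter (a : Rn n) (L : ℝ) : Rn n := WithLp.toLp 2 fun i => a i + L / 2

theorem hbox_subset_cube (a : Rn n) (L : ℝ) : hbox a L ⊆ cube (boxCenter a L) (L / 2) := by
  intro y hy i
  have := hy i
  rw [abs_le]
  simp only [boxCenter]
  constructor <;> linarith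

/-- Half-open boxes tile exactly; closed cubes are what BMO, atoms and Vitali families use. This
passes between the two. -/
theorem hbox_ae_eq_cube (a : Rn n) {L : ℝ} (hL : 0 ≤ L) :
    hbox a L =ᵐ[volume] cube (boxCenter a L) (L / 2) := by
  refine ae_eq_of_subset_of_measure_ge (hbox_subset_cube a L) ?_
    (measurableSet_hbox a L).nullMeasurableSet ?_
  · rw [volume_hbox a hL, volume_cube _ (by positivity)]
    rw [show 2 * (L / 2) = L by ring]
  · rw [volume_cube _ (by positivity)]
    exact ENNReal.ofReal_ne_top

theorem hbox_subset_closedBall (a : Rn n) {L : ℝ} (hL : 0 ≤ L) :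
    hbox a L ⊆ Metric.closedBall (boxCenter a L) (n * L) := by
  refine (hbox_subset_cube a L).trans ((cube_subset_closedBall _ (by positivity)).trans ?_)
  refine Metric.closedBall_subset_closedBall ?_
  have : (0 : ℝ) ≤ n := by positivity
  nlinarith

/-- The index, at level `k`, of the dyadic cell that contains `y`. -/
def didx (a : Rn n) (L : ℝ) (k : ℕ) (y : Rn n) : Fin n → ℤ :=
  fun i => ⌊(y i - a i) / (L / 2 ^ k)⌋

/-- The lower corner of a dyadic cell. -/
def dcorner (a : Rn n) (L : ℝ) (k : ℕ) (v : Fin n → ℤ) : Rn n :=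
  WithLp.toLp 2 fun i => a i + v i * (L / 2 ^ k)

/-- The dyadic cell of level `k` and index `v` in the grid generated by `hbox a L`. -/
def dcell (a : Rn n) (L : ℝ) (k : ℕ) (v : Fin n → ℤ) : Set (Rn n) :=
  hbox (dcorner a L k v) (L / 2 ^ k)

theorem mem_dcell_iff (a : Rn n) {L : ℝ} (hL : 0 < L) (k : ℕ) (v : Fin n → ℤ) (y : Rn n) :
    y ∈ dcell a L k v ↔ didx a L k y = v := by
  have hl : 0 < L / 2 ^ k := by positivity
  rw [funext_iff]
  refine forall_congr' fun i => ?_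
  simp only [dcorner, didx]
  rw [Int.floor_eq_iff, le_div_iff₀ hl, div_lt_iff₀ hl]
  constructor <;> rintro ⟨h1, h2⟩ <;> constructor <;> linarith

theorem mem_dcell_didx (a : Rn n) {L : ℝ} (hL : 0 < L) (k : ℕ) (y : Rn n) :
    y ∈ dcell a L k (didx a L k y) := (mem_dcell_iff a hL k _ y).2 rfl

theorem dcell_zero (a : Rn n) (L : ℝ) : dcell a L 0 0 = hbox a L := by
  simp [dcell, hbox, dcorner]

/-- Nestedness of the grid: ⌊s⌋ is ⌊2s⌋ divided by 2 with rounding down, so the index of a cell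
determines that of its parent. -/
theorem didx_eq_of_succ {a : Rn n} {L : ℝ} {k : ℕ} {y z : Rn n}
    (h : didx a L (k + 1) y = didx a L (k + 1) z) : didx a L k y = didx a L k z := by
  have key : ∀ s : ℝ, ⌊s⌋ = ⌊2 * s⌋ / 2 := by
    intro s
    rw [Int.floor_eq_iff]
    have h1 := Int.floor_le (2 * s)
    have h2 := Int.lt_floor_add_one (2 * s)
    have h3 : 2 * (⌊2 * s⌋ / 2) ≤ ⌊2 * s⌋ := by omega
    have h4 : ⌊2 * s⌋ ≤ 2 * (⌊2 * s⌋ / 2) + 1 := by omega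
    have h3' : (2 : ℝ) * ((⌊2 * s⌋ / 2 : ℤ) : ℝ) ≤ (⌊2 * s⌋ : ℝ) := by exact_mod_cast h3
    have h4' : (⌊2 * s⌋ : ℝ) ≤ 2 * ((⌊2 * s⌋ / 2 : ℤ) : ℝ) + 1 := by exact_mod_cast h4
    constructor <;> linarith
  have h' : ∀ w : Rn n, ∀ i, didx a L k w i = didx a L (k + 1) w i / 2 := by
    intro w i
    simp only [didx]
    rw [key, pow_succ, show (w i - a i) / (L / (2 ^ k * 2)) = 2 * ((w i - a i) / (L / 2 ^ k)) by
      rw [div_div_eq_mul_div, div_div_eq_mul_div]; ring]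
  funext i
  rw [h' y i, h' z i, h]

theorem didx_eq_of_le {a : Rn n} {L : ℝ} {j k : ℕ} (hjk : j ≤ k) {y z : Rn n}
    (h : didx a L k y = didx a L k z) : didx a L j y = didx a L j z := by
  induction hjk with
  | refl => exact h
  | step _ ih => exact ih (didx_eq_of_succ h)

theorem dcell_subset_of_le (a : Rn n) {L : ℝ} (hL : 0 < L) {j k : ℕ} (hjk : j ≤ k) (y : Rn n) :
    dcell a L k (didx a L k y) ⊆ dcell a L j (didx a L j y) := by
  intro z hz
  rw [mem_dcell_iff a hL] at hz ⊢
  exact didx_eq_of_le hjk hz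

theorem measurableSet_dcell (a : Rn n) (L : ℝ) (k : ℕ) (v : Fin n → ℤ) :
    MeasurableSet (dcell a L k v) := measurableSet_hbox _ _

theorem volume_dcell (a : Rn n) {L : ℝ} (hL : 0 < L) (k : ℕ) (v : Fin n → ℤ) :
    volume (dcell a L k v) = ENNReal.ofReal ((L / 2 ^ k) ^ n) :=
  volume_hbox _ (by positivity)

theorem volume_dcell_eq_succ (a : Rn n) {L : ℝ} (hL : 0 < L) (k : ℕ) (v w : Fin n → ℤ) :
    volume (dcell a L k v) = 2 ^ n * volume (dcell a L (k + 1) w) := by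
  rw [volume_dcell a hL, volume_dcell a hL, show (2 : ℝ≥0∞) ^ n = ENNReal.ofReal (2 ^ n) by
    rw [ENNReal.ofReal_pow (by norm_num)]; norm_num, ← ENNReal.ofReal_mul (by positivity),
    ← mul_pow]
  congr 2
  rw [pow_succ]
  field_simp

/-! ### Lebesgue differentiation along dyadic cells -/

/-- A Vitali family that contains all cubes. -/
def cubeFamily (n : ℕ) : VitaliFamily (volume : Measure (Rn n)) :=
  -- The summand 3^n is the doubling constant the construction demands. The summand (6n)^n compares
  -- a cube of side l with the ball of radius 3nl, which lies in a cube of side 6nl.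
  Vitali.vitaliFamily volume ((6 * n) ^ n + 3 ^ n : ℝ≥0) fun x => by
    refine Eventually.frequently ?_
    filter_upwards [self_mem_nhdsWithin] with r hr
    have hr' : 0 < r := hr
    rw [Measure.addHaar_closedBall _ _ (by positivity), Measure.addHaar_closedBall _ _ hr'.le,
      finrank_euclideanSpace, Fintype.card_fin, ← mul_assoc, mul_pow,
      ENNReal.ofReal_mul (by positivity)]
    gcongr
    rw [ENNReal.ofReal_pow (by norm_num)]
    push_cast
    norm_num

theorem tendsto_cube_filterAt (a : Rn n) {L : ℝ} (hL : 0 < L) (x : Rn n) :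
    Tendsto (fun k => cube (boxCenter (dcorner a L k (didx a L k x)) (L / 2 ^ k)) (L / 2 ^ k / 2))
      atTop ((cubeFamily n).filterAt x) := by
  have hsub : ∀ k, cube (boxCenter (dcorner a L k (didx a L k x)) (L / 2 ^ k)) (L / 2 ^ k / 2) ⊆
      Metric.closedBall x (n * (L / 2 ^ k)) := by
    intro k y hy
    have hx := hbox_subset_cube _ _ (mem_dcell_didx a hL k x)
    rw [Metric.mem_closedBall, dist_eq_norm]
    refine norm_le_mul_of_abs_apply_le (by positivity) fun i => ?_
    have h1 := abs_le.1 (hx i)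
    have h2 := abs_le.1 (hy i)
    rw [PiLp.sub_apply, abs_le]
    constructor <;> linarith [h1.1, h1.2, h2.1, h2.2]
  rw [VitaliFamily.tendsto_filterAt_iff]
  constructor
  · refine Eventually.of_forall fun k => ?_
    have hl : 0 < L / 2 ^ k := by positivity
    refine ⟨isClosed_cube _ _, ?_, n * (L / 2 ^ k), hsub k, ?_⟩
    · refine Set.Nonempty.mono (interior_mono (ball_subset_cube _ _)) ?_
      exact (Metric.nonempty_ball.2 (by positivity)).mono Metric.ball_subset_interior_closedBall
    · refine (measure_mono (ball_subset_cube _ _)).trans ?_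
      rw [volume_cube _ (by positivity), volume_cube _ (by positivity)]
      rw [show 2 * (3 * (n * (L / 2 ^ k))) = (6 * n) * (2 * (L / 2 ^ k / 2)) by ring, mul_pow,
        ENNReal.ofReal_mul (by positivity)]
      gcongr
      rw [ENNReal.ofReal_pow (by positivity), ENNReal.ofReal_mul (by norm_num)]
      push_cast
      rw [ENNReal.ofReal_natCast]
      norm_num
  · intro ε hε
    have hlim : Tendsto (fun k : ℕ => (n : ℝ) * (L / 2 ^ k)) atTop (𝓝 0) := by
      have := (tendsto_pow_atTop_nhds_zero_of_lt_one (r := (1 / 2 : ℝ)) (by norm_num)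
        (by norm_num)).const_mul ((n : ℝ) * L)
      rw [mul_zero] at this
      refine this.congr fun k => ?_
      rw [one_div, inv_pow]
      ring
    filter_upwards [hlim.eventually (Iio_mem_nhds hε)] with k hk
    have hk' : (n : ℝ) * (L / 2 ^ k) < ε := hk
    exact (hsub k).trans (Metric.closedBall_subset_closedBall hk'.le)

theorem ae_tendsto_density_dcell (a : Rn n) {L : ℝ} (hL : 0 < L) {E : Set (Rn n)}
    (hE : MeasurableSet E) : ∀ᵐ x, x ∈ E → Tendsto (fun k =>
      volume (E ∩ dcell a L k (didx a L k x)) / volume (dcell a L k (didx a L k x)))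
      atTop (𝓝 1) := by
  filter_upwards [(cubeFamily n).ae_tendsto_measure_inter_div_of_measurableSet hE] with x hx hxE
  rw [indicator_of_mem hxE, Pi.one_apply] at hx
  refine (hx.comp (tendsto_cube_filterAt a hL x)).congr fun k => ?_
  have h := hbox_ae_eq_cube (dcorner a L k (didx a L k x)) (L := L / 2 ^ k) (by positivity)
  simp only [Function.comp_apply]
  rw [dcell, measure_congr h, measure_congr ((ae_eq_refl E).inter h)]

theorem ae_tendsto_average_dcell {B : Type*} [NormedAddCommGroup B] [NormedSpace ℝ B]
    [CompleteSpace B] (a : Rn n) {L : ℝ} (hL : 0 < L) {f : Rn n → B}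
    (hf : LocallyIntegrable f volume) : ∀ᵐ x, Tendsto (fun k =>
      ⨍ y in dcell a L k (didx a L k x), f y) atTop (𝓝 (f x)) := by
  filter_upwards [(cubeFamily n).ae_tendsto_average hf] with x hx
  refine (hx.comp (tendsto_cube_filterAt a hL x)).congr fun k => ?_
  have h := hbox_ae_eq_cube (dcorner a L k (didx a L k x)) (L := L / 2 ^ k) (by positivity)
  simp only [Function.comp_apply]
  rw [dcell, setAverage_congr h]

/-! ### Stopping cells -/

/-- The maximal dyadic cells with property `P`. -/
def stopCells (a : Rn n) (L : ℝ) (P : ℕ → (Fin n → ℤ) → Prop) : Set (ℕ × (Fin n → ℤ)) :=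
  {p | P p.1 p.2 ∧ ∀ j < p.1, ∀ y ∈ dcell a L p.1 p.2, ¬ P j (didx a L j y)}

theorem exists_mem_stopCells {a : Rn n} {L : ℝ} (hL : 0 < L) {P : ℕ → (Fin n → ℤ) → Prop}
    {y : Rn n} (h : ∃ k, P k (didx a L k y)) :
    ∃ p ∈ stopCells a L P, y ∈ dcell a L p.1 p.2 := by
  classical
  refine ⟨(Nat.find h, didx a L (Nat.find h) y), ⟨Nat.find_spec h, fun j hj z hz => ?_⟩,
    mem_dcell_didx a hL _ y⟩
  rw [mem_dcell_iff a hL] at hz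
  rw [didx_eq_of_le (le_of_lt hj) hz]
  exact Nat.find_min h hj

theorem pairwiseDisjoint_stopCells {a : Rn n} {L : ℝ} (hL : 0 < L)
    (P : ℕ → (Fin n → ℤ) → Prop) :
    (stopCells a L P).PairwiseDisjoint (fun p => dcell a L p.1 p.2) := by
  intro p hp r hr hne
  refine Set.disjoint_left.2 fun y hyp hyr => hne ?_
  have h1 := (mem_dcell_iff a hL _ _ _).1 hyp
  have h2 := (mem_dcell_iff a hL _ _ _).1 hyr
  have h3 : p.1 = r.1 := by
    rcases lt_trichotomy p.1 r.1 with h | h | h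
    · exact absurd (by rw [h1]; exact hp.1) (hr.2 p.1 h y hyr)
    · exact h
    · exact absurd (by rw [h2]; exact hr.1) (hp.2 r.1 h y hyp)
  refine Prod.ext h3 ?_
  rw [← h1, ← h2, h3]

/-- Summing measure estimates over disjoint cells. -/
theorem measure_le_of_forall_cells {ι : Type*} {S : Set ι} (hS : S.Countable)
    {Q : ι → Set (Rn n)} (hQ : ∀ p ∈ S, MeasurableSet (Q p)) (hd : S.PairwiseDisjoint Q)
    {A E : Set (Rn n)} {c : ℝ≥0∞} (hA : ∀ᵐ y, y ∈ A → ∃ p ∈ S, y ∈ Q p)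
    (h : ∀ p ∈ S, volume (A ∩ Q p) ≤ c * volume (E ∩ Q p)) :
    volume A ≤ c * volume E := by
  have h1 : volume A ≤ volume (⋃ p ∈ S, A ∩ Q p) := by
    refine measure_mono_ae ?_
    filter_upwards [hA] with y hy hyA
    obtain ⟨p, hp, hyp⟩ := hy hyA
    exact mem_biUnion hp ⟨hyA, hyp⟩
  calc volume A ≤ volume (⋃ p ∈ S, A ∩ Q p) := h1
    _ ≤ ∑' p : S, volume (A ∩ Q p) := measure_biUnion_le _ hS _
    _ ≤ ∑' p : S, c * volume.restrict E (Q p) := by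
        refine ENNReal.tsum_le_tsum fun p => (h p p.2).trans ?_
        rw [Measure.restrict_apply (hQ p p.2), inter_comm]
    _ = c * volume.restrict E (⋃ p ∈ S, Q p) := by
        rw [ENNReal.tsum_mul_left, measure_biUnion hS hd hQ]
    _ ≤ c * volume E := by
        refine mul_le_mul_right ?_ c
        exact (measure_mono (subset_univ _)).trans_eq (Measure.restrict_apply_univ E)

/-- A good-λ inequality. If `F` oscillates little on most of every box that meets `G`, then the
distribution function of `F` on `G` decays. -/
theorem good_lambda {F : Rn n → ℝ} (hF : Measurable F) {G : Set (Rn n)} {κ lam : ℝ} {ε : ℝ≥0∞}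
    (hε : ε < 1 / 2)
    (hosc : ∀ (b : Rn n) (l : ℝ), 0 < l → (hbox b l ∩ G).Nonempty →
      ∃ c : ℝ, volume (hbox b l ∩ {y | κ < |F y - c|}) ≤ ε * volume (hbox b l))
    (a : Rn n) {L : ℝ} (hL : 0 < L)
    (h0 : volume (hbox a L ∩ {y | lam < F y}) ≤ volume (hbox a L) / 2) :
    volume (hbox a L ∩ {y | lam + 2 * κ < F y} ∩ G) ≤
      2 ^ (n + 1) * ε * volume (hbox a L ∩ {y | lam < F y}) := by
  classical
  -- For κ < 0 the oscillation set is the whole box, so the hypothesis forces the box to miss G.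
  rcases lt_or_ge κ 0 with hκ | hκ
  · by_cases hne : (hbox a L ∩ G).Nonempty
    · exfalso
      obtain ⟨c, hc⟩ := hosc a L hL hne
      have : hbox a L ∩ {y | κ < |F y - c|} = hbox a L :=
        inter_eq_left.2 fun y _ => hκ.trans_le (abs_nonneg _)
      rw [this] at hc
      have hv : volume (hbox a L) ≠ 0 := by
        rw [volume_hbox a hL.le]; simp; positivity
      have hv' : volume (hbox a L) ≠ ∞ := by
        rw [volume_hbox a hL.le]; exact ENNReal.ofReal_ne_top
      have : ε * volume (hbox a L) < 1 * volume (hbox a L) := by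
        refine ENNReal.mul_lt_mul_left hv hv' (hε.trans ?_)
        simp
      rw [one_mul] at this
      exact absurd hc (not_le.2 this)
    · rw [not_nonempty_iff_eq_empty] at hne
      rw [inter_right_comm, hne]
      simp
  set E : Set (Rn n) := hbox a L ∩ {y | lam < F y} with hE
  have hEm : MeasurableSet E :=
    (measurableSet_hbox a L).inter (measurableSet_lt measurable_const hF)
  -- Stop at the maximal cells of which E occupies more than half. By Lebesgue density they cover
  -- almost every point where F > lam + 2κ in the box, since lam + 2κ ≥ lam.
  set P : ℕ → (Fin n → ℤ) → Prop := fun k v =>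
    volume (dcell a L k v) / 2 < volume (E ∩ dcell a L k v) with hP
  have hvol0 : ∀ k v, volume (dcell a L k v) ≠ 0 := fun k v => by
    rw [volume_dcell a hL]; simp; positivity
  have hvolt : ∀ k v, volume (dcell a L k v) ≠ ∞ := fun k v => by
    rw [volume_dcell a hL]; exact ENNReal.ofReal_ne_top
  refine measure_le_of_forall_cells (S := stopCells a L P) (Set.to_countable _)
    (fun p _ => measurableSet_dcell a L p.1 p.2) (pairwiseDisjoint_stopCells hL P) ?_ ?_
  · filter_upwards [ae_tendsto_density_dcell a hL hEm] with y hy hyA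
    refine exists_mem_stopCells hL ?_
    have hyF : lam + 2 * κ < F y := hyA.1.2
    have hyE : y ∈ E := ⟨hyA.1.1, show lam < F y by linarith⟩
    have hhalf : (1 / 2 : ℝ≥0∞) < 1 := by simp
    obtain ⟨k, hk⟩ := ((hy hyE).eventually (Ioi_mem_nhds hhalf)).exists
    refine ⟨k, ?_⟩
    have hk' := hk
    rw [ENNReal.lt_div_iff_mul_lt (Or.inl (hvol0 _ _)) (Or.inl (hvolt _ _))] at hk'
    change _ / 2 < _
    rwa [ENNReal.div_eq_inv_mul, ← one_div]
  · rintro ⟨k, v⟩ ⟨hPkv, hmin⟩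
    simp only at hPkv hmin ⊢
    by_cases hG : (dcell a L k v ∩ G).Nonempty
    swap
    · rw [not_nonempty_iff_eq_empty] at hG
      have : hbox a L ∩ {y | lam + 2 * κ < F y} ∩ G ∩ dcell a L k v = ∅ := by
        rw [eq_empty_iff_forall_notMem] at hG ⊢
        exact fun y hy => hG y ⟨hy.2, hy.1.2⟩
      rw [this]
      simp
    obtain ⟨z, hz, hzG⟩ := hG
    have hEne : (E ∩ dcell a L k v).Nonempty := by
      by_contra hemp
      rw [not_nonempty_iff_eq_empty] at hemp
      change _ / 2 < volume (E ∩ dcell a L k v) at hPkv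
      rw [hemp, measure_empty] at hPkv
      exact not_lt_zero hPkv
    -- Level 0 cannot be selected: the initial box is at most half filled, by `h0`. So a selected
    -- cell has a parent.
    rcases k with _ | k
    · exfalso
      obtain ⟨w, hwE, hw⟩ := hEne
      have hv : v = 0 := by
        rw [mem_dcell_iff a hL] at hw
        rw [← hw, ← mem_dcell_iff a hL, dcell_zero]
        exact hwE.1
      subst hv
      change volume (dcell a L 0 0) / 2 < volume (E ∩ dcell a L 0 0) at hPkv
      rw [dcell_zero] at hPkv
      exact absurd (hPkv.trans_le (measure_mono inter_subset_left)) (not_lt.2 h0)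
    set Q' := dcell a L k (didx a L k z) with hQ'
    have hzv : didx a L (k + 1) z = v := (mem_dcell_iff a hL _ _ _).1 hz
    have hsub : dcell a L (k + 1) v ⊆ Q' := by
      rw [← hzv]; exact dcell_subset_of_le a hL (Nat.le_succ k) z
    have hnP : volume (E ∩ Q') ≤ volume Q' / 2 := not_lt.1 (hmin k (Nat.lt_succ_self k) z hz)
    obtain ⟨c, hc⟩ := hosc (dcorner a L k (didx a L k z)) (L / 2 ^ k) (by positivity)
      ⟨z, mem_dcell_didx a hL k z, hzG⟩
    change volume (Q' ∩ {y | κ < |F y - c|}) ≤ ε * volume Q' at hc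
    have hQ0 : Q' ⊆ hbox a L := by
      obtain ⟨w, hwE, hw⟩ := hEne
      have h1 : didx a L 0 w = 0 := by
        rw [← mem_dcell_iff a hL, dcell_zero]; exact hwE.1
      have h2 : didx a L (k + 1) w = didx a L (k + 1) z := by
        rw [hzv]; exact (mem_dcell_iff a hL _ _ _).1 hw
      have h3 : didx a L 0 z = 0 := by rw [← didx_eq_of_le (Nat.zero_le _) h2, h1]
      have := dcell_subset_of_le a hL (Nat.zero_le k) z
      rwa [h3, dcell_zero] at this
    -- At least half of the parent lies where F ≤ lam. If c > lam + κ, that half would consist of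
    -- points with |F - c| > κ, whose share is at most ε < 1/2.
    have hclam : c ≤ lam + κ := by
      by_contra hlt
      push Not at hlt
      have hcov : Q' ⊆ (E ∩ Q') ∪ (Q' ∩ {y | κ < |F y - c|}) := by
        intro y hy
        by_cases hyl : lam < F y
        · exact Or.inl ⟨⟨hQ0 hy, hyl⟩, hy⟩
        · refine Or.inr ⟨hy, ?_⟩
          push Not at hyl
          change κ < |F y - c|
          rw [lt_abs]
          right; linarith
      have hlt : volume Q' < volume Q' := by
        calc volume Q' ≤ volume (E ∩ Q') + volume (Q' ∩ {y | κ < |F y - c|}) :=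
              (measure_mono hcov).trans (measure_union_le _ _)
          _ ≤ volume Q' / 2 + ε * volume Q' := add_le_add hnP hc
          _ < volume Q' / 2 + 1 / 2 * volume Q' := by
              refine ENNReal.add_lt_add_left ?_ ?_
              · exact ENNReal.div_ne_top (hvolt _ _) (by simp)
              · exact ENNReal.mul_lt_mul_left (hvol0 _ _) (hvolt _ _) hε
          _ = volume Q' := by
              rw [one_div, ← ENNReal.div_eq_inv_mul, ENNReal.add_halves]
      exact lt_irrefl _ hlt
    -- Where F > lam + 2κ the bound on c gives F - c > κ, a set of measure at most ε times that of
    -- the parent. Passing to the selected cell costs 2^n, and passing to its part in E costs 2.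
    calc volume (hbox a L ∩ {y | lam + 2 * κ < F y} ∩ G ∩ dcell a L (k + 1) v)
        ≤ volume (Q' ∩ {y | κ < |F y - c|}) := by
          refine measure_mono fun y hy => ⟨hsub hy.2, ?_⟩
          have : lam + 2 * κ < F y := hy.1.1.2
          change κ < |F y - c|
          rw [lt_abs]
          left; linarith
      _ ≤ ε * volume Q' := hc
      _ = 2 ^ (n + 1) * ε * (volume (dcell a L (k + 1) v) / 2) := by
          rw [hQ', volume_dcell_eq_succ a hL k _ v, pow_succ, ENNReal.div_eq_inv_mul]
          calc ε * (2 ^ n * volume (dcell a L (k + 1) v))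
              = 2 ^ n * ε * (2 * 2⁻¹) * volume (dcell a L (k + 1) v) := by
                rw [ENNReal.mul_inv_cancel (by simp) (by simp)]; ring
            _ = _ := by ring
      _ ≤ 2 ^ (n + 1) * ε * volume (E ∩ dcell a L (k + 1) v) := by
          gcongr

end

end FracLP

namespace FracLP

noncomputable section

variable {n : ℕ}

/-! ### The maximal inequality -/

/-- The set where the (centred) maximal function of `φ` exceeds `lam`, up to normalization. -/
def bad (φ : Rn n → ℝ≥0∞) (lam : ℝ) : Set (Rn n) :=
  {x | ∃ r : ℝ, 0 < r ∧ ENNReal.ofReal (lam * r ^ n) < ∫⁻ y in Metric.closedBall x r, φ y}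

theorem lintegral_closedBall_le_of_notMem_bad {φ : Rn n → ℝ≥0∞} {lam : ℝ} {x : Rn n}
    (hx : x ∉ bad φ lam) {r : ℝ} (hr : 0 < r) :
    ∫⁻ y in Metric.closedBall x r, φ y ≤ ENNReal.ofReal (lam * r ^ n) := by
  by_contra h
  exact hx ⟨r, hr, not_le.1 h⟩

theorem bad_congr {φ ψ : Rn n → ℝ≥0∞} (h : φ =ᵐ[volume] ψ) (lam : ℝ) : bad φ lam = bad ψ lam := by
  ext x
  refine exists_congr fun r => ?_
  rw [lintegral_congr_ae (ae_restrict_of_ae h)]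

/-- The volume of the unit ball. -/
def unitVol (n : ℕ) : ℝ≥0∞ := volume (Metric.ball (0 : Rn n) 1)

theorem unitVol_ne_zero (n : ℕ) : unitVol n ≠ 0 :=
  (Metric.measure_ball_pos _ _ one_pos).ne'

theorem unitVol_ne_top (n : ℕ) : unitVol n ≠ ∞ := measure_ball_lt_top.ne

theorem volume_closedBall (x : Rn n) {r : ℝ} (hr : 0 ≤ r) :
    volume (Metric.closedBall x r) = ENNReal.ofReal (r ^ n) * unitVol n := by
  rw [Measure.addHaar_closedBall _ _ hr, finrank_euclideanSpace, Fintype.card_fin, unitVol]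

/-- The weak type (1,1) inequality for the maximal function. -/
theorem volume_bad_le (hn : 0 < n) (φ : Rn n → ℝ≥0∞) {lam : ℝ} (hlam : 0 < lam) :
    volume (bad φ lam) ≤ 5 ^ n * unitVol n * ENNReal.ofReal (1 / lam) * ∫⁻ y, φ y := by
  rcases eq_or_ne (∫⁻ y, φ y) ∞ with hI | hI
  · rw [hI, ENNReal.mul_top]
    · exact le_top
    · have : ENNReal.ofReal (1 / lam) ≠ 0 := by simp [hlam]
      exact mul_ne_zero (mul_ne_zero (by simp) (unitVol_ne_zero n)) this
  set I : ℝ := (∫⁻ y, φ y).toReal with hIdef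
  have hex : ∀ x : Rn n, ∃ r : ℝ, x ∈ bad φ lam → 0 < r ∧
      ENNReal.ofReal (lam * r ^ n) < ∫⁻ y in Metric.closedBall x r, φ y := by
    intro x
    by_cases h : x ∈ bad φ lam
    · obtain ⟨r, hr⟩ := h
      exact ⟨r, fun _ => hr⟩
    · exact ⟨1, fun h' => absurd h' h⟩
  choose r hr using hex
  -- Vitali's covering lemma needs bounded radii. They are bounded because lam r^n is less than the
  -- total mass and r ≤ r^n for r > 1.
  have hR : ∀ x ∈ bad φ lam, r x ≤ 1 + I / lam := by
    intro x hx
    obtain ⟨h1, h2⟩ := hr x hx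
    have hI0 : 0 ≤ I / lam := by positivity
    rcases le_or_gt (r x) 1 with h | h
    · linarith
    · have h3 : ENNReal.ofReal (lam * r x ^ n) < ENNReal.ofReal I := by
        rw [hIdef, ENNReal.ofReal_toReal hI]
        exact h2.trans_le (setLIntegral_le_lintegral _ _)
      have h4 : lam * r x ^ n < I :=
        (ENNReal.ofReal_lt_ofReal_iff_of_nonneg (by positivity)).1 h3
      have h5 : r x ≤ r x ^ n := le_self_pow₀ h.le hn.ne'
      have h6 : r x ≤ I / lam := by
        rw [le_div_iff₀ hlam]
        nlinarith
      linarith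
  obtain ⟨u, hut, hud, hucov⟩ := Vitali.exists_disjoint_subfamily_covering_enlargement_closedBall
    (bad φ lam) (fun x => x) r _ hR 5 (by norm_num)
  have huc : u.Countable := by
    refine hud.countable_of_nonempty_interior fun x hx => ?_
    exact (Metric.nonempty_ball.2 (hr x (hut hx)).1).mono Metric.ball_subset_interior_closedBall
  calc volume (bad φ lam) ≤ volume (⋃ x ∈ u, Metric.closedBall x (5 * r x)) := by
        refine measure_mono fun x hx => ?_
        obtain ⟨b, hb, hsub⟩ := hucov x hx
        exact mem_biUnion hb (hsub (Metric.mem_closedBall_self (hr x hx).1.le))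
    _ ≤ ∑' x : u, volume (Metric.closedBall (x : Rn n) (5 * r x)) := measure_biUnion_le _ huc _
    _ ≤ ∑' x : u, 5 ^ n * unitVol n * ENNReal.ofReal (1 / lam) *
          ∫⁻ y in Metric.closedBall (x : Rn n) (r x), φ y := by
        refine ENNReal.tsum_le_tsum fun x => ?_
        obtain ⟨h1, h2⟩ := hr x (hut x.2)
        rw [volume_closedBall _ (by positivity)]
        calc ENNReal.ofReal ((5 * r x) ^ n) * unitVol n
            = 5 ^ n * unitVol n * ENNReal.ofReal (1 / lam) * ENNReal.ofReal (lam * r x ^ n) := by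
              rw [mul_assoc (5 ^ n * unitVol n), ← ENNReal.ofReal_mul (by positivity),
                show 1 / lam * (lam * r x ^ n) = r x ^ n by field_simp, mul_pow,
                ENNReal.ofReal_mul (by positivity), ENNReal.ofReal_pow (by norm_num)]
              norm_num
              ring
          _ ≤ _ := by gcongr
    _ = 5 ^ n * unitVol n * ENNReal.ofReal (1 / lam) *
          ∫⁻ y in ⋃ x ∈ u, Metric.closedBall x (r x), φ y := by
        rw [ENNReal.tsum_mul_left, lintegral_biUnion huc
          (fun x _ => Metric.isClosed_closedBall.measurableSet) hud]
    _ ≤ _ := by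
        gcongr
        exact Measure.restrict_le_self

/-- The maximal function of `φ` at height `lam` is controlled by the part of `φ` above a
multiple of `lam`. -/
theorem bad_subset_bad_indicator {φ : Rn n → ℝ≥0∞} (hφ : Measurable φ) {lam : ℝ}
    (hlam : 0 < lam) :
    bad φ lam ⊆ bad ({y | ENNReal.ofReal (lam / (2 * (unitVol n).toReal)) < φ y}.indicator φ)
      (lam / 2) := by
  intro x hx
  by_contra hnot
  obtain ⟨r, hr, hlt⟩ := hx
  set c : ℝ≥0∞ := ENNReal.ofReal (lam / (2 * (unitVol n).toReal)) with hc
  have hω : 0 < (unitVol n).toReal := ENNReal.toReal_pos (unitVol_ne_zero n) (unitVol_ne_top n)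
  have h1 := lintegral_closedBall_le_of_notMem_bad hnot hr
  have hms : MeasurableSet {y | c < φ y} := measurableSet_lt measurable_const hφ
  have h2 : ∫⁻ y in Metric.closedBall x r, φ y ≤
      (∫⁻ y in Metric.closedBall x r, {y | c < φ y}.indicator φ y) +
        ∫⁻ _y in Metric.closedBall x r, c := by
    rw [← lintegral_add_left (hφ.indicator hms)]
    refine lintegral_mono fun y => ?_
    by_cases hy : c < φ y
    · rw [indicator_of_mem (by exact hy)]
      exact le_self_add
    · rw [indicator_of_notMem (by exact hy), zero_add]
      exact not_lt.1 hy
  rw [setLIntegral_const, volume_closedBall _ hr.le] at h2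
  have h3 : c * (ENNReal.ofReal (r ^ n) * unitVol n) = ENNReal.ofReal (lam / 2 * r ^ n) := by
    rw [hc, ← ENNReal.ofReal_toReal (unitVol_ne_top n), ← ENNReal.ofReal_mul (by positivity),
      ← ENNReal.ofReal_mul (by positivity), ENNReal.toReal_ofReal hω.le]
    congr 1
    field_simp
  rw [h3] at h2
  have h4 := h2.trans (add_le_add_left h1 _)
  rw [← ENNReal.ofReal_add (by positivity) (by positivity),
    show lam / 2 * r ^ n + lam / 2 * r ^ n = lam * r ^ n by ring] at h4
  exact absurd hlt (not_lt.2 h4)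

theorem lintegral_Ioo_rpow {p R : ℝ} (hp : 1 < p) (hR : 0 ≤ R) :
    ∫⁻ t in Ioo 0 R, ENNReal.ofReal (t ^ (p - 2)) = ENNReal.ofReal (R ^ (p - 1) / (p - 1)) := by
  rw [setLIntegral_congr Ioo_ae_eq_Ioc, ← ofReal_integral_eq_lintegral_ofReal]
  · rw [← intervalIntegral.integral_of_le hR, integral_rpow (Or.inl (by linarith)),
      show p - 2 + 1 = p - 1 by ring, Real.zero_rpow (by linarith), sub_zero]
  · exact (intervalIntegrable_iff_integrableOn_Ioc_of_le hR).1
      (intervalIntegral.intervalIntegrable_rpow' (by linarith))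
  · refine (ae_restrict_iff' measurableSet_Ioc).2 (Eventually.of_forall fun t ht => ?_)
    have : 0 < t := ht.1
    simp only [Pi.zero_apply]
    positivity

/-- The strong type inequality for the maximal function, in terms of the distribution function. -/
theorem exists_lintegral_bad_le (hn : 0 < n) {p γ : ℝ} (hp : 1 < p) (hγ : 0 < γ) :
    ∃ C : ℝ≥0, ∀ φ : Rn n → ℝ≥0∞, AEMeasurable φ volume →
      ∫⁻ t in Ioi (0 : ℝ), volume (bad φ (γ * t)) * ENNReal.ofReal (t ^ (p - 1)) ≤
        C * ∫⁻ y, φ y ^ p := by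
  have hω : 0 < (unitVol n).toReal := ENNReal.toReal_pos (unitVol_ne_zero n) (unitVol_ne_top n)
  -- At height γt, values of φ below ct contribute at most half of the average, so only the part
  -- above ct enters the weak type bound. Integrating that bound in t first leaves φ^p.
  set c : ℝ := γ / (2 * (unitVol n).toReal) with hc
  have hc0 : 0 < c := by positivity
  have hp1 : 0 < p - 1 := by linarith
  set D : ℝ≥0∞ := 5 ^ n * unitVol n * ENNReal.ofReal (2 / γ) with hD
  have hDtop : D ≠ ∞ := by
    refine ENNReal.mul_ne_top (ENNReal.mul_ne_top (by simp) (unitVol_ne_top n))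
      ENNReal.ofReal_ne_top
  have hD0 : D ≠ 0 := by
    refine mul_ne_zero (mul_ne_zero (by simp) (unitVol_ne_zero n)) ?_
    simp [hγ]
  set K : ℝ := 1 / (c ^ (p - 1) * (p - 1)) with hK
  have hK0 : 0 < K := by positivity
  have hmain : ∀ φ : Rn n → ℝ≥0∞, Measurable φ →
      ∫⁻ t in Ioi (0 : ℝ), volume (bad φ (γ * t)) * ENNReal.ofReal (t ^ (p - 1)) ≤
        D * ENNReal.ofReal K * ∫⁻ y, φ y ^ p := by
    intro φ hφ
    have hjm : Measurable (fun z : ℝ × Rn n => ENNReal.ofReal (z.1 ^ (p - 2)) *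
        {z : ℝ × Rn n | ENNReal.ofReal (c * z.1) < φ z.2}.indicator (fun z => φ z.2) z) := by
      refine Measurable.mul (by fun_prop) (Measurable.indicator (by fun_prop) ?_)
      exact measurableSet_lt (by fun_prop) (by fun_prop)
    have h1 : ∀ t ∈ Ioi (0 : ℝ), volume (bad φ (γ * t)) * ENNReal.ofReal (t ^ (p - 1)) ≤
        ∫⁻ y, D * (ENNReal.ofReal (t ^ (p - 2)) *
          {z : ℝ × Rn n | ENNReal.ofReal (c * z.1) < φ z.2}.indicator (fun z => φ z.2) (t, y)) := by
      intro t ht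
      have ht' : 0 < t := ht
      have h2 := (measure_mono (bad_subset_bad_indicator hφ (mul_pos hγ ht'))).trans
        (volume_bad_le hn _ (by positivity))
      rw [show γ * t / (2 * (unitVol n).toReal) = c * t by rw [hc]; ring] at h2
      have hcongr : ∀ y, {z : ℝ × Rn n | ENNReal.ofReal (c * z.1) < φ z.2}.indicator
          (fun z => φ z.2) (t, y) = {y | ENNReal.ofReal (c * t) < φ y}.indicator φ y := by
        intro y
        by_cases hy : ENNReal.ofReal (c * t) < φ y
        · rw [indicator_of_mem (by exact hy), indicator_of_mem (by exact hy)]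
        · rw [indicator_of_notMem (by exact hy), indicator_of_notMem (by exact hy)]
      simp only [hcongr]
      rw [lintegral_const_mul' _ _ hDtop, lintegral_const_mul' _ _ ENNReal.ofReal_ne_top]
      calc volume (bad φ (γ * t)) * ENNReal.ofReal (t ^ (p - 1))
          ≤ 5 ^ n * unitVol n * ENNReal.ofReal (1 / (γ * t / 2)) *
            (∫⁻ y, {y | ENNReal.ofReal (c * t) < φ y}.indicator φ y) *
              ENNReal.ofReal (t ^ (p - 1)) := by gcongr
        _ = 5 ^ n * unitVol n * (ENNReal.ofReal (1 / (γ * t / 2)) * ENNReal.ofReal (t ^ (p - 1))) *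
            ∫⁻ y, {y | ENNReal.ofReal (c * t) < φ y}.indicator φ y := by ring
        _ = _ := by
            rw [← ENNReal.ofReal_mul (by positivity),
              show 1 / (γ * t / 2) * t ^ (p - 1) = 2 / γ * t ^ (p - 2) by
                rw [show p - 1 = (p - 2) + 1 by ring, Real.rpow_add_one ht'.ne']
                field_simp,
              ENNReal.ofReal_mul (by positivity), hD]
            ring
    calc ∫⁻ t in Ioi (0 : ℝ), volume (bad φ (γ * t)) * ENNReal.ofReal (t ^ (p - 1))
        ≤ ∫⁻ t in Ioi (0 : ℝ), ∫⁻ y, D * (ENNReal.ofReal (t ^ (p - 2)) *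
          {z : ℝ × Rn n | ENNReal.ofReal (c * z.1) < φ z.2}.indicator (fun z => φ z.2) (t, y)) :=
          setLIntegral_mono' measurableSet_Ioi h1
      _ = ∫⁻ y, ∫⁻ t in Ioi (0 : ℝ), D * (ENNReal.ofReal (t ^ (p - 2)) *
          {z : ℝ × Rn n | ENNReal.ofReal (c * z.1) < φ z.2}.indicator (fun z => φ z.2) (t, y)) :=
          lintegral_lintegral_swap (hjm.const_mul D).aemeasurable
      _ ≤ ∫⁻ y, D * (ENNReal.ofReal K * φ y ^ p) := by
          refine lintegral_mono fun y => ?_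
          rw [lintegral_const_mul' _ _ hDtop]
          gcongr
          rcases eq_or_ne (φ y) ∞ with htop | htop
          · rw [htop, ENNReal.top_rpow_of_pos (by linarith), ENNReal.mul_top (by simp [hK0])]
            exact le_top
          set R : ℝ := (φ y).toReal with hR
          have hR0 : 0 ≤ R := ENNReal.toReal_nonneg
          have hφR : φ y = ENNReal.ofReal R := (ENNReal.ofReal_toReal htop).symm
          calc ∫⁻ t in Ioi (0 : ℝ), ENNReal.ofReal (t ^ (p - 2)) *
                {z : ℝ × Rn n | ENNReal.ofReal (c * z.1) < φ z.2}.indicator (fun z => φ z.2) (t, y)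
              ≤ ∫⁻ t in Ioi (0 : ℝ), (Ioo 0 (R / c)).indicator
                  (fun t => ENNReal.ofReal (t ^ (p - 2)) * φ y) t := by
                refine setLIntegral_mono' measurableSet_Ioi fun t ht => ?_
                by_cases hy : ENNReal.ofReal (c * t) < φ y
                · rw [indicator_of_mem (by exact hy), indicator_of_mem]
                  refine ⟨ht, ?_⟩
                  rw [hφR] at hy
                  have ht' : 0 < t := ht
                  have := (ENNReal.ofReal_lt_ofReal_iff_of_nonneg (by positivity)).1 hy
                  rw [lt_div_iff₀ hc0]
                  linarith
                · rw [indicator_of_notMem (by exact hy), mul_zero]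
                  exact zero_le
            _ ≤ ∫⁻ t, (Ioo 0 (R / c)).indicator
                  (fun t => ENNReal.ofReal (t ^ (p - 2)) * φ y) t := setLIntegral_le_lintegral _ _
            _ = ENNReal.ofReal ((R / c) ^ (p - 1) / (p - 1)) * φ y := by
                rw [lintegral_indicator measurableSet_Ioo, lintegral_mul_const' _ _ htop,
                  lintegral_Ioo_rpow hp (by positivity)]
            _ = ENNReal.ofReal K * φ y ^ p := by
                rw [hφR, ENNReal.ofReal_rpow_of_nonneg hR0 (by linarith),
                  ← ENNReal.ofReal_mul (by positivity), ← ENNReal.ofReal_mul (by positivity)]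
                congr 1
                rw [Real.div_rpow hR0 hc0.le, hK]
                rcases hR0.eq_or_lt with h0 | h0
                · rw [← h0, Real.zero_rpow hp1.ne', Real.zero_rpow (by linarith : p ≠ 0)]; ring
                · rw [show p = (p - 1) + 1 by ring, Real.rpow_add_one h0.ne', add_sub_cancel_right]
                  field_simp
      _ = D * ENNReal.ofReal K * ∫⁻ y, φ y ^ p := by
          rw [lintegral_const_mul' _ _ hDtop, lintegral_const_mul' _ _ ENNReal.ofReal_ne_top]
          ring
  refine ⟨(D * ENNReal.ofReal K).toNNReal, fun φ hφ => ?_⟩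
  rw [ENNReal.coe_toNNReal (ENNReal.mul_ne_top hDtop ENNReal.ofReal_ne_top)]
  have h1 := hmain (hφ.mk φ) hφ.measurable_mk
  have h2 : ∫⁻ y, hφ.mk φ y ^ p = ∫⁻ y, φ y ^ p := by
    refine lintegral_congr_ae ?_
    filter_upwards [hφ.ae_eq_mk] with y hy
    rw [hy]
  rw [h2] at h1
  simpa only [bad_congr hφ.ae_eq_mk] using h1

/-- Tails: growth of the integrals over the balls `B(x, 2^j r)` controls the integral against
`|x - y|^{-(n + 1/2)}` over `|x - y| ≥ r`. -/
theorem exists_tail_le (n : ℕ) : ∃ C : ℝ, 0 ≤ C ∧ ∀ (φ : Rn n → ℝ≥0∞) (x : Rn n) (r M : ℝ), 0 < r →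
    0 ≤ M → (∀ j : ℕ, ∫⁻ y in Metric.closedBall x (2 ^ (j + 1) * r), φ y ≤
      ENNReal.ofReal (M * (j + 1) * (2 ^ j * r) ^ n)) →
    ∫⁻ y in {y | r ≤ ‖x - y‖}, φ y * ENNReal.ofReal (‖x - y‖ ^ (-((n : ℝ) + 1 / 2))) ≤
      ENNReal.ofReal (C * M * r ^ (-(1 / 2) : ℝ)) := by
  -- The ratio between consecutive dyadic shells. The factor j + 1 allowed in the hypothesis is
  -- harmless against θ^j; it accommodates the drift of BMO averages.
  set θ : ℝ := 2 ^ (-(1 / 2) : ℝ) with hθ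
  have hθ0 : 0 < θ := by positivity
  have hθ1 : θ < 1 := Real.rpow_lt_one_of_one_lt_of_neg (by norm_num) (by norm_num)
  have hsum : Summable (fun j : ℕ => ((j : ℝ) + 1) * θ ^ j) := by
    have h1 := summable_pow_mul_geometric_of_norm_lt_one 1
      (by rwa [Real.norm_of_nonneg hθ0.le] : ‖θ‖ < 1)
    have h2 := summable_geometric_of_lt_one hθ0.le hθ1
    refine (h1.add h2).congr fun j => ?_
    rw [pow_one]; ring
  refine ⟨∑' j : ℕ, ((j : ℝ) + 1) * θ ^ j, tsum_nonneg fun j => by positivity,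
    fun φ x r M hr hM h => ?_⟩
  have hcov : {y : Rn n | r ≤ ‖x - y‖} ⊆
      ⋃ j : ℕ, {y : Rn n | 2 ^ j * r ≤ ‖x - y‖ ∧ ‖x - y‖ ≤ 2 ^ (j + 1) * r} := by
    intro y hy
    have hy' : r ≤ ‖x - y‖ := hy
    obtain ⟨j, hj⟩ := exists_nat_pow_near (x := ‖x - y‖ / r) (y := (2 : ℝ))
      (by rwa [le_div_iff₀ hr, one_mul]) (by norm_num)
    rw [le_div_iff₀ hr, div_lt_iff₀ hr] at hj
    exact mem_iUnion.2 ⟨j, hj.1, hj.2.le⟩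
  have hterm : ∀ j : ℕ, ∫⁻ y in {y : Rn n | 2 ^ j * r ≤ ‖x - y‖ ∧ ‖x - y‖ ≤ 2 ^ (j + 1) * r},
      φ y * ENNReal.ofReal (‖x - y‖ ^ (-((n : ℝ) + 1 / 2))) ≤
      ENNReal.ofReal (M * r ^ (-(1 / 2) : ℝ) * (((j : ℝ) + 1) * θ ^ j)) := by
    intro j
    have hms : MeasurableSet
        {y : Rn n | 2 ^ j * r ≤ ‖x - y‖ ∧ ‖x - y‖ ≤ 2 ^ (j + 1) * r} := by
      rw [ofPred_and]
      exact (measurableSet_le (by fun_prop) (by fun_prop)).inter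
        (measurableSet_le (by fun_prop) (by fun_prop))
    have hn0 : (0 : ℝ) ≤ n := by positivity
    calc _ ≤ ∫⁻ y in {y : Rn n | 2 ^ j * r ≤ ‖x - y‖ ∧ ‖x - y‖ ≤ 2 ^ (j + 1) * r},
          φ y * ENNReal.ofReal ((2 ^ j * r) ^ (-((n : ℝ) + 1 / 2))) := by
          refine setLIntegral_mono' hms fun y hy => ?_
          refine mul_le_mul_of_nonneg_left (ENNReal.ofReal_le_ofReal ?_) zero_le
          exact Real.rpow_le_rpow_of_nonpos (by positivity : 0 < 2 ^ j * r) hy.1 (by linarith)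
      _ = (∫⁻ y in {y : Rn n | 2 ^ j * r ≤ ‖x - y‖ ∧ ‖x - y‖ ≤ 2 ^ (j + 1) * r}, φ y) *
          ENNReal.ofReal ((2 ^ j * r) ^ (-((n : ℝ) + 1 / 2))) :=
          lintegral_mul_const' _ _ ENNReal.ofReal_ne_top
      _ ≤ ENNReal.ofReal (M * (j + 1) * (2 ^ j * r) ^ n) *
          ENNReal.ofReal ((2 ^ j * r) ^ (-((n : ℝ) + 1 / 2))) := by
          gcongr
          refine (lintegral_mono_set fun y hy => ?_).trans (h j)
          rw [Metric.mem_closedBall, dist_comm, dist_eq_norm]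
          exact hy.2
      _ = _ := by
          rw [← ENNReal.ofReal_mul (by positivity)]
          congr 1
          have h2j : (0 : ℝ) < 2 ^ j * r := by positivity
          rw [mul_assoc, ← Real.rpow_natCast (2 ^ j * r) n, ← Real.rpow_add h2j,
            show (n : ℝ) + -((n : ℝ) + 1 / 2) = -(1 / 2) by ring,
            Real.mul_rpow (by positivity) hr.le, hθ, ← Real.rpow_natCast 2 j,
            ← Real.rpow_natCast (2 ^ (-(1 / 2) : ℝ)) j, ← Real.rpow_mul (by norm_num),
            ← Real.rpow_mul (by norm_num), mul_comm (j : ℝ) (-(1 / 2))]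
          ring
  calc _ ≤ ∫⁻ y in ⋃ j : ℕ, {y : Rn n | 2 ^ j * r ≤ ‖x - y‖ ∧ ‖x - y‖ ≤ 2 ^ (j + 1) * r},
        φ y * ENNReal.ofReal (‖x - y‖ ^ (-((n : ℝ) + 1 / 2))) := lintegral_mono_set hcov
    _ ≤ ∑' j : ℕ, ENNReal.ofReal (M * r ^ (-(1 / 2) : ℝ) * (((j : ℝ) + 1) * θ ^ j)) :=
        (lintegral_iUnion_le _ _).trans (ENNReal.tsum_le_tsum hterm)
    _ = _ := by
        rw [← ENNReal.ofReal_tsum_of_nonneg (fun j => by positivity) (hsum.mul_left _),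
          tsum_mul_left]
        congr 1
        ring

/-! ### Absorption in good-λ inequalities -/

theorem lintegral_comp_two_mul (g : ℝ → ℝ≥0∞) : ∫⁻ t, g t = 2 * ∫⁻ t, g (2 * t) := by
  have h := Real.smul_map_volume_mul_left (a := 2) two_ne_zero
  have hemb : MeasurableEmbedding (fun t : ℝ => 2 * t) :=
    measurableEmbedding_mulLeft₀ (two_ne_zero (α := ℝ))
  calc ∫⁻ t, g t = ∫⁻ t, g t ∂(ENNReal.ofReal |2| • Measure.map (2 * ·) volume) := by rw [h]
    _ = 2 * ∫⁻ t, g (2 * t) := by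
        rw [lintegral_smul_measure, hemb.lintegral_map]
        simp

/-- Substituting 2t for t on (0, 2N) gives I(2N) ≤ 2^p (η I(N) + Ψ) ≤ I(2N)/2 + 2^p Ψ. The first
term can be absorbed only because the truncated integrals are finite, which is what `hfin` is for.
-/
theorem lintegral_rpow_le_of_good_lambda {Φ ψ : ℝ → ℝ≥0∞} (hΦ : Measurable Φ) {p : ℝ} (hp : 0 < p)
    {η : ℝ≥0∞} (hη : 2 ^ p * η ≤ 1 / 2) (h : ∀ t, 0 < t → Φ (2 * t) ≤ η * Φ t + ψ t)
    (hfin : ∀ N : ℝ, 0 < N → ∫⁻ t in Ioo 0 N, Φ t * ENNReal.ofReal (t ^ (p - 1)) ≠ ∞) :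
    ∫⁻ t in Ioi (0 : ℝ), Φ t * ENNReal.ofReal (t ^ (p - 1)) ≤
      2 ^ (p + 1) * ∫⁻ t in Ioi (0 : ℝ), ψ t * ENNReal.ofReal (t ^ (p - 1)) := by
  set Ψ : ℝ≥0∞ := ∫⁻ t in Ioi (0 : ℝ), ψ t * ENNReal.ofReal (t ^ (p - 1)) with hΨ
  set I : ℝ → ℝ≥0∞ := fun N => ∫⁻ t in Ioo 0 N, Φ t * ENNReal.ofReal (t ^ (p - 1)) with hI
  have h2p : (2 : ℝ≥0∞) ^ p ≠ ∞ := ENNReal.rpow_ne_top_of_nonneg hp.le (by simp)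
  have hstep : ∀ N, 0 < N → I (2 * N) ≤ 2 ^ p * (η * I N + Ψ) := by
    intro N hN
    have h1 : I (2 * N) = 2 ^ p * ∫⁻ t in Ioo 0 N, Φ (2 * t) * ENNReal.ofReal (t ^ (p - 1)) := by
      rw [hI]
      simp only
      rw [← lintegral_indicator measurableSet_Ioo, lintegral_comp_two_mul,
        ← lintegral_const_mul' _ _ (by simp), ← lintegral_const_mul' _ _ h2p,
        ← lintegral_indicator measurableSet_Ioo]
      refine lintegral_congr fun t => ?_
      by_cases ht : t ∈ Ioo 0 N
      · have ht0 : 0 < t := ht.1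
        have ht2 : 2 * t ∈ Ioo 0 (2 * N) := ⟨by linarith, by linarith [ht.2]⟩
        rw [indicator_of_mem ht, indicator_of_mem ht2, Real.mul_rpow (by norm_num) ht0.le,
          ENNReal.ofReal_mul (by positivity), ← ENNReal.ofReal_rpow_of_pos (by norm_num),
          ENNReal.ofReal_ofNat, show p = 1 + (p - 1) by ring,
          ENNReal.rpow_add _ _ (by simp) (by simp), ENNReal.rpow_one]
        ring_nf
      · have ht2 : 2 * t ∉ Ioo 0 (2 * N) := fun h2 =>
          ht ⟨by linarith [h2.1], by linarith [h2.2]⟩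
        rw [indicator_of_notMem ht, indicator_of_notMem ht2, mul_zero]
    rw [h1]
    gcongr
    calc ∫⁻ t in Ioo 0 N, Φ (2 * t) * ENNReal.ofReal (t ^ (p - 1))
        ≤ ∫⁻ t in Ioo 0 N, (η * (Φ t * ENNReal.ofReal (t ^ (p - 1))) +
            ψ t * ENNReal.ofReal (t ^ (p - 1))) := by
          refine setLIntegral_mono' measurableSet_Ioo fun t ht => ?_
          calc Φ (2 * t) * ENNReal.ofReal (t ^ (p - 1))
              ≤ (η * Φ t + ψ t) * ENNReal.ofReal (t ^ (p - 1)) := by gcongr; exact h t ht.1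
            _ = _ := by ring
      _ = η * I N + ∫⁻ t in Ioo 0 N, ψ t * ENNReal.ofReal (t ^ (p - 1)) := by
          rw [lintegral_add_left (by fun_prop), lintegral_const_mul _ (by fun_prop)]
      _ ≤ η * I N + Ψ := add_le_add le_rfl (lintegral_mono_set Ioo_subset_Ioi_self)
  have hbound : ∀ N, 0 < N → I (2 * N) ≤ 2 ^ (p + 1) * Ψ := by
    intro N hN
    have hmono : I N ≤ I (2 * N) :=
      lintegral_mono_set (Ioo_subset_Ioo_right (by linarith))
    have hne : I (2 * N) ≠ ∞ := hfin _ (by linarith)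
    have h1 : I (2 * N) ≤ 1 / 2 * I (2 * N) + 2 ^ p * Ψ := by
      refine (hstep N hN).trans ?_
      rw [mul_add, ← mul_assoc]
      gcongr
    have h2 : I (2 * N) = 1 / 2 * I (2 * N) + 1 / 2 * I (2 * N) := by
      rw [← add_mul, one_div, ENNReal.inv_two_add_inv_two, one_mul]
    have h3 : 1 / 2 * I (2 * N) ≤ 2 ^ p * Ψ := by
      have hne' : 1 / 2 * I (2 * N) ≠ ∞ := ENNReal.mul_ne_top (by simp) hne
      rw [h2, mul_add] at h1
      refine (ENNReal.add_le_add_iff_left hne').1 ?_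
      calc 1 / 2 * I (2 * N) + 1 / 2 * I (2 * N)
          ≤ _ := h1
        _ = 1 / 2 * I (2 * N) + 2 ^ p * Ψ := by
            rw [← mul_add, ← h2]
    calc I (2 * N) = 2 * (1 / 2 * I (2 * N)) := by
          rw [← mul_assoc, one_div, ENNReal.mul_inv_cancel (by simp) (by simp), one_mul]
      _ ≤ 2 * (2 ^ p * Ψ) := by gcongr
      _ = 2 ^ (p + 1) * Ψ := by
          rw [ENNReal.rpow_add _ _ (by simp) (by simp), ENNReal.rpow_one]; ring
  have hunion : Ioi (0 : ℝ) = ⋃ N : ℕ, Ioo (0 : ℝ) (2 * ((N : ℝ) + 1)) := by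
    ext t
    simp only [mem_Ioi, mem_iUnion, mem_Ioo, exists_and_left]
    refine ⟨fun ht => ⟨ht, ?_⟩, fun ht => ht.1⟩
    obtain ⟨N, hN⟩ := exists_nat_gt t
    exact ⟨N, by linarith⟩
  rw [hunion, setLIntegral_iUnion_of_directed]
  · exact iSup_le fun N => hbound _ (by positivity)
  · refine Monotone.directed_le fun N M hNM => Ioo_subset_Ioo_right ?_
    have : (N : ℝ) ≤ M := by exact_mod_cast hNM
    linarith

/-- The same absorption with the supremum of s Φ(s) over 0 < s < N in place of the integral. -/
theorem mul_le_of_good_lambda {Φ : ℝ → ℝ≥0∞} {A η : ℝ≥0∞} (hη : 2 * η ≤ 1 / 2)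
    (h : ∀ t, 0 < t → Φ (2 * t) ≤ η * Φ t + A * ENNReal.ofReal (1 / t))
    (hfin : ∀ N : ℝ, 0 < N → ∃ K : ℝ≥0∞, K ≠ ∞ ∧ ∀ t, 0 < t → t < N → ENNReal.ofReal t * Φ t ≤ K)
    {t : ℝ} (ht : 0 < t) : ENNReal.ofReal t * Φ t ≤ 4 * A := by
  set S : ℝ → ℝ≥0∞ := fun N => ⨆ (s : ℝ) (_ : 0 < s ∧ s < N), ENNReal.ofReal s * Φ s with hS
  have hle : ∀ N s, 0 < s → s < N → ENNReal.ofReal s * Φ s ≤ S N := fun N s h0 hN =>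
    le_iSup₂_of_le s ⟨h0, hN⟩ le_rfl
  set N : ℝ := 2 * t with hN
  have hNpos : 0 < N := by linarith
  have hne : S N ≠ ∞ := by
    obtain ⟨K, hK, hb⟩ := hfin N hNpos
    exact ne_top_of_le_ne_top hK (iSup₂_le fun s hs => hb s hs.1 hs.2)
  have h1 : S N ≤ 1 / 2 * S N + 2 * A := by
    refine iSup₂_le fun s hs => ?_
    have hs2 : 0 < s / 2 := by linarith [hs.1]
    have h2 := h (s / 2) hs2
    rw [show 2 * (s / 2) = s by ring] at h2
    have h3 : ENNReal.ofReal s = 2 * ENNReal.ofReal (s / 2) := by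
      rw [← ENNReal.ofReal_ofNat 2, ← ENNReal.ofReal_mul (by norm_num)]
      congr 1; ring
    calc ENNReal.ofReal s * Φ s
        ≤ ENNReal.ofReal s * (η * Φ (s / 2) + A * ENNReal.ofReal (1 / (s / 2))) := by gcongr
      _ = 2 * η * (ENNReal.ofReal (s / 2) * Φ (s / 2)) +
          2 * A * (ENNReal.ofReal (s / 2) * ENNReal.ofReal (1 / (s / 2))) := by rw [h3]; ring
      _ ≤ 1 / 2 * S N + 2 * A * 1 := by
          gcongr
          · exact hle N _ hs2 (by linarith [hs.2])
          · rw [← ENNReal.ofReal_mul hs2.le, mul_one_div_cancel hs2.ne', ENNReal.ofReal_one]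
      _ = _ := by rw [mul_one]
  have h2 : S N = 1 / 2 * S N + 1 / 2 * S N := by
    rw [← add_mul, one_div, ENNReal.inv_two_add_inv_two, one_mul]
  have h3 : 1 / 2 * S N ≤ 2 * A := by
    have hne' : 1 / 2 * S N ≠ ∞ := ENNReal.mul_ne_top (by simp) hne
    refine (ENNReal.add_le_add_iff_left hne').1 ?_
    rw [← h2]
    exact h1
  calc ENNReal.ofReal t * Φ t ≤ S N := hle N t ht (by linarith)
    _ = 2 * (1 / 2 * S N) := by
        rw [← mul_assoc, one_div, ENNReal.mul_inv_cancel (by simp) (by simp), one_mul]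
    _ ≤ 2 * (2 * A) := by gcongr
    _ = 4 * A := by rw [← mul_assoc]; norm_num

end

end FracLP

namespace FracLP

noncomputable section

variable {n : ℕ} {B : Type*} [NormedAddCommGroup B]

/-! ### The Calderón--Zygmund decomposition -/

theorem enorm_setAverage_le [NormedSpace ℝ B] (f : Rn n → B) (Q : Set (Rn n)) :
    ‖⨍ y in Q, f y‖ₑ ≤ (volume Q)⁻¹ * ∫⁻ y in Q, ‖f y‖ₑ := by
  rw [setAverage_eq']
  refine (enorm_integral_le_lintegral_enorm _).trans (le_of_eq ?_)
  rw [lintegral_smul_measure, smul_eq_mul]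

theorem lintegral_sub_setAverage_le [NormedSpace ℝ B] (f : Rn n → B) (Q : Set (Rn n)) :
    ∫⁻ y in Q, ‖f y - ⨍ z in Q, f z‖ₑ ≤ 2 * ∫⁻ y in Q, ‖f y‖ₑ := by
  calc ∫⁻ y in Q, ‖f y - ⨍ z in Q, f z‖ₑ ≤ ∫⁻ y in Q, (‖f y‖ₑ + ‖⨍ z in Q, f z‖ₑ) :=
        lintegral_mono fun y => enorm_sub_le
    _ = (∫⁻ y in Q, ‖f y‖ₑ) + volume Q * ‖⨍ z in Q, f z‖ₑ := by
        rw [lintegral_add_right _ measurable_const, setLIntegral_const, mul_comm]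
    _ ≤ (∫⁻ y in Q, ‖f y‖ₑ) + volume Q * ((volume Q)⁻¹ * ∫⁻ y in Q, ‖f y‖ₑ) := by
        gcongr
        exact enorm_setAverage_le f Q
    _ ≤ (∫⁻ y in Q, ‖f y‖ₑ) + 1 * ∫⁻ y in Q, ‖f y‖ₑ := by
        rw [← mul_assoc]
        gcongr
        exact ENNReal.mul_inv_le_one _
    _ = 2 * ∫⁻ y in Q, ‖f y‖ₑ := by ring

/-- The error after N terms is at most the sum of the remaining norms, and the integrals of these
form the tail of a convergent series. -/
theorem tendsto_lintegral_partial_sum {b : ℕ → Rn n → B} {f : Rn n → B}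
    (hb : ∀ i, AEStronglyMeasurable (b i) volume) (hsum : ∑' i, ∫⁻ y, ‖b i y‖ₑ ≠ ∞)
    (hf : ∀ y, Tendsto (fun N => ∑ i ∈ Finset.range N, b i y) atTop (𝓝 (f y))) :
    Tendsto (fun N => ∫⁻ y, ‖∑ i ∈ Finset.range N, b i y - f y‖ₑ) atTop (𝓝 0) := by
  have hle : ∀ N, ∫⁻ y, ‖∑ i ∈ Finset.range N, b i y - f y‖ₑ ≤
      ∑' i, ∫⁻ y, ‖b (i + N) y‖ₑ := by
    intro N
    rw [← lintegral_tsum fun i => (hb _).enorm]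
    refine lintegral_mono fun y => ?_
    have h1 : Tendsto (fun M => ‖∑ i ∈ Finset.range N, b i y - ∑ i ∈ Finset.range (M + N), b i y‖ₑ)
        atTop (𝓝 ‖∑ i ∈ Finset.range N, b i y - f y‖ₑ) :=
      (tendsto_const_nhds.sub ((hf y).comp (tendsto_add_atTop_nat N))).enorm
    refine le_of_tendsto h1 (Eventually.of_forall fun M => ?_)
    rw [enorm_sub_rev, add_comm M N, Finset.sum_range_add, add_sub_cancel_left]
    refine (enorm_sum_le _ _).trans ?_
    simp only [add_comm N]
    exact ENNReal.sum_le_tsum _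
  exact tendsto_of_tendsto_of_tendsto_of_le_of_le tendsto_const_nhds
    (ENNReal.tendsto_sum_nat_add _ hsum) (fun _ => zero_le) hle

variable [NormedSpace ℝ B]

/-- The Calderón--Zygmund decomposition of `f` on a box, at height `h`. -/
theorem exists_cz_decomposition [CompleteSpace B] (hn : 0 < n) (a : Rn n) {L : ℝ} (hL : 0 < L)
    {f : Rn n → B} (hf : Integrable f) (hsupp : Function.support f ⊆ hbox a L) {h : ℝ} (hh : 0 < h)
    (hmass : ∫⁻ y, ‖f y‖ₑ ≤ ENNReal.ofReal h * volume (hbox a L)) :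
    ∃ (b : ℕ → Rn n → B) (s : Rn n → B) (z : ℕ → Rn n) (ρ : ℕ → ℝ) (Ω : Set (Rn n)),
      (∀ i, Integrable (b i)) ∧ (∀ i, ∫ y, b i y = 0) ∧ (∀ i, 0 < ρ i) ∧
      (∀ i y, b i y ≠ 0 → ‖y - z i‖ ≤ ρ i) ∧
      (∀ i, b i = 0 ∨ Metric.closedBall (z i) (2 * ρ i) ⊆ Ω) ∧
      ∑' i, ∫⁻ y, ‖b i y‖ₑ ≤ 2 * ∫⁻ y, ‖f y‖ₑ ∧
      Tendsto (fun N => ∫⁻ y, ‖∑ i ∈ Finset.range N, b i y - s y‖ₑ) atTop (𝓝 0) ∧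
      Integrable s ∧
      (∀ᵐ y, ‖f y - s y‖ ≤ 2 ^ n * h) ∧ (∀ y, f y - s y ≠ 0 → y ∈ hbox a L) ∧
      MeasurableSet Ω ∧
      volume Ω ≤ ENNReal.ofReal ((2 * n) ^ n) * unitVol n * ENNReal.ofReal (1 / h) *
        ∫⁻ y, ‖f y‖ₑ := by
  classical
  -- Stop when the mean of ‖f‖ over the cell exceeds h.
  set P : ℕ → (Fin n → ℤ) → Prop := fun k v =>
    ENNReal.ofReal h * volume (dcell a L k v) < ∫⁻ y in dcell a L k v, ‖f y‖ₑ with hP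
  have : Nonempty (Fin n → ℤ) := ⟨0⟩
  have hden : Nonempty (Denumerable (ℕ × (Fin n → ℤ))) := nonempty_denumerable _
  obtain ⟨hden⟩ := hden
  set e : ℕ ≃ ℕ × (Fin n → ℤ) := (Denumerable.eqv (ℕ × (Fin n → ℤ))).symm with he
  set S := stopCells a L P with hS
  -- All dyadic cells are enumerated and the unselected ones replaced by ∅, so that the bad parts
  -- form an honest sequence, possibly with zero terms.
  set Q : ℕ → Set (Rn n) := fun i => if e i ∈ S then dcell a L (e i).1 (e i).2 else ∅ with hQ
  have hQact : ∀ i, e i ∈ S → Q i = dcell a L (e i).1 (e i).2 := fun i hi => if_pos hi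
  have hQina : ∀ i, e i ∉ S → Q i = ∅ := fun i hi => if_neg hi
  have hvolt : ∀ i, volume (Q i) ≠ ∞ := by
    intro i
    by_cases hi : e i ∈ S
    · rw [hQact i hi, volume_dcell a hL]; exact ENNReal.ofReal_ne_top
    · rw [hQina i hi]; simp
  have hQm : ∀ i, MeasurableSet (Q i) := by
    intro i
    by_cases hi : e i ∈ S
    · rw [hQact i hi]; exact measurableSet_dcell _ _ _ _
    · rw [hQina i hi]; exact MeasurableSet.empty
  have hQd : Pairwise (Function.onFun Disjoint Q) := by
    intro i j hij
    by_cases hi : e i ∈ S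
    · by_cases hj : e j ∈ S
      · simp only [Function.onFun]
        rw [hQact i hi, hQact j hj]
        exact pairwiseDisjoint_stopCells hL P hi hj (fun h => hij (e.injective h))
      · simp only [Function.onFun]
        rw [hQina j hj]; exact disjoint_bot_right
    · simp only [Function.onFun]
      rw [hQina i hi]; exact disjoint_bot_left
  have hvol0 : ∀ v, volume (dcell a L 0 v) = volume (hbox a L) := by
    intro v
    rw [volume_dcell a hL, volume_hbox a hL.le]; simp
  have hP0 : ∀ v, ¬ P 0 v := by
    intro v hv
    change ENNReal.ofReal h * volume (dcell a L 0 v) < _ at hv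
    rw [hvol0] at hv
    exact absurd (hv.trans_le (setLIntegral_le_lintegral _ _)) (not_lt.2 hmass)
  -- The parent was not selected, so the mean on a selected cell is at most 2^n h. A parent exists
  -- because `hmass` rules out level 0.
  have hupper : ∀ i, e i ∈ S → ∫⁻ y in Q i, ‖f y‖ₑ ≤
      ENNReal.ofReal (2 ^ n * h) * volume (Q i) := by
    intro i hi
    have hi' := hi
    rw [hQact i hi]
    rcases hei : e i with ⟨k, v⟩
    rw [hei] at hi'
    obtain ⟨hPkv, hmin⟩ := hi'
    simp only at hPkv hmin ⊢
    rcases k with _ | k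
    · exact absurd hPkv (hP0 v)
    have hne : (dcell a L (k + 1) v).Nonempty := by
      rw [nonempty_iff_ne_empty]
      intro hemp
      change ENNReal.ofReal h * volume (dcell a L (k + 1) v) < _ at hPkv
      rw [hemp] at hPkv
      simp at hPkv
    obtain ⟨w, hw⟩ := hne
    have hwv := (mem_dcell_iff a hL _ _ _).1 hw
    have hnP := not_lt.1 (hmin k (Nat.lt_succ_self k) w hw)
    have hsub : dcell a L (k + 1) v ⊆ dcell a L k (didx a L k w) := by
      rw [← hwv]; exact dcell_subset_of_le a hL (Nat.le_succ k) w
    refine (lintegral_mono_set hsub).trans (hnP.trans (le_of_eq ?_))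
    rw [volume_dcell_eq_succ a hL k _ v, ENNReal.ofReal_mul (by positivity),
      ENNReal.ofReal_pow (by norm_num), ENNReal.ofReal_ofNat]
    ring
  have hlower : ∀ i, volume (Q i) ≤ ENNReal.ofReal (1 / h) * ∫⁻ y in Q i, ‖f y‖ₑ := by
    intro i
    by_cases hi : e i ∈ S
    · rw [hQact i hi]
      have h1 : ENNReal.ofReal h * volume (dcell a L (e i).1 (e i).2) ≤
        ∫⁻ y in dcell a L (e i).1 (e i).2, ‖f y‖ₑ := le_of_lt hi.1
      calc volume (dcell a L (e i).1 (e i).2)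
          = ENNReal.ofReal (1 / h) * (ENNReal.ofReal h * volume (dcell a L (e i).1 (e i).2)) := by
            rw [← mul_assoc, ← ENNReal.ofReal_mul (by positivity), one_div_mul_cancel hh.ne',
              ENNReal.ofReal_one, one_mul]
        _ ≤ _ := by gcongr
    · rw [hQina i hi]; simp
  have hsubQ0 : ∀ i, Q i ⊆ hbox a L := by
    intro i
    by_cases hi : e i ∈ S
    · rw [hQact i hi]
      have hPi : ENNReal.ofReal h * volume (dcell a L (e i).1 (e i).2) <
        ∫⁻ y in dcell a L (e i).1 (e i).2, ‖f y‖ₑ := hi.1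
      have hex : ∃ w ∈ dcell a L (e i).1 (e i).2, f w ≠ 0 := by
        by_contra hno
        push Not at hno
        have : ∫⁻ y in dcell a L (e i).1 (e i).2, ‖f y‖ₑ = 0 := by
          rw [setLIntegral_congr_fun (g := fun _ => 0) (measurableSet_dcell _ _ _ _)
            (fun y hy => by simp [hno y hy])]
          simp
        rw [this] at hPi
        exact not_lt_zero hPi
      obtain ⟨w, hw, hfw⟩ := hex
      have h1 : didx a L 0 w = 0 := by
        rw [← mem_dcell_iff a hL, dcell_zero]; exact hsupp hfw
      have h2 := (mem_dcell_iff a hL _ _ _).1 hw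
      have := dcell_subset_of_le a hL (Nat.zero_le (e i).1) w
      rwa [h1, dcell_zero, h2] at this
    · rw [hQina i hi]; exact empty_subset _
  have hsumQ : ∑' i, ∫⁻ y in Q i, ‖f y‖ₑ ≤ ∫⁻ y, ‖f y‖ₑ := by
    rw [← lintegral_iUnion hQm hQd]
    exact setLIntegral_le_lintegral _ _
  set av : ℕ → B := fun i => ⨍ y in Q i, f y with hav
  set b : ℕ → Rn n → B := fun i => (Q i).indicator fun y => f y - av i with hb
  -- The sum of the bad parts; the good part is f - s.
  set s : Rn n → B := fun y => ∑' i, b i y with hs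
  have hbint : ∀ i, Integrable (b i) := fun i =>
    (hf.integrableOn.sub (integrableOn_const (hvolt i))).integrable_indicator (hQm i)
  have hbL1 : ∀ i, ∫⁻ y, ‖b i y‖ₑ ≤ 2 * ∫⁻ y in Q i, ‖f y‖ₑ := by
    intro i
    simp only [hb, enorm_indicator_eq_indicator_enorm]
    rw [lintegral_indicator (hQm i)]
    exact lintegral_sub_setAverage_le f (Q i)
  have hbsum : ∑' i, ∫⁻ y, ‖b i y‖ₑ ≤ 2 * ∫⁻ y, ‖f y‖ₑ := by
    refine (ENNReal.tsum_le_tsum hbL1).trans ?_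
    rw [ENNReal.tsum_mul_left]
    gcongr
  have hzero : ∀ i j y, y ∈ Q i → j ≠ i → b j y = 0 := fun i j y hy hji =>
    indicator_of_notMem (fun hyj => Set.disjoint_left.1 (hQd hji) hyj hy) _
  have hs_in : ∀ i y, y ∈ Q i → s y = f y - av i := by
    intro i y hy
    rw [hs]
    simp only
    rw [tsum_eq_single i (fun j hj => hzero i j y hy hj)]
    exact indicator_of_mem hy _
  have hs_out : ∀ y, (∀ i, y ∉ Q i) → s y = 0 := by
    intro y hy
    rw [hs]
    simp only
    have : ∀ i, b i y = 0 := fun i => indicator_of_notMem (hy i) _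
    simp [this]
  have hpt : ∀ y, Tendsto (fun N => ∑ i ∈ Finset.range N, b i y) atTop (𝓝 (s y)) := by
    intro y
    have hsm : Summable fun i => b i y := by
      by_cases hy : ∃ i, y ∈ Q i
      · obtain ⟨i, hi⟩ := hy
        exact (hasSum_single i (fun j hj => hzero i j y hi hj)).summable
      · push Not at hy
        have : ∀ i, b i y = 0 := fun i => indicator_of_notMem (hy i) _
        simp only [this]
        exact summable_zero
    exact hsm.hasSum.tendsto_sum_nat
  have hsm : AEStronglyMeasurable s volume := by
    refine aestronglyMeasurable_of_tendsto_ae (f := fun N y => ∑ i ∈ Finset.range N, b i y) atTop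
      (fun N => ?_) (Eventually.of_forall hpt)
    exact Finset.aestronglyMeasurable_fun_sum _ fun i _ => (hbint i).1
  have hftop : ∫⁻ y, ‖f y‖ₑ ≠ ∞ := hf.2.ne
  have hbsum_ne : ∑' i, ∫⁻ y, ‖b i y‖ₑ ≠ ∞ :=
    ne_top_of_le_ne_top (ENNReal.mul_ne_top (by simp) hftop) hbsum
  have hsint : Integrable s := by
    refine ⟨hsm, lt_of_le_of_lt ?_ hbsum_ne.lt_top⟩
    rw [← lintegral_tsum fun i => (hbint i).1.enorm]
    refine lintegral_mono fun y => le_of_tendsto (hpt y).enorm (Eventually.of_forall fun N => ?_)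
    exact (enorm_sum_le _ _).trans (ENNReal.sum_le_tsum _)
  set l : ℕ → ℝ := fun i => L / 2 ^ (e i).1 with hl
  have hlpos : ∀ i, 0 < l i := fun i => by rw [hl]; positivity
  have hn' : (0 : ℝ) < n := by exact_mod_cast hn
  set z : ℕ → Rn n := fun i => boxCenter (dcorner a L (e i).1 (e i).2) (l i) with hz
  set Ω : Set (Rn n) := ⋃ i, if e i ∈ S then Metric.closedBall (z i) (2 * (n * l i)) else ∅ with hΩ
  have hsubball : ∀ i, Q i ⊆ Metric.closedBall (z i) (n * l i) := by
    intro i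
    by_cases hi : e i ∈ S
    · rw [hQact i hi]
      exact hbox_subset_closedBall _ (hlpos i).le
    · rw [hQina i hi]; exact empty_subset _
  refine ⟨b, s, z, fun i => n * l i, Ω, hbint, fun i => ?_, fun i => mul_pos hn' (hlpos i),
    fun i y hy => ?_, fun i => ?_, hbsum,
    tendsto_lintegral_partial_sum (fun i => (hbint i).1) hbsum_ne hpt, hsint, ?_, ?_, ?_, ?_⟩
  · simp only [hb]
    rw [integral_indicator (hQm i), integral_sub hf.integrableOn (integrableOn_const (hvolt i)),
      setIntegral_const, measure_smul_setAverage _ (hvolt i), sub_self]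
  · have hyQ : y ∈ Q i := by
      by_contra hno
      exact hy (indicator_of_notMem hno _)
    have := hsubball i hyQ
    rwa [Metric.mem_closedBall, dist_eq_norm] at this
  · by_cases hi : e i ∈ S
    · right
      refine subset_iUnion_of_subset i ?_
      rw [if_pos hi]
    · left
      funext y
      simp only [hb]
      rw [hQina i hi]
      simp
  -- Off the selected cells every dyadic mean is at most h, and these means converge to f almost
  -- everywhere.
  · have hbd : ∀ᵐ y, (∀ i, y ∉ Q i) → ‖f y‖ ≤ h := by
      filter_upwards [ae_tendsto_average_dcell a hL hf.locallyIntegrable] with y hy hyQ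
      refine le_of_tendsto hy.norm (Eventually.of_forall fun k => ?_)
      have hnP : ¬ P k (didx a L k y) := by
        intro hPk
        obtain ⟨p, hp, hyp⟩ := exists_mem_stopCells hL ⟨k, hPk⟩
        refine hyQ (e.symm p) ?_
        rw [hQact _ (by rw [Equiv.apply_symm_apply]; exact hp), Equiv.apply_symm_apply]
        exact hyp
      have h1 := enorm_setAverage_le f (dcell a L k (didx a L k y))
      have h2 := not_lt.1 hnP
      have hv0 : volume (dcell a L k (didx a L k y)) ≠ 0 := by
        rw [volume_dcell a hL]; simp; positivity
      have hvt : volume (dcell a L k (didx a L k y)) ≠ ∞ := by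
        rw [volume_dcell a hL]; exact ENNReal.ofReal_ne_top
      have h3 : ‖⨍ z in dcell a L k (didx a L k y), f z‖ₑ ≤ ENNReal.ofReal h := by
        refine h1.trans ?_
        calc _ ≤ (volume (dcell a L k (didx a L k y)))⁻¹ *
              (ENNReal.ofReal h * volume (dcell a L k (didx a L k y))) := by gcongr
          _ = ENNReal.ofReal h * (volume (dcell a L k (didx a L k y)) *
              (volume (dcell a L k (didx a L k y)))⁻¹) := by ring
          _ = ENNReal.ofReal h := by rw [ENNReal.mul_inv_cancel hv0 hvt, mul_one]
      rwa [← ofReal_norm, ENNReal.ofReal_le_ofReal_iff hh.le] at h3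
    filter_upwards [hbd] with y hy
    by_cases hyQ : ∃ i, y ∈ Q i
    · obtain ⟨i, hi⟩ := hyQ
      have hiS : e i ∈ S := by
        by_contra hno
        rw [hQina i hno] at hi
        exact hi
      rw [hs_in i y hi, sub_sub_cancel]
      have h1 := enorm_setAverage_le f (Q i)
      have hv0 : volume (Q i) ≠ 0 := by
        rw [hQact i hiS, volume_dcell a hL]; simp; positivity
      have h3 : ‖av i‖ₑ ≤ ENNReal.ofReal (2 ^ n * h) := by
        refine h1.trans ?_
        calc _ ≤ (volume (Q i))⁻¹ * (ENNReal.ofReal (2 ^ n * h) * volume (Q i)) := by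
              gcongr; exact hupper i hiS
          _ = ENNReal.ofReal (2 ^ n * h) * (volume (Q i) * (volume (Q i))⁻¹) := by ring
          _ = _ := by rw [ENNReal.mul_inv_cancel hv0 (hvolt i), mul_one]
      rwa [← ofReal_norm, ENNReal.ofReal_le_ofReal_iff (by positivity)] at h3
    · push Not at hyQ
      rw [hs_out y hyQ, sub_zero]
      refine (hy hyQ).trans ?_
      have : (1 : ℝ) ≤ 2 ^ n := one_le_pow₀ (by norm_num)
      nlinarith
  · intro y hy
    by_contra hno
    refine hy ?_
    rw [hs_out y fun i hi => hno (hsubQ0 i hi), sub_zero]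
    by_contra hfy
    exact hno (hsupp hfy)
  · refine MeasurableSet.iUnion fun i => ?_
    split_ifs
    · exact Metric.isClosed_closedBall.measurableSet
    · exact MeasurableSet.empty
  · refine (measure_iUnion_le _).trans ?_
    calc _ ≤ ∑' i, ENNReal.ofReal ((2 * n) ^ n) * unitVol n * ENNReal.ofReal (1 / h) *
          ∫⁻ y in Q i, ‖f y‖ₑ := by
          refine ENNReal.tsum_le_tsum fun i => ?_
          by_cases hi : e i ∈ S
          · rw [if_pos hi, volume_closedBall _ (by have := hlpos i; positivity), ← mul_assoc,
              mul_pow, ENNReal.ofReal_mul (by positivity)]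
            have h1 := hlower i
            rw [hQact i hi, volume_dcell a hL] at h1
            calc _ = ENNReal.ofReal ((2 * n) ^ n) * unitVol n * ENNReal.ofReal (l i ^ n) := by ring
              _ ≤ _ := by
                rw [mul_assoc (ENNReal.ofReal ((2 * (n : ℝ)) ^ n) * unitVol n), hQact i hi]
                gcongr
          · rw [if_neg hi]; simp
      _ ≤ _ := by
          rw [ENNReal.tsum_mul_left]
          gcongr

end

end FracLP

/-! ### From the local weak type estimate to the global bounds. -/

namespace FracLP

noncomputable section

variable {n : ℕ} {B : Type*} [NormedAddCommGroup B]
variable {𝕜 : Type*} [RCLike 𝕜] [NormedSpace 𝕜 B] [NormedSpace ℝ B] {δ : ℝ} {C : ℝ≥0}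
  {U : (Rn n → B) → Rn n → ℝ≥0∞}

/-! ### Local weak type estimates -/

/-- A local weak type `(∞, 1)` estimate, uniform in the boxes. -/
def WeakOnBounded (U : (Rn n → B) → Rn n → ℝ≥0∞) : Prop :=
  ∃ C : ℝ≥0, ∀ (a : Rn n) (L : ℝ), 0 < L → ∀ (f : Rn n → B) (M : ℝ), 0 ≤ M →
    AEStronglyMeasurable f → Function.support f ⊆ hbox a L → (∀ᵐ y, ‖f y‖ ≤ M) → ∀ s : ℝ, 0 < s →
      volume (hbox a L ∩ {x | ENNReal.ofReal s < U f x}) ≤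
        C * ENNReal.ofReal (M / s) * volume (hbox a L)

/-- A local estimate in measure for integrable functions, uniform in the boxes. -/
def SmallOnIntegrable (U : (Rn n → B) → Rn n → ℝ≥0∞) : Prop :=
  ∀ ε : ℝ, 0 < ε → ∃ K : ℝ, 0 < K ∧ ∀ (a : Rn n) (L : ℝ), 0 < L → ∀ (f : Rn n → B) (lam : ℝ),
    0 < lam → Integrable f → Function.support f ⊆ hbox a L →
    ∫⁻ y, ‖f y‖ₑ ≤ ENNReal.ofReal lam * volume (hbox a L) →
      volume (hbox a L ∩ {x | ENNReal.ofReal (K * lam) < U f x}) ≤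
        ENNReal.ofReal ε * volume (hbox a L)

theorem IsCZ.zero (hU : IsCZ 𝕜 δ C U) (hδ : 0 < δ) (x : Rn n) : U (fun _ => 0) x = 0 := by
  have h0 : Adm δ (fun _ : Rn n => (0 : B)) := (integrable_zero _ _ _).adm hδ.le
  simpa using hU.smul 0 _ h0 x

theorem IsCZ.sum_le (hU : IsCZ 𝕜 δ C U) (hδ : 0 < δ) {b : ℕ → Rn n → B}
    (hb : ∀ i, Integrable (b i)) (N : ℕ) (x : Rn n) :
    U (fun y => ∑ i ∈ Finset.range N, b i y) x ≤ ∑ i ∈ Finset.range N, U (b i) x := by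
  induction N with
  | zero => simp [hU.zero hδ]
  | succ N ih =>
    simp only [Finset.sum_range_succ]
    exact (hU.add_le _ _ ((integrable_finsetSum _ fun i _ => hb i).adm hδ.le)
      ((hb N).adm hδ.le) x).trans (by gcongr)

/-- Finite sublinearity passes to the limit by lower semicontinuity. This replaces the exchange of a
linear operator with an infinite sum. -/
theorem IsCZ.tsum_le (hU : IsCZ 𝕜 δ C U) (hδ : 0 < δ) {b : ℕ → Rn n → B} {f : Rn n → B}
    (hb : ∀ i, Integrable (b i)) (hf : Integrable f)
    (h : Tendsto (fun N => ∫⁻ y, ‖∑ i ∈ Finset.range N, b i y - f y‖ₑ) atTop (𝓝 0)) (x : Rn n) :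
    U f x ≤ ∑' i, U (b i) x := by
  refine (hU.lsc f (fun N y => ∑ i ∈ Finset.range N, b i y) (hf.adm hδ.le)
    (fun N => (integrable_finsetSum _ fun i _ => hb i).adm hδ.le) ?_ x).trans ?_
  · exact tendsto_of_tendsto_of_tendsto_of_le_of_le tendsto_const_nhds h (fun _ => zero_le)
      fun N => lintegral_wgt_le hδ.le _
  · refine (liminf_le_liminf (Eventually.of_forall fun N =>
      (hU.sum_le hδ hb N x).trans (ENNReal.sum_le_tsum _))).trans ?_
    simp

/-- The tail estimate with φ = 1: half a power of |x - z| is frozen at 2ρ, and the exponent n + 1/2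
remains. -/
theorem exists_lintegral_tail_le (n : ℕ) : ∃ C : ℝ≥0, ∀ (z : Rn n) (ρ : ℝ), 0 < ρ →
    ∫⁻ x in {x | 2 * ρ ≤ ‖x - z‖}, ENNReal.ofReal (ρ * ‖x - z‖ ^ (-((n : ℝ) + 1))) ≤ C := by
  obtain ⟨C, hC, h⟩ := exists_tail_le n
  set M : ℝ := 2 ^ n * (unitVol n).toReal with hM
  refine ⟨(C * M / 2).toNNReal, fun z ρ hρ => ?_⟩
  have h1 := h (fun _ => 1) z (2 * ρ) M (by positivity) (by positivity) fun j => by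
    rw [setLIntegral_one, volume_closedBall _ (by positivity),
      ← ENNReal.ofReal_toReal (unitVol_ne_top n), ← ENNReal.ofReal_mul (by positivity)]
    refine ENNReal.ofReal_le_ofReal ?_
    have h3 : (2 ^ (j + 1) * (2 * ρ)) ^ n = 2 ^ n * (2 ^ j * (2 * ρ)) ^ n := by
      rw [← mul_pow]; ring
    rw [h3, hM]
    have h4 : 0 ≤ 2 ^ n * (unitVol n).toReal * (2 ^ j * (2 * ρ)) ^ n := by positivity
    nlinarith [(Nat.cast_nonneg j : (0 : ℝ) ≤ j), mul_nonneg h4 (Nat.cast_nonneg j : (0 : ℝ) ≤ j)]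
  have hms : MeasurableSet {x : Rn n | 2 * ρ ≤ ‖x - z‖} :=
    measurableSet_le measurable_const (by fun_prop)
  calc _ ≤ ∫⁻ x in {x | 2 * ρ ≤ ‖x - z‖}, ENNReal.ofReal (ρ * (2 * ρ) ^ (-(1 / 2) : ℝ)) *
        (1 * ENNReal.ofReal (‖z - x‖ ^ (-((n : ℝ) + 1 / 2)))) := by
        refine setLIntegral_mono' hms fun x hx => ?_
        have hx : 2 * ρ ≤ ‖x - z‖ := hx
        have h0 : 0 < ‖x - z‖ := by linarith
        rw [one_mul, ← ENNReal.ofReal_mul (by positivity), norm_sub_rev z x]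
        refine ENNReal.ofReal_le_ofReal ?_
        rw [show (-((n : ℝ) + 1)) = -(1 / 2) + -((n : ℝ) + 1 / 2) by ring, Real.rpow_add h0,
          ← mul_assoc]
        refine mul_le_mul_of_nonneg_right (mul_le_mul_of_nonneg_left ?_ hρ.le) (by positivity)
        exact Real.rpow_le_rpow_of_nonpos (by positivity) hx (by norm_num)
    _ = ENNReal.ofReal (ρ * (2 * ρ) ^ (-(1 / 2) : ℝ)) * ∫⁻ x in {x | 2 * ρ ≤ ‖z - x‖},
        1 * ENNReal.ofReal (‖z - x‖ ^ (-((n : ℝ) + 1 / 2))) := by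
        rw [lintegral_const_mul' _ _ ENNReal.ofReal_ne_top]
        simp only [norm_sub_rev z]
    _ ≤ ENNReal.ofReal (ρ * (2 * ρ) ^ (-(1 / 2) : ℝ)) *
        ENNReal.ofReal (C * M * (2 * ρ) ^ (-(1 / 2) : ℝ)) := by gcongr
    _ = ENNReal.ofReal (C * M / 2) := by
        rw [← ENNReal.ofReal_mul (by positivity)]
        congr 1
        have h5 : (2 * ρ) ^ (-(1 / 2) : ℝ) * (2 * ρ) ^ (-(1 / 2) : ℝ) = (2 * ρ)⁻¹ := by
          rw [← Real.rpow_add (by positivity), ← Real.rpow_neg_one]; norm_num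
        calc _ = ρ * (C * M) * ((2 * ρ) ^ (-(1 / 2) : ℝ) * (2 * ρ) ^ (-(1 / 2) : ℝ)) := by ring
          _ = _ := by rw [h5]; field_simp

/-- The integrated form of cancellation: away from the doubled ball, a mean-zero piece contributes
at most a multiple of its L¹ norm. -/
theorem IsCZ.exists_lintegral_le (hU : IsCZ 𝕜 δ C U) : ∃ C' : ℝ≥0, ∀ (b : Rn n → B) (z : Rn n)
    (ρ : ℝ), Integrable b → 0 < ρ → (∀ y, b y ≠ 0 → ‖y - z‖ ≤ ρ) → ∫ y, b y = 0 →
    ∫⁻ x in {x | 2 * ρ ≤ ‖x - z‖}, U b x ≤ C' * ∫⁻ y, ‖b y‖ₑ := by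
  obtain ⟨C₁, h₁⟩ := exists_lintegral_tail_le n
  refine ⟨C * C₁, fun b z ρ hb hρ hsupp hint => ?_⟩
  have hms : MeasurableSet {x : Rn n | 2 * ρ ≤ ‖x - z‖} :=
    measurableSet_le measurable_const (by fun_prop)
  calc _ ≤ ∫⁻ x in {x | 2 * ρ ≤ ‖x - z‖}, C * (∫⁻ y, ‖b y‖ₑ) *
        ENNReal.ofReal (ρ * ‖x - z‖ ^ (-((n : ℝ) + 1))) := by
        refine setLIntegral_mono' hms fun x hx => ?_
        refine (hU.cancel b hb x z ρ hρ hsupp hint hx).trans (le_of_eq ?_)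
        ring
    _ = C * (∫⁻ y, ‖b y‖ₑ) * ∫⁻ x in {x | 2 * ρ ≤ ‖x - z‖},
        ENNReal.ofReal (ρ * ‖x - z‖ ^ (-((n : ℝ) + 1))) :=
        lintegral_const_mul' _ _ (ENNReal.mul_ne_top ENNReal.coe_ne_top hb.2.ne)
    _ ≤ C * (∫⁻ y, ‖b y‖ₑ) * C₁ := by gcongr; exact h₁ z ρ hρ
    _ = _ := by push_cast; ring

/-- Decompose f at height A·lam. The exceptional set Ω takes at most the fraction D/A of the box;
outside it the bad parts are controlled by cancellation and Chebyshev. The good part is bounded by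
2^n A·lam, and `WeakOnBounded` applies to it. -/
theorem IsCZ.smallOnIntegrable [CompleteSpace B] (hn : 0 < n) (hδ : 0 < δ) (hU : IsCZ 𝕜 δ C U)
    (hW : WeakOnBounded U) : SmallOnIntegrable U := by
  obtain ⟨Cw, hW⟩ := hW
  obtain ⟨C', hC'⟩ := hU.exists_lintegral_le
  intro ε hε
  set D : ℝ := (2 * n) ^ n * (unitVol n).toReal with hD
  have hD0 : 0 ≤ D := by positivity
  -- A is fixed first, to make Ω occupy at most ε/3 of the box; A ≥ 1 keeps the mass hypothesis of
  -- the decomposition.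
  set A : ℝ := 1 + 3 * D / ε with hA
  have hA1 : 1 ≤ A := by have : 0 ≤ 3 * D / ε := by positivity
                         linarith
  have hDA : D / A ≤ ε / 3 := by
    rw [div_le_iff₀ (by positivity), hA]
    have : ε / 3 * (1 + 3 * D / ε) = ε / 3 + D := by field_simp
    rw [this]; linarith
  -- Then K is taken large enough that the good part and the bad part, each at level K·lam/2, cost
  -- at most ε/3.
  set K : ℝ := 1 + 3 * (Cw * (2 ^ (n + 1) * A)) / ε + 3 * (4 * C') / ε with hK
  have hK0 : 0 < K := by positivity
  have hK1 : Cw * (2 ^ (n + 1) * A) / K ≤ ε / 3 := by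
    rw [div_le_iff₀ hK0, hK]
    have : ε / 3 * (1 + 3 * (Cw * (2 ^ (n + 1) * A)) / ε + 3 * (4 * C') / ε) =
      ε / 3 + Cw * (2 ^ (n + 1) * A) + 4 * C' := by field_simp
    rw [this]; linarith [C'.coe_nonneg]
  have hK2 : 4 * C' / K ≤ ε / 3 := by
    rw [div_le_iff₀ hK0, hK]
    have : ε / 3 * (1 + 3 * (Cw * (2 ^ (n + 1) * A)) / ε + 3 * (4 * C') / ε) =
      ε / 3 + Cw * (2 ^ (n + 1) * A) + 4 * C' := by field_simp
    have h2 : 0 ≤ Cw * (2 ^ (n + 1) * A) := by positivity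
    rw [this]; linarith
  refine ⟨K, hK0, fun a L hL f lam hlam hf hsupp hmass => ?_⟩
  set V := volume (hbox a L) with hV
  have hAlam : 0 < A * lam := by positivity
  obtain ⟨b, s, z, ρ, Ω, hb, hb0, hρ, hbs, hΩ, hbsum, htend, hs, hbd, hfs, hΩm, hΩv⟩ :=
    exists_cz_decomposition hn a hL hf hsupp hAlam (hmass.trans (by
      gcongr; nlinarith))
  have hUs := hU.tsum_le hδ hb hs htend
  have hUf : ∀ x, U f x ≤ U (fun y => f y - s y) x + ∑' i, U (b i) x := fun x => by
    have := hU.add_le (fun y => f y - s y) s ((hf.sub hs).adm hδ.le) (hs.adm hδ.le) x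
    simp only [sub_add_cancel] at this
    exact this.trans (by gcongr; exact hUs x)
  have hUb : ∀ i, ∫⁻ x in Ωᶜ, U (b i) x ≤ C' * ∫⁻ y, ‖b i y‖ₑ := fun i => by
    rcases hΩ i with h | h
    · have h3 : U (b i) = fun _ => 0 := by rw [h]; exact funext fun x => hU.zero hδ x
      rw [h3]; simp
    · refine le_trans (lintegral_mono_set fun x hx => ?_)
        (hC' (b i) (z i) (ρ i) (hb i) (hρ i) (hbs i) (hb0 i))
      by_contra hno
      refine hx (h ?_)
      have hno : ¬ (2 * ρ i ≤ ‖x - z i‖) := hno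
      rw [mem_closedBall_iff_norm]; linarith
  have hmeas : ∀ i, Measurable (U (b i)) := fun i => hU.measurable _ ((hb i).adm hδ.le)
  have hsum : ∫⁻ x in Ωᶜ, ∑' i, U (b i) x ≤ ENNReal.ofReal (2 * C' * lam) * V := by
    rw [lintegral_tsum fun i => (hmeas i).aemeasurable]
    calc _ ≤ ∑' i, C' * ∫⁻ y, ‖b i y‖ₑ := ENNReal.tsum_le_tsum hUb
      _ ≤ C' * (2 * (ENNReal.ofReal lam * V)) := by
          rw [ENNReal.tsum_mul_left]; gcongr; exact hbsum.trans (by gcongr)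
      _ = _ := by
          rw [ENNReal.ofReal_mul (by positivity), ENNReal.ofReal_mul (by positivity),
            ENNReal.ofReal_coe_nnreal, ENNReal.ofReal_ofNat]; ring
  have hKl : 0 < K * lam / 2 := by positivity
  have hsub : hbox a L ∩ {x | ENNReal.ofReal (K * lam) < U f x} ⊆
      (hbox a L ∩ {x | ENNReal.ofReal (K * lam / 2) < U (fun y => f y - s y) x}) ∪ (Ω ∪
        {x | ENNReal.ofReal (K * lam / 2) ≤ Ωᶜ.indicator (fun x => ∑' i, U (b i) x) x}) := by
    rintro x ⟨hxQ, hx⟩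
    have hx : ENNReal.ofReal (K * lam) < U f x := hx
    by_cases h1 : ENNReal.ofReal (K * lam / 2) < U (fun y => f y - s y) x
    · exact Or.inl ⟨hxQ, h1⟩
    · by_cases h2 : x ∈ Ω
      · exact Or.inr (Or.inl h2)
      · refine Or.inr (Or.inr ?_)
        rw [mem_ofPred_eq, indicator_of_mem (by exact h2)]
        by_contra h3
        push Not at h1 h3
        refine absurd hx (not_lt.2 ((hUf x).trans ((add_le_add h1 h3.le).trans (le_of_eq ?_))))
        rw [← ENNReal.ofReal_add hKl.le hKl.le, add_halves]
  have e1 : volume (hbox a L ∩ {x | ENNReal.ofReal (K * lam / 2) < U (fun y => f y - s y) x}) ≤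
      ENNReal.ofReal (ε / 3) * V := by
    refine (hW a L hL (fun y => f y - s y) (2 ^ n * (A * lam)) (by positivity) (hf.sub hs).1
      (fun y hy => hfs y hy) hbd (K * lam / 2) hKl).trans ?_
    gcongr
    rw [← ENNReal.ofReal_coe_nnreal, ← ENNReal.ofReal_mul (by positivity)]
    refine ENNReal.ofReal_le_ofReal (le_trans (le_of_eq ?_) hK1)
    rw [pow_succ]; field_simp
  have e2 : volume Ω ≤ ENNReal.ofReal (ε / 3) * V := by
    refine hΩv.trans ?_
    calc _ ≤ ENNReal.ofReal ((2 * n) ^ n) * unitVol n * ENNReal.ofReal (1 / (A * lam)) *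
          (ENNReal.ofReal lam * V) := by gcongr
      _ = ENNReal.ofReal (D / A) * V := by
          rw [← ENNReal.ofReal_toReal (unitVol_ne_top n), ← ENNReal.ofReal_mul (by positivity),
            ← ENNReal.ofReal_mul (by positivity), ← mul_assoc, ← ENNReal.ofReal_mul (by positivity)]
          congr 2
          rw [hD]; field_simp
      _ ≤ _ := by gcongr
  have e3 : volume {x | ENNReal.ofReal (K * lam / 2) ≤
      Ωᶜ.indicator (fun x => ∑' i, U (b i) x) x} ≤ ENNReal.ofReal (ε / 3) * V := by
    have hmi : Measurable (Ωᶜ.indicator (fun x => ∑' i, U (b i) x)) :=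
      (Measurable.tsum hmeas).indicator hΩm.compl
    have h1 := mul_meas_ge_le_lintegral (μ := volume) hmi (ENNReal.ofReal (K * lam / 2))
    rw [lintegral_indicator hΩm.compl] at h1
    rw [mul_comm, ← ENNReal.le_div_iff_mul_le (Or.inl (by simpa using hKl))
      (Or.inl ENNReal.ofReal_ne_top)] at h1
    refine h1.trans ?_
    calc _ ≤ ENNReal.ofReal (2 * C' * lam) * V / ENNReal.ofReal (K * lam / 2) := by
          gcongr
      _ = ENNReal.ofReal (4 * C' / K) * V := by
          rw [ENNReal.div_eq_inv_mul, ← ENNReal.ofReal_inv_of_pos hKl, ← mul_assoc,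
            ← ENNReal.ofReal_mul (by positivity)]
          congr 2
          field_simp; ring
      _ ≤ _ := by gcongr
  calc _ ≤ ENNReal.ofReal (ε / 3) * V + (ENNReal.ofReal (ε / 3) * V +
        ENNReal.ofReal (ε / 3) * V) :=
        (measure_mono hsub).trans ((measure_union_le _ _).trans
          (add_le_add e1 ((measure_union_le _ _).trans (add_le_add e2 e3))))
    _ = ENNReal.ofReal ε * V := by
        rw [← add_mul, ← add_mul, ← ENNReal.ofReal_add (by positivity) (by positivity),
          ← ENNReal.ofReal_add (by positivity) (by positivity)]
        congr 2; ring

end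

end FracLP

namespace FracLP

noncomputable section

variable {n : ℕ} {B : Type*} [NormedAddCommGroup B]

/-! ### Dilated boxes -/

/-- The lower corner of the box concentric with `hbox b l` and of side length `6 * n * l`. -/
def starCorner (b : Rn n) (l : ℝ) : Rn n := WithLp.toLp 2 fun i => boxCenter b l i - 3 * (n * l)

/-- The box concentric with `hbox b l`, dilated by the factor `6 * n`. -/
def starBox (b : Rn n) (l : ℝ) : Set (Rn n) := hbox (starCorner b l) (6 * (n * l))

theorem measurableSet_starBox (b : Rn n) (l : ℝ) : MeasurableSet (starBox b l) :=
  measurableSet_hbox _ _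

theorem closedBall_subset_starBox (hn : 0 < n) (b : Rn n) {l : ℝ} (hl : 0 < l) :
    Metric.closedBall (boxCenter b l) (2 * (n * l)) ⊆ starBox b l := by
  intro y hy i
  have h1 := abs_apply_le_norm (y - boxCenter b l) i
  rw [mem_closedBall_iff_norm] at hy
  have h2 := abs_le.1 (h1.trans hy)
  have h3 : (y - boxCenter b l) i = y i - boxCenter b l i := rfl
  have h4 : starCorner b l i = boxCenter b l i - 3 * (n * l) := rfl
  have h5 : (0 : ℝ) < n * l := by positivity
  rw [h3] at h2
  rw [h4]
  constructor <;> linarith [h2.1, h2.2]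

theorem hbox_subset_starBox (hn : 0 < n) (b : Rn n) {l : ℝ} (hl : 0 < l) :
    hbox b l ⊆ starBox b l :=
  (hbox_subset_closedBall b hl.le).trans ((Metric.closedBall_subset_closedBall (by
    have : (0 : ℝ) < n * l := by positivity
    linarith)).trans (closedBall_subset_starBox hn b hl))

theorem boxCenter_starCorner (b : Rn n) (l : ℝ) :
    boxCenter (starCorner b l) (6 * (n * l)) = boxCenter b l := by
  ext i
  simp only [boxCenter, starCorner]
  ring

theorem starBox_subset_closedBall (b : Rn n) {l : ℝ} (hl : 0 < l) :
    starBox b l ⊆ Metric.closedBall (boxCenter b l) (6 * n ^ 2 * l) := by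
  have := hbox_subset_closedBall (starCorner b l) (L := 6 * (n * l)) (by positivity)
  rw [boxCenter_starCorner] at this
  exact this.trans (Metric.closedBall_subset_closedBall (le_of_eq (by ring)))

theorem volume_starBox (b : Rn n) {l : ℝ} (hl : 0 < l) :
    volume (starBox b l) = ENNReal.ofReal ((6 * n) ^ n) * volume (hbox b l) := by
  rw [starBox, volume_hbox _ (by positivity), volume_hbox _ hl.le,
    ← ENNReal.ofReal_mul (by positivity), ← mul_pow, mul_assoc]

theorem le_norm_sub_of_notMem_starBox (hn : 0 < n) (b : Rn n) {l : ℝ} (hl : 0 < l) {y : Rn n}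
    (hy : y ∉ starBox b l) : 2 * (n * l) ≤ ‖boxCenter b l - y‖ := by
  by_contra h
  refine hy (closedBall_subset_starBox hn b hl ?_)
  rw [mem_closedBall_iff_norm, norm_sub_rev]
  exact (not_le.1 h).le

/-- The box of side length `2 * L` centred at the origin. -/
def centralBox (n : ℕ) (L : ℝ) : Set (Rn n) := hbox (WithLp.toLp 2 fun _ => -L) (2 * L)

theorem mem_centralBox_of_norm_lt {L : ℝ} {x : Rn n} (hx : ‖x‖ < L) : x ∈ centralBox n L := by
  intro i
  have h := abs_lt.1 ((abs_apply_le_norm x i).trans_lt hx)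
  change -L ≤ x i ∧ x i < -L + 2 * L
  constructor <;> linarith [h.1, h.2]

theorem volume_centralBox {L : ℝ} (hL : 0 ≤ L) :
    volume (centralBox n L) = ENNReal.ofReal ((2 * L) ^ n) := volume_hbox _ (by positivity)

theorem measure_le_of_forall_centralBox {S : Set (Rn n)} {X : ℝ≥0∞} {L₀ : ℝ}
    (h : ∀ L, L₀ ≤ L → volume (centralBox n L ∩ S) ≤ X) : volume S ≤ X := by
  have hmono : Monotone fun k : ℕ => Metric.ball (0 : Rn n) k ∩ S := fun i j hij =>
    inter_subset_inter_left _ (Metric.ball_subset_ball (by exact_mod_cast hij))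
  have hun : S = ⋃ k : ℕ, Metric.ball (0 : Rn n) k ∩ S := by
    rw [← iUnion_inter, Metric.iUnion_ball_nat, univ_inter]
  rw [hun, hmono.measure_iUnion]
  refine iSup_le fun k => (measure_mono (inter_subset_inter_left _ fun x hx => ?_)).trans
    (h (max L₀ k) (le_max_left _ _))
  rw [mem_ball_zero_iff] at hx
  exact mem_centralBox_of_norm_lt (hx.trans_le (le_max_right _ _))

/-! ### Oscillation estimates -/

variable {𝕜 : Type*} [RCLike 𝕜] [NormedSpace 𝕜 B] [NormedSpace ℝ B] {δ : ℝ} {C : ℝ≥0}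
  {U : (Rn n → B) → Rn n → ℝ≥0∞}

theorem IsCZ.neg (hU : IsCZ 𝕜 δ C U) {f : Rn n → B} (hf : Adm δ f) (x : Rn n) :
    U (fun y => -f y) x = U f x := by
  have := hU.smul (-1) f hf x
  simpa using this

theorem IsCZ.le_add_sub (hU : IsCZ 𝕜 δ C U) (hδ : 0 < δ) {f g : Rn n → B} (hf : Integrable f)
    (hg : Integrable g) (x : Rn n) : U f x ≤ U g x + U (fun y => f y - g y) x := by
  have := hU.add_le g (fun y => f y - g y) (hg.adm hδ.le) ((hf.sub hg).adm hδ.le) x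
  simpa using this

theorem IsCZ.sub_comm (hU : IsCZ 𝕜 δ C U) (hδ : 0 < δ) {f g : Rn n → B} (hf : Integrable f)
    (hg : Integrable g) (x : Rn n) : U (fun y => f y - g y) x = U (fun y => g y - f y) x := by
  have := hU.neg (f := fun y => g y - f y) ((hg.sub hf).adm hδ.le) x
  simpa using this

/-- U is not linear, so values of U g at two points are compared by translating g. By translation
invariance their difference is at most U of g minus its translate, which is why regularity in `IsCZ`
concerns such differences. -/
theorem IsCZ.le_translate_add (hU : IsCZ 𝕜 δ C U) (hδ : 0 < δ) {g : Rn n → B}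
    (hg : Integrable g) (x h : Rn n) :
    U g x ≤ U g (x + h) + U (fun y => g y - g (y + h)) x := by
  have := hU.le_add_sub hδ hg (hg.comp_add_right h) x
  rwa [hU.translate g hg h x] at this

theorem IsCZ.translate_le_add (hU : IsCZ 𝕜 δ C U) (hδ : 0 < δ) {g : Rn n → B}
    (hg : Integrable g) (x h : Rn n) :
    U g (x + h) ≤ U g x + U (fun y => g y - g (y + h)) x := by
  have := hU.le_add_sub hδ (hg.comp_add_right h) hg x
  rwa [hU.translate g hg h x, hU.sub_comm hδ (hg.comp_add_right h) hg] at this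

theorem abs_toReal_sub_toReal_le {a b : ℝ≥0∞} {r : ℝ} (hb : b ≠ ∞)
    (h1 : a ≤ b + ENNReal.ofReal r) (h2 : b ≤ a + ENNReal.ofReal r) (hr : 0 ≤ r) :
    |a.toReal - b.toReal| ≤ r := by
  have ha : a ≠ ∞ := ne_top_of_le_ne_top (ENNReal.add_ne_top.2 ⟨hb, ENNReal.ofReal_ne_top⟩) h1
  have e1 := ENNReal.toReal_mono (ENNReal.add_ne_top.2 ⟨hb, ENNReal.ofReal_ne_top⟩) h1
  have e2 := ENNReal.toReal_mono (ENNReal.add_ne_top.2 ⟨ha, ENNReal.ofReal_ne_top⟩) h2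
  rw [ENNReal.toReal_add hb ENNReal.ofReal_ne_top, ENNReal.toReal_ofReal hr] at e1
  rw [ENNReal.toReal_add ha ENNReal.ofReal_ne_top, ENNReal.toReal_ofReal hr] at e2
  rw [abs_le]; constructor <;> linarith

/-- If the far part `g` of a function is almost constant under `U` on a box, and the near part `f₀`
has small mean, then `U (f₀ + g)` oscillates little on this box. -/
theorem IsCZ.exists_oscillation_le (hn : 0 < n) (hδ : 0 < δ) (hU : IsCZ 𝕜 δ C U)
    (hI : SmallOnIntegrable U) {ε : ℝ} (hε : 0 < ε) {D : ℝ} (hD : 0 ≤ D) :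
    ∃ K : ℝ, 0 < K ∧ ∀ (b : Rn n) (l : ℝ), 0 < l → ∀ (f₀ g : Rn n → B) (lam : ℝ), 0 < lam →
      Integrable f₀ → Integrable g → Function.support f₀ ⊆ starBox b l →
      ∫⁻ y, ‖f₀ y‖ₑ ≤ ENNReal.ofReal lam * volume (starBox b l) →
      U g (boxCenter b l) ≠ ∞ →
      (∀ h, ‖h‖ ≤ n * l → U (fun y => g y - g (y + h)) (boxCenter b l) ≤
        ENNReal.ofReal (D * lam)) →
      volume (hbox b l ∩ {y | K * lam < |(U (fun y => f₀ y + g y) y).toReal -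
        (U g (boxCenter b l)).toReal|}) ≤ ENNReal.ofReal ε * volume (hbox b l) := by
  -- The near part lives in the dilated box, whose volume is larger by the factor (6n)^n.
  obtain ⟨K, hK, hI⟩ := hI (ε / (6 * n) ^ n) (by positivity)
  refine ⟨K + D, by positivity, fun b l hl f₀ g lam hlam hf₀ hg hsupp hmass hfin hosc => ?_⟩
  have h1 := hI (starCorner b l) (6 * (n * l)) (by positivity) f₀ lam hlam hf₀ hsupp hmass
  rw [← starBox, volume_starBox b hl, ← mul_assoc, ← ENNReal.ofReal_mul (by positivity),
    div_mul_cancel₀ _ (by positivity)] at h1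
  refine le_trans (measure_mono ?_) h1
  intro y hy
  refine ⟨hbox_subset_starBox hn b hl hy.1, ?_⟩
  by_contra hno
  have hno : U f₀ y ≤ ENNReal.ofReal (K * lam) := not_lt.1 hno
  set x := boxCenter b l
  set h := y - x with hh
  have hhn : ‖h‖ ≤ n * l := mem_closedBall_iff_norm.1 (hbox_subset_closedBall b hl.le hy.1)
  have hxh : x + h = y := by rw [hh]; abel
  have e1 : U g y ≤ U g x + ENNReal.ofReal (D * lam) := by
    rw [← hxh]
    exact (hU.translate_le_add hδ hg x h).trans (by gcongr; exact hosc h hhn)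
  have e2 : U g x ≤ U g y + ENNReal.ofReal (D * lam) := by
    rw [← hxh]
    exact (hU.le_translate_add hδ hg x h).trans (by gcongr; exact hosc h hhn)
  have e3 : U (fun y => f₀ y + g y) y ≤ U g y + ENNReal.ofReal (K * lam) := by
    refine (hU.add_le f₀ g (hf₀.adm hδ.le) (hg.adm hδ.le) y).trans ?_
    rw [add_comm]; gcongr
  have e4 : U g y ≤ U (fun y => f₀ y + g y) y + ENNReal.ofReal (K * lam) := by
    have := hU.le_add_sub hδ hg (hf₀.add hg) y
    refine this.trans (add_le_add le_rfl ?_)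
    have e := hU.neg (hf₀.adm hδ.le) y
    refine le_trans (le_of_eq ?_) hno
    rw [← e]
    congr 1
    ext z
    simp
  have hs : ENNReal.ofReal ((K + D) * lam) =
      ENNReal.ofReal (K * lam) + ENNReal.ofReal (D * lam) := by
    rw [← ENNReal.ofReal_add (by positivity) (by positivity), add_mul]
  have := abs_toReal_sub_toReal_le (r := (K + D) * lam) hfin
    (a := U (fun y => f₀ y + g y) y)
    (by rw [hs, add_comm (ENNReal.ofReal (K * lam)), ← add_assoc]; exact e3.trans (by gcongr))
    (by rw [hs, ← add_assoc]; exact e2.trans (by gcongr)) (by positivity)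
  exact absurd hy.2 (not_lt.2 this)

/-- One point of the box outside the bad set controls the mass of f on all balls about the centre
with radius at least comparable to the side. This bounds the mean of the near part and, shell by
shell, the regularity integral of the far part. -/
theorem IsCZ.exists_oscillation_le_of_notMem_bad (hn : 0 < n) (hδ : 0 < δ) (hU : IsCZ 𝕜 δ C U)
    (hI : SmallOnIntegrable U) {ε : ℝ} (hε : 0 < ε) :
    ∃ K : ℝ, 0 < K ∧ ∀ (f : Rn n → B) (lam : ℝ), 0 < lam → Integrable f →
      ∀ (b : Rn n) (l : ℝ), 0 < l → (hbox b l ∩ (bad (fun y => ‖f y‖ₑ) lam)ᶜ).Nonempty →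
      ∃ c : ℝ, volume (hbox b l ∩ {y | K * lam < |(U f y).toReal - c|}) ≤
        ENNReal.ofReal ε * volume (hbox b l) := by
  obtain ⟨Ct, hCt, htail⟩ := exists_tail_le n
  -- The dilated box lies in the ball of radius 6n²l about the centre, hence within 7n²l of the good
  -- point.
  set A : ℝ := (7 * n ^ 2) ^ n with hA
  have hA0 : 0 < A := by positivity
  -- The factor 3^n comes from recentring the dyadic balls at the good point. The division by A
  -- compensates for using the height A·lam.
  set D : ℝ := C * (Ct * 3 ^ n) / A with hD
  obtain ⟨K, hK, hosc⟩ := hU.exists_oscillation_le hn hδ hI hε (D := D) (by positivity)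
  refine ⟨K * A, by positivity, fun f lam hlam hf b l hl ⟨z, hzb, hz⟩ => ?_⟩
  set x := boxCenter b l with hx
  have hzx : ‖z - x‖ ≤ n * l := mem_closedBall_iff_norm.1 (hbox_subset_closedBall b hl.le hzb)
  have hnl : (0 : ℝ) < n * l := by positivity
  have hn1 : (1 : ℝ) ≤ n := by exact_mod_cast hn
  have hball : ∀ R, 0 < R → ∫⁻ y in Metric.closedBall x R, ‖f y‖ₑ ≤
      ENNReal.ofReal (lam * (R + n * l) ^ n) := fun R hR =>
    (lintegral_mono_set (Metric.closedBall_subset_closedBall' (by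
      rw [dist_comm, dist_eq_norm]; linarith))).trans
      (lintegral_closedBall_le_of_notMem_bad hz (by positivity))
  have hms := measurableSet_starBox b l
  have hg : Integrable ((starBox b l)ᶜ.indicator f) := hf.indicator hms.compl
  have hgs : ∀ y, (starBox b l)ᶜ.indicator f y ≠ 0 → 2 * (n * l) ≤ ‖x - y‖ := fun y hy =>
    le_norm_sub_of_notMem_starBox hn b hl (mem_of_indicator_ne_zero hy)
  have hfun : (fun y => (starBox b l).indicator f y + (starBox b l)ᶜ.indicator f y) = f :=
    funext fun y => congr_fun (indicator_self_add_compl (starBox b l) f) y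
  refine ⟨(U ((starBox b l)ᶜ.indicator f) x).toReal, ?_⟩
  have := hosc b l hl ((starBox b l).indicator f) ((starBox b l)ᶜ.indicator f) (A * lam)
    (by positivity) (hf.indicator hms) hg support_indicator_subset ?_ ?_ ?_
  · rwa [hfun, ← mul_assoc] at this
  · simp_rw [enorm_indicator_eq_indicator_enorm]
    rw [lintegral_indicator hms]
    refine (lintegral_mono_set (starBox_subset_closedBall b hl)).trans
      ((hball _ (by positivity)).trans ?_)
    rw [volume_starBox b hl, volume_hbox _ hl.le, ← ENNReal.ofReal_mul (by positivity),
      ← ENNReal.ofReal_mul (by positivity)]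
    refine ENNReal.ofReal_le_ofReal ?_
    have h1 : (6 * (n : ℝ) ^ 2 * l + n * l) ^ n ≤ (7 * n ^ 2) ^ n * l ^ n := by
      rw [← mul_pow]
      refine pow_le_pow_left₀ (by positivity) ?_ n
      nlinarith [mul_le_mul_of_nonneg_right hn1 hnl.le]
    have h2 : (1 : ℝ) ≤ (6 * n) ^ n := one_le_pow₀ (by linarith)
    have h3 : 0 ≤ lam * (A * l ^ n) := by positivity
    calc lam * (6 * (n : ℝ) ^ 2 * l + n * l) ^ n ≤ lam * (A * l ^ n) * 1 := by
          rw [mul_one]; gcongr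
      _ ≤ lam * (A * l ^ n) * (6 * n) ^ n := by gcongr
      _ = _ := by ring
  · refine ne_top_of_le_ne_top ?_ (hU.size _ hg x (2 * (n * l)) (by positivity) hgs)
    exact ENNReal.mul_ne_top (ENNReal.mul_ne_top ENNReal.coe_ne_top ENNReal.ofReal_ne_top)
      hg.2.ne
  · intro h hh
    refine (hU.reg _ hg x h (n * l) hnl hh hgs).trans ?_
    have hset : MeasurableSet {y | 2 * (n * l) ≤ ‖x - y‖} :=
      measurableSet_le measurable_const (by fun_prop)
    have h1 : ∫⁻ y, ‖(starBox b l)ᶜ.indicator f y‖ₑ *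
        ENNReal.ofReal (‖x - y‖ ^ (-((n : ℝ) + 1 / 2))) ≤
        ENNReal.ofReal (Ct * (3 ^ n * lam) * (2 * (n * l)) ^ (-(1 / 2) : ℝ)) := by
      refine le_trans ?_ (htail (fun y => ‖f y‖ₑ) x (2 * (n * l)) (3 ^ n * lam) (by positivity)
        (by positivity) fun j => (hball _ (by positivity)).trans (ENNReal.ofReal_le_ofReal ?_))
      · rw [← lintegral_indicator hset]
        refine lintegral_mono fun y => ?_
        by_cases hy : y ∈ starBox b l
        · rw [indicator_of_notMem (by simpa using hy)]; simp
        · rw [indicator_of_mem (by exact hy),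
            indicator_of_mem (by exact le_norm_sub_of_notMem_starBox hn b hl hy)]
      · have h2 : (2 : ℝ) ^ (j + 1) * (2 * (n * l)) + n * l ≤ 3 * (2 ^ j * (2 * (n * l))) := by
          have : (1 : ℝ) ≤ 2 ^ j := one_le_pow₀ (by norm_num)
          rw [pow_succ]; nlinarith
        calc _ ≤ lam * (3 * (2 ^ j * (2 * (n * l)))) ^ n := by gcongr
          _ = 3 ^ n * lam * 1 * (2 ^ j * (2 * (n * l))) ^ n := by rw [mul_pow]; ring
          _ ≤ _ := by gcongr; linarith [(Nat.cast_nonneg j : (0 : ℝ) ≤ j)]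
    calc _ ≤ C * ENNReal.ofReal ((n * l) ^ (1 / 2 : ℝ)) *
          ENNReal.ofReal (Ct * (3 ^ n * lam) * (2 * (n * l)) ^ (-(1 / 2) : ℝ)) := by gcongr
      _ ≤ ENNReal.ofReal (C * (Ct * 3 ^ n) * lam) := by
          rw [← ENNReal.ofReal_coe_nnreal, ← ENNReal.ofReal_mul (by positivity),
            ← ENNReal.ofReal_mul (by positivity)]
          refine ENNReal.ofReal_le_ofReal ?_
          have h3 : (2 * (n * l)) ^ (-(1 / 2) : ℝ) ≤ (n * l) ^ (-(1 / 2) : ℝ) :=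
            Real.rpow_le_rpow_of_nonpos hnl (by linarith) (by norm_num)
          have h4 : (n * l) ^ (1 / 2 : ℝ) * (n * l) ^ (-(1 / 2) : ℝ) = 1 := by
            rw [← Real.rpow_add hnl]; norm_num
          calc _ ≤ C * (n * l) ^ (1 / 2 : ℝ) * (Ct * (3 ^ n * lam) * (n * l) ^ (-(1 / 2) : ℝ)) := by
                gcongr
            _ = C * (Ct * 3 ^ n) * lam * ((n * l) ^ (1 / 2 : ℝ) * (n * l) ^ (-(1 / 2) : ℝ)) := by
                ring
            _ = _ := by rw [h4, mul_one]
      _ = _ := by congr 1; rw [hD]; field_simp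

end

end FracLP

namespace FracLP

noncomputable section

variable {n : ℕ} {B : Type*} [NormedAddCommGroup B]
  {U : (Rn n → B) → Rn n → ℝ≥0∞}

/-! ### Weak type `(1, 1)` and strong type `(p, p)` -/

/-- In every large central box the set where U f = ∞ has measure at most ε times the volume for
every ε > 0. -/
theorem SmallOnIntegrable.ae_ne_top (hI : SmallOnIntegrable U) {f : Rn n → B} (hf : Integrable f)
    {R : ℝ} (hR : ∀ y, f y ≠ 0 → ‖y‖ ≤ R) : ∀ᵐ x, U f x ≠ ∞ := by
  refine le_antisymm (measure_le_of_forall_centralBox (L₀ := max (R + 1) 1) fun L hL => ?_) zero_le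
  have hL1 : 0 < L := by linarith [le_max_right (R + 1) 1]
  set V := volume (centralBox n L) with hV
  have hVr : V = ENNReal.ofReal ((2 * L) ^ n) := volume_centralBox hL1.le
  have hsupp : Function.support f ⊆ centralBox n L := fun y hy =>
    mem_centralBox_of_norm_lt (by linarith [hR y hy, le_max_left (R + 1) 1])
  set lam : ℝ := (∫⁻ y, ‖f y‖ₑ).toReal / (2 * L) ^ n + 1 with hlam
  have hmass : ∫⁻ y, ‖f y‖ₑ ≤ ENNReal.ofReal lam * V := by
    rw [hVr, ← ENNReal.ofReal_mul (by positivity)]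
    refine (ENNReal.ofReal_toReal hf.2.ne).symm.le.trans (ENNReal.ofReal_le_ofReal ?_)
    rw [hlam, add_mul, div_mul_cancel₀ _ (by positivity)]
    have : 0 < (2 * L) ^ n := by positivity
    linarith
  have hε : ∀ k : ℕ, volume (centralBox n L ∩ {x | U f x ≠ ∞}ᶜ) ≤
      ENNReal.ofReal (1 / ((k : ℝ) + 1)) * V := fun k => by
    obtain ⟨K, hK, h⟩ := hI (1 / ((k : ℝ) + 1)) (by positivity)
    refine le_trans (measure_mono ?_) (h _ (2 * L) (by positivity) f lam (by positivity) hf hsupp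
      hmass)
    intro x hx
    refine ⟨hx.1, ?_⟩
    have hx2 : U f x = ∞ := not_not.1 hx.2
    rw [mem_ofPred_eq, hx2]
    exact ENNReal.ofReal_lt_top
  have h1 := ENNReal.tendsto_ofReal tendsto_one_div_add_atTop_nhds_zero_nat
  have h2 := ENNReal.Tendsto.mul_const (b := V) h1 (Or.inr (by rw [hVr]; simp))
  rw [ENNReal.ofReal_zero, zero_mul] at h2
  exact ge_of_tendsto' h2 hε

variable {𝕜 : Type*} [RCLike 𝕜] [NormedSpace 𝕜 B] [NormedSpace ℝ B] {δ : ℝ} {C : ℝ≥0}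

/-- An a priori bound whose constants depend on f: away from the support the size estimate gives
decay of order |x|^{-n}. It serves only to make the quantities finite in the absorption arguments.
-/
theorem IsCZ.exists_volume_lt_le (hn : 0 < n) (hU : IsCZ 𝕜 δ C U) {f : Rn n → B}
    (hf : Integrable f) {R : ℝ} (hR : ∀ y, f y ≠ 0 → ‖y‖ ≤ R) :
    ∃ K₁ K₂ : ℝ≥0∞, K₁ ≠ ∞ ∧ K₂ ≠ ∞ ∧ ∀ t : ℝ, 0 < t →
      volume {x | ENNReal.ofReal t < U f x} ≤ K₁ + K₂ * ENNReal.ofReal (1 / t) := by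
  set I : ℝ := (∫⁻ y, ‖f y‖ₑ).toReal with hI
  have hI0 : 0 ≤ I := ENNReal.toReal_nonneg
  set D : ℝ := C * 2 ^ n * I with hD
  have hD0 : 0 ≤ D := by positivity
  set R' : ℝ := max R 1 with hR'
  have hR'0 : 0 < R' := by linarith [le_max_right R 1]
  refine ⟨volume (Metric.closedBall (0 : Rn n) (2 * R')), ENNReal.ofReal D * unitVol n,
    measure_closedBall_lt_top.ne, ENNReal.mul_ne_top ENNReal.ofReal_ne_top (unitVol_ne_top n),
    fun t ht => ?_⟩
  have hsub : {x | ENNReal.ofReal t < U f x} ⊆ Metric.closedBall (0 : Rn n) (2 * R') ∪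
      Metric.closedBall (0 : Rn n) ((D / t) ^ (1 / (n : ℝ))) := by
    intro x hx
    by_cases hx2 : ‖x‖ ≤ 2 * R'
    · exact Or.inl (mem_closedBall_zero_iff.2 hx2)
    refine Or.inr (mem_closedBall_zero_iff.2 ?_)
    push Not at hx2
    have hx0 : 0 < ‖x‖ := by linarith
    have h1 := hU.size f hf x (‖x‖ / 2) (by positivity) fun y hy => by
      have h1 := norm_sub_norm_le x y
      have h2 := (hR y hy).trans (le_max_left R 1)
      linarith
    have h2 := lt_of_lt_of_le hx h1
    rw [← ENNReal.ofReal_toReal hf.2.ne, ← ENNReal.ofReal_coe_nnreal,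
      ← ENNReal.ofReal_mul (by positivity), ← ENNReal.ofReal_mul (by positivity)] at h2
    have h3 := (ENNReal.ofReal_lt_ofReal_iff_of_nonneg ht.le).1 h2
    rw [Real.rpow_neg (by positivity), Real.rpow_natCast, div_pow] at h3
    have h4 : ‖x‖ ^ n ≤ D / t := by
      rw [le_div_iff₀ ht]
      have h5 : C * (‖x‖ ^ n / 2 ^ n)⁻¹ * I = D / ‖x‖ ^ n := by rw [hD]; field_simp
      rw [h5, lt_div_iff₀ (by positivity)] at h3
      linarith
    calc ‖x‖ = (‖x‖ ^ n) ^ (1 / (n : ℝ)) := by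
          rw [one_div, Real.pow_rpow_inv_natCast hx0.le hn.ne']
      _ ≤ _ := Real.rpow_le_rpow (by positivity) h4 (by positivity)
  refine (measure_mono hsub).trans ((measure_union_le _ _).trans ?_)
  gcongr
  rw [volume_closedBall _ (by positivity), one_div (n : ℝ),
    Real.rpow_inv_natCast_pow (by positivity) hn.ne', div_eq_mul_one_div,
    ENNReal.ofReal_mul hD0]
  exact le_of_eq (by ring)

/-- The good-`λ` inequality between `U f` and the maximal function of `f`. -/
theorem IsCZ.exists_good_lambda (hn : 0 < n) (hδ : 0 < δ) (hU : IsCZ 𝕜 δ C U)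
    (hI : SmallOnIntegrable U) {η : ℝ} (hη : 0 < η) :
    ∃ γ : ℝ, 0 < γ ∧ ∀ f : Rn n → B, Integrable f → ∀ R : ℝ, (∀ y, f y ≠ 0 → ‖y‖ ≤ R) →
      ∀ t : ℝ, 0 < t → volume {x | ENNReal.ofReal (2 * t) < U f x} ≤
        ENNReal.ofReal η * volume {x | ENNReal.ofReal t < U f x} +
          volume (bad (fun y => ‖f y‖ₑ) (γ * t)) := by
  -- The first entry cancels the factor 2^{n+1} of `good_lambda`; the second ensures ε < 1/2.
  set ε : ℝ := min (η / 2 ^ (n + 1)) (1 / 4) with hεd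
  have hε : 0 < ε := by positivity
  have hε2 : ENNReal.ofReal ε < 1 / 2 := by
    rw [show (1 / 2 : ℝ≥0∞) = ENNReal.ofReal (1 / 2) by
      rw [ENNReal.ofReal_div_of_pos (by norm_num)]; simp]
    exact (ENNReal.ofReal_lt_ofReal_iff (by norm_num)).2
      (lt_of_le_of_lt (min_le_right _ _) (by norm_num))
  have hε3 : 2 ^ (n + 1) * ENNReal.ofReal ε ≤ ENNReal.ofReal η := by
    rw [show (2 : ℝ≥0∞) ^ (n + 1) = ENNReal.ofReal (2 ^ (n + 1)) by
      rw [ENNReal.ofReal_pow (by norm_num)]; simp, ← ENNReal.ofReal_mul (by positivity)]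
    refine ENNReal.ofReal_le_ofReal ?_
    calc 2 ^ (n + 1) * ε ≤ 2 ^ (n + 1) * (η / 2 ^ (n + 1)) := by gcongr; exact min_le_left _ _
      _ = η := by field_simp
  obtain ⟨K, hK, hosc⟩ := hU.exists_oscillation_le_of_notMem_bad hn hδ hI hε
  -- With this γ the oscillation threshold is t/2, so t + 2(t/2) = 2t.
  refine ⟨1 / (2 * K), by positivity, fun f hf R hR t ht => ?_⟩
  set G : Set (Rn n) := (bad (fun y => ‖f y‖ₑ) (1 / (2 * K) * t))ᶜ with hG
  have hmeas : Measurable fun x => (U f x).toReal := (hU.measurable f (hf.adm hδ.le)).ennreal_toReal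
  have hfin := hI.ae_ne_top hf hR
  have hae : ∀ s : ℝ, 0 < s → ({x | ENNReal.ofReal s < U f x} : Set (Rn n)) =ᵐ[volume]
      {x | s < (U f x).toReal} := fun s hs => by
    filter_upwards [hfin] with x hx
    exact propext ((ENNReal.ofReal_lt_iff_lt_toReal hs.le hx))
  obtain ⟨K₁, K₂, hK₁, hK₂, hap⟩ := hU.exists_volume_lt_le hn hf hR
  set Φ := volume {x | ENNReal.ofReal t < U f x} with hΦ
  have hΦtop : Φ ≠ ∞ := ne_top_of_le_ne_top
    (ENNReal.add_ne_top.2 ⟨hK₁, ENNReal.mul_ne_top hK₂ ENNReal.ofReal_ne_top⟩) (hap t ht)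
  have hkey : volume ({x | 2 * t < (U f x).toReal} ∩ G) ≤ ENNReal.ofReal η * Φ := by
    refine measure_le_of_forall_centralBox (L₀ := max 1 Φ.toReal) fun L hL => ?_
    have hL1 : 1 ≤ L := (le_max_left _ _).trans hL
    -- In a large enough box the level set fills at most half, as the dyadic argument requires.
    -- Letting the box grow removes the localization.
    have hΦL : Φ ≤ volume (centralBox n L) / 2 := by
      rw [ENNReal.le_div_iff_mul_le (by simp) (by simp), volume_centralBox (by linarith),
        ← ENNReal.ofReal_toReal hΦtop, show (2 : ℝ≥0∞) = ENNReal.ofReal 2 by simp,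
        ← ENNReal.ofReal_mul ENNReal.toReal_nonneg]
      refine ENNReal.ofReal_le_ofReal ?_
      calc Φ.toReal * 2 ≤ 2 * L := by linarith [(le_max_right 1 Φ.toReal).trans hL]
        _ = (2 * L) ^ 1 := (pow_one _).symm
        _ ≤ (2 * L) ^ n := pow_le_pow_right₀ (by linarith) hn
    have h1 : volume (centralBox n L ∩ {y | t < (U f y).toReal}) ≤ Φ :=
      (measure_mono inter_subset_right).trans (measure_congr (hae t ht)).symm.le
    have h2 := good_lambda hmeas (G := G) (κ := t / 2) (lam := t) hε2 (fun b l hl hne => by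
      have := hosc f (1 / (2 * K) * t) (by positivity) hf b l hl hne
      rwa [show K * (1 / (2 * K) * t) = t / 2 by field_simp] at this) _
      (L := 2 * L) (by positivity) (h1.trans hΦL)
    rw [show t + 2 * (t / 2) = 2 * t by ring, inter_assoc] at h2
    exact h2.trans (mul_le_mul' hε3 h1)
  calc volume {x | ENNReal.ofReal (2 * t) < U f x}
      = volume {x | 2 * t < (U f x).toReal} := measure_congr (hae (2 * t) (by positivity))
    _ ≤ volume ({x | 2 * t < (U f x).toReal} ∩ G ∪ Gᶜ) := measure_mono fun x hx => by
        by_cases h : x ∈ G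
        · exact Or.inl ⟨hx, h⟩
        · exact Or.inr h
    _ ≤ _ := (measure_union_le _ _).trans (add_le_add hkey (by rw [hG, compl_compl]))

/-- Absorb in the good-λ inequality with η = 1/4; the remaining term is the weak type (1,1) bound of
the maximal function. -/
theorem IsCZ.exists_weak_bound_of_bounded_support (hn : 0 < n) (hδ : 0 < δ) (hU : IsCZ 𝕜 δ C U)
    (hI : SmallOnIntegrable U) : ∃ C' : ℝ≥0, ∀ f : Rn n → B, Integrable f →
      ∀ R : ℝ, (∀ y, f y ≠ 0 → ‖y‖ ≤ R) → ∀ t : ℝ, 0 < t →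
        ENNReal.ofReal t * volume {x | ENNReal.ofReal t < U f x} ≤ C' * ∫⁻ y, ‖f y‖ₑ := by
  obtain ⟨γ, hγ, hgl⟩ := hU.exists_good_lambda hn hδ hI (η := 1 / 4) (by norm_num)
  set E : ℝ≥0∞ := 4 * (5 ^ n * unitVol n * ENNReal.ofReal (1 / γ)) with hE
  have hEtop : E ≠ ∞ := ENNReal.mul_ne_top (by simp) (ENNReal.mul_ne_top
    (ENNReal.mul_ne_top (by simp) (unitVol_ne_top n)) ENNReal.ofReal_ne_top)
  refine ⟨E.toNNReal, fun f hf R hR t ht => ?_⟩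
  rw [ENNReal.coe_toNNReal hEtop, hE, mul_assoc]
  obtain ⟨K₁, K₂, hK₁, hK₂, hap⟩ := hU.exists_volume_lt_le hn hf hR
  refine mul_le_of_good_lambda (Φ := fun t => volume {x | ENNReal.ofReal t < U f x})
    (η := ENNReal.ofReal (1 / 4)) ?_ (fun s hs => ?_) (fun N hN => ?_) ht
  · rw [show (2 : ℝ≥0∞) = ENNReal.ofReal 2 by simp, ← ENNReal.ofReal_mul (by norm_num),
      ← ENNReal.ofReal_one, ← ENNReal.ofReal_div_of_pos (by norm_num)]
    exact ENNReal.ofReal_le_ofReal (by norm_num)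
  · refine (hgl f hf R hR s hs).trans (add_le_add le_rfl
      ((volume_bad_le hn _ (by positivity)).trans (le_of_eq ?_)))
    rw [show 1 / (γ * s) = 1 / γ * (1 / s) by field_simp, ENNReal.ofReal_mul (by positivity)]
    ring
  · refine ⟨ENNReal.ofReal N * K₁ + K₂, ENNReal.add_ne_top.2
      ⟨ENNReal.mul_ne_top ENNReal.ofReal_ne_top hK₁, hK₂⟩, fun s hs hsN => ?_⟩
    calc _ ≤ ENNReal.ofReal s * (K₁ + K₂ * ENNReal.ofReal (1 / s)) := by gcongr; exact hap s hs
      _ = ENNReal.ofReal s * K₁ + K₂ * (ENNReal.ofReal s * ENNReal.ofReal (1 / s)) := by ring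
      _ = ENNReal.ofReal s * K₁ + K₂ := by
          rw [← ENNReal.ofReal_mul hs.le, mul_one_div_cancel hs.ne', ENNReal.ofReal_one, mul_one]
      _ ≤ _ := by gcongr

/-- The layer-cake formula, then absorption against the strong type bound of the maximal function.
-/
theorem IsCZ.exists_strong_bound_of_bounded_support (hn : 0 < n) (hδ : 0 < δ)
    (hU : IsCZ 𝕜 δ C U) (hI : SmallOnIntegrable U) {p : ℝ} (hp : 1 < p) :
    ∃ C' : ℝ≥0, ∀ f : Rn n → B, Integrable f →
      ∀ R : ℝ, (∀ y, f y ≠ 0 → ‖y‖ ≤ R) → ∫⁻ x, U f x ^ p ≤ C' * ∫⁻ y, ‖f y‖ₑ ^ p := by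
  have hp0 : 0 < p := by linarith
  -- Makes 2^p η = 1/2, the borderline for absorption.
  set η : ℝ := (2 : ℝ) ^ (-p - 1) with hη
  obtain ⟨γ, hγ, hgl⟩ := hU.exists_good_lambda hn hδ hI (η := η) (by positivity)
  obtain ⟨E, hE⟩ := exists_lintegral_bad_le hn hp hγ
  refine ⟨p.toNNReal * (2 ^ (p + 1) * E), fun f hf R hR => ?_⟩
  obtain ⟨K₁, K₂, hK₁, hK₂, hap⟩ := hU.exists_volume_lt_le hn hf hR
  have hm := hU.measurable f (hf.adm hδ.le)
  have hfin := hI.ae_ne_top hf hR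
  set Φ : ℝ → ℝ≥0∞ := fun t => volume {x | ENNReal.ofReal t < U f x} with hΦ
  have hanti : Antitone Φ := fun s t hst => measure_mono fun x hx =>
    lt_of_le_of_lt (ENNReal.ofReal_le_ofReal hst) hx
  have hmain := lintegral_rpow_le_of_good_lambda (Φ := Φ)
    (ψ := fun t => volume (bad (fun y => ‖f y‖ₑ) (γ * t))) hanti.measurable hp0
    (η := ENNReal.ofReal η) ?_ (fun t ht => hgl f hf R hR t ht) ?_
  · have hlc := lintegral_rpow_eq_lintegral_meas_lt_mul volume
      (f := fun x => (U f x).toReal) (Eventually.of_forall fun x => ENNReal.toReal_nonneg)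
      hm.ennreal_toReal.aemeasurable hp0
    have h1 : ∫⁻ x, U f x ^ p = ∫⁻ x, ENNReal.ofReal ((U f x).toReal ^ p) := by
      refine lintegral_congr_ae ?_
      filter_upwards [hfin] with x hx
      rw [← ENNReal.ofReal_rpow_of_nonneg ENNReal.toReal_nonneg hp0.le, ENNReal.ofReal_toReal hx]
    have h2 : ∫⁻ t in Ioi (0 : ℝ), volume {x | t < (U f x).toReal} * ENNReal.ofReal (t ^ (p - 1)) =
        ∫⁻ t in Ioi (0 : ℝ), Φ t * ENNReal.ofReal (t ^ (p - 1)) := by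
      refine setLIntegral_congr_fun measurableSet_Ioi fun t ht => ?_
      have ht : 0 < t := ht
      refine congrArg (· * _) (measure_congr ?_)
      filter_upwards [hfin] with x hx
      exact propext ((ENNReal.ofReal_lt_iff_lt_toReal ht.le hx)).symm
    rw [h1, hlc, h2]
    calc _ ≤ ENNReal.ofReal p * (2 ^ (p + 1) * (E * ∫⁻ y, ‖f y‖ₑ ^ p)) := by
          gcongr
          refine hmain.trans ?_
          gcongr
          exact hE _ hf.1.enorm
      _ = _ := by
          rw [ENNReal.coe_mul, ENNReal.coe_mul, ENNReal.coe_rpow_of_nonneg _ (by positivity)]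
          change _ = ENNReal.ofReal p * _ * _
          push_cast
          ring
  · rw [show (2 : ℝ≥0∞) = ENNReal.ofReal 2 by simp,
      ENNReal.ofReal_rpow_of_pos (by norm_num), ← ENNReal.ofReal_mul (by positivity),
      ← ENNReal.ofReal_one, ← ENNReal.ofReal_div_of_pos (by norm_num), hη,
      ← Real.rpow_add (by norm_num)]
    refine ENNReal.ofReal_le_ofReal (le_of_eq ?_)
    rw [show p + (-p - 1) = -1 by ring, Real.rpow_neg_one]; norm_num
  · intro N hN
    have hint : ∀ a : ℝ, 0 < a →
        ∫⁻ t in Ioo 0 N, ENNReal.ofReal (t ^ (a - 1)) ≠ ∞ := fun a ha => by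
      have h := (intervalIntegral.intervalIntegrable_rpow' (a := 0) (b := N) (r := a - 1)
        (by linarith))
      rw [intervalIntegrable_iff_integrableOn_Ioo_of_le hN.le] at h
      have h2 := h.2
      refine ne_top_of_le_ne_top h2.ne (lintegral_mono fun t => ?_)
      exact Real.ofReal_le_enorm _
    -- The a priori bound behaves like 1/t near 0, and t^{p-2} is integrable there because p > 1.
    refine ne_top_of_le_ne_top (b := K₁ * (∫⁻ t in Ioo 0 N, ENNReal.ofReal (t ^ (p - 1))) +
      K₂ * ∫⁻ t in Ioo 0 N, ENNReal.ofReal (t ^ ((p - 1) - 1))) ?_ ?_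
    · exact ENNReal.add_ne_top.2 ⟨ENNReal.mul_ne_top hK₁ (hint p hp0),
        ENNReal.mul_ne_top hK₂ (hint (p - 1) (by linarith))⟩
    · rw [← lintegral_const_mul' _ _ hK₁, ← lintegral_const_mul' _ _ hK₂,
        ← lintegral_add_left (by fun_prop)]
      refine setLIntegral_mono' measurableSet_Ioo fun t ht => ?_
      refine (mul_le_mul_left (hap t ht.1) _).trans (le_of_eq ?_)
      rw [add_mul, mul_assoc, ← ENNReal.ofReal_mul (by have := ht.1; positivity),
        Real.rpow_sub_one ht.1.ne' (p - 1), one_div_mul_eq_div]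

end

end FracLP

/-! ### Truncation: weak and strong type without the restriction on the support. -/

namespace FracLP

noncomputable section

variable {n : ℕ} {B : Type*} [NormedAddCommGroup B] {δ : ℝ} {f : Rn n → B}

theorem norm_le_of_indicator_closedBall_ne_zero {R : ℝ} {y : Rn n}
    (hy : (Metric.closedBall (0 : Rn n) R).indicator f y ≠ 0) : ‖y‖ ≤ R :=
  mem_closedBall_zero_iff.1 (mem_of_indicator_ne_zero hy)

theorem Adm.indicator (hf : Adm δ f) {S : Set (Rn n)} (hS : MeasurableSet S) :
    Adm δ (S.indicator f) := by
  refine ⟨hf.1.indicator hS, lt_of_le_of_lt (lintegral_mono fun y => ?_) hf.2⟩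
  gcongr
  exact enorm_indicator_le_enorm_self _ _

theorem Adm.tendsto_indicator (hf : Adm δ f) {S : ℕ → Set (Rn n)} (hS : ∀ k, MeasurableSet (S k))
    (h : ∀ y, ∀ᶠ k in atTop, y ∈ S k) :
    Tendsto (fun k => ∫⁻ y, ‖(S k).indicator f y - f y‖ₑ * ENNReal.ofReal (wgt n δ y))
      atTop (𝓝 0) := by
  rw [← lintegral_zero (μ := (volume : Measure (Rn n)))]
  have hw := measurable_wgt n δ
  refine tendsto_lintegral_of_dominated_convergence'
    (fun y => ‖f y‖ₑ * ENNReal.ofReal (wgt n δ y)) (fun k => ?_) (fun k => ?_) hf.2.ne ?_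
  · exact ((hf.1.indicator (hS k)).sub hf.1).enorm.mul hw.ennreal_ofReal.aemeasurable
  · refine Eventually.of_forall fun y => ?_
    by_cases hy : y ∈ S k
    · simp [indicator_of_mem hy]
    · simp [indicator_of_notMem hy]
  · refine Eventually.of_forall fun y => ?_
    refine tendsto_const_nhds.congr' ?_
    filter_upwards [h y] with k hk
    simp [indicator_of_mem hk]

theorem eventually_mem_closedBall (y : Rn n) :
    ∀ᶠ k : ℕ in atTop, y ∈ Metric.closedBall (0 : Rn n) k := by
  obtain ⟨N, hN⟩ := exists_nat_ge ‖y‖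
  filter_upwards [eventually_ge_atTop N] with k hk
  rw [mem_closedBall_zero_iff]
  exact hN.trans (by exact_mod_cast hk)

variable {𝕜 : Type*} [RCLike 𝕜] [NormedSpace 𝕜 B] [NormedSpace ℝ B] {C : ℝ≥0}
  {U : (Rn n → B) → Rn n → ℝ≥0∞}

theorem IsCZ.le_liminf_truncation (hU : IsCZ 𝕜 δ C U) (hf : Adm δ f) (x : Rn n) :
    U f x ≤ liminf (fun k : ℕ => U ((Metric.closedBall (0 : Rn n) k).indicator f) x) atTop :=
  hU.lsc f _ hf (fun _ => hf.indicator Metric.isClosed_closedBall.measurableSet)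
    (hf.tendsto_indicator (fun _ => Metric.isClosed_closedBall.measurableSet)
      eventually_mem_closedBall) x

theorem IsCZ.mapsL1ToWeakL1 (hn : 0 < n) (hδ : 0 < δ) (hU : IsCZ 𝕜 δ C U)
    (hI : SmallOnIntegrable U) : MapsL1ToWeakL1 U := by
  obtain ⟨C', hC'⟩ := hU.exists_weak_bound_of_bounded_support hn hδ hI
  refine ⟨C', fun f hf => ?_⟩
  have hfi : Integrable f := memLp_one_iff_integrable.1 hf
  have had := hfi.adm hδ.le
  refine ⟨(hU.measurable f had).aemeasurable, fun s hs => ?_⟩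
  rw [eLpNorm_one_eq_lintegral_enorm]
  set F : ℕ → Rn n → B := fun k => (Metric.closedBall (0 : Rn n) k).indicator f
  -- If U f exceeds s, so does the liminf over truncations, hence all late truncations do. The union
  -- over N is increasing, so its measure is a supremum of measures already bounded.
  have hsub : {x | (s : ℝ≥0∞) < U f x} ⊆ ⋃ N : ℕ, ⋂ k : ℕ, ⋂ _ : N ≤ k,
      {x | (s : ℝ≥0∞) < U (F k) x} := by
    intro x hx
    have h1 := eventually_lt_of_lt_liminf (lt_of_lt_of_le hx (hU.le_liminf_truncation had x))
    obtain ⟨N, hN⟩ := eventually_atTop.1 h1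
    exact mem_iUnion.2 ⟨N, mem_iInter₂.2 fun k hk => hN k hk⟩
  have hmono : Monotone fun N : ℕ => ⋂ k : ℕ, ⋂ _ : N ≤ k, {x | (s : ℝ≥0∞) < U (F k) x} :=
    fun N M hNM => iInter_mono fun k => iInter_mono' fun hk => ⟨hNM.trans hk, Subset.rfl⟩
  refine (mul_le_mul_right (measure_mono hsub) _).trans ?_
  rw [hmono.measure_iUnion, ENNReal.mul_iSup]
  refine iSup_le fun N => ?_
  have h2 := hC' (F N) (hfi.indicator Metric.isClosed_closedBall.measurableSet) N
    (fun y hy => norm_le_of_indicator_closedBall_ne_zero hy) s hs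
  rw [ENNReal.ofReal_coe_nnreal] at h2
  refine (mul_le_mul_right (measure_mono (iInter₂_subset N le_rfl)) _).trans (h2.trans ?_)
  gcongr
  exact enorm_indicator_le_enorm_self _ _

/-- Truncate to balls, then combine pointwise lower semicontinuity with Fatou's lemma. L^p functions
are admissible, so U f is controlled although f need not be integrable. -/
theorem IsCZ.mapsLpToLp (hn : 0 < n) (hδ : 0 < δ) (hU : IsCZ 𝕜 δ C U)
    (hI : SmallOnIntegrable U) {p : ℝ} (hp : 1 < p) : MapsLpToLp U p := by
  have hp0 : 0 < p := by linarith
  obtain ⟨C', hC'⟩ := hU.exists_strong_bound_of_bounded_support hn hδ hI hp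
  refine ⟨C' ^ (1 / p), fun f hf => ?_⟩
  have hp1 : 1 ≤ ENNReal.ofReal p := by
    rw [← ENNReal.ofReal_one]; exact ENNReal.ofReal_le_ofReal hp.le
  have hp00 : ENNReal.ofReal p ≠ 0 := by simpa using hp0
  have had : Adm δ f := hf.adm hδ hp1
  have hm := hU.measurable f had
  set F : ℕ → Rn n → B := fun k => (Metric.closedBall (0 : Rn n) k).indicator f
  have hFi : ∀ k, Integrable (F k) := fun k => by
    refine IntegrableOn.integrable_indicator ?_ Metric.isClosed_closedBall.measurableSet
    have : IsFiniteMeasure (volume.restrict (Metric.closedBall (0 : Rn n) k)) :=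
      isFiniteMeasure_restrict.2 measure_closedBall_lt_top.ne
    exact (hf.restrict _).integrable hp1
  have h1 : ∫⁻ x, U f x ^ p ≤ C' * ∫⁻ y, ‖f y‖ₑ ^ p := by
    have hlim : ∀ x, U f x ^ p ≤ liminf (fun k => U (F k) x ^ p) atTop := fun x =>
      calc U f x ^ p ≤ (liminf (fun k => U (F k) x) atTop) ^ p :=
            ENNReal.rpow_le_rpow (hU.le_liminf_truncation had x) hp0.le
        _ = _ := (ENNReal.orderIsoRpow p hp0).liminf_apply
    refine (lintegral_mono hlim).trans ((lintegral_liminf_le fun k =>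
      (hU.measurable _ ((hFi k).adm hδ.le)).pow_const p).trans ?_)
    refine (liminf_le_liminf (Eventually.of_forall fun k => ?_)).trans (liminf_const _).le
    refine (hC' (F k) (hFi k) k fun y hy => norm_le_of_indicator_closedBall_ne_zero hy).trans ?_
    gcongr
    exact enorm_indicator_le_enorm_self _ _
  have h2 : eLpNorm (U f) (ENNReal.ofReal p) volume ≤
      ((C' ^ (1 / p) : ℝ≥0) : ℝ≥0∞) * eLpNorm f (ENNReal.ofReal p) volume := by
    rw [eLpNorm_eq_lintegral_rpow_enorm_toReal hp00 ENNReal.ofReal_ne_top,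
      eLpNorm_eq_lintegral_rpow_enorm_toReal hp00 ENNReal.ofReal_ne_top,
      ENNReal.toReal_ofReal hp0.le, ENNReal.coe_rpow_of_nonneg _ (by positivity),
      ← ENNReal.mul_rpow_of_nonneg _ _ (by positivity)]
    exact ENNReal.rpow_le_rpow (by simpa using h1) (by positivity)
  exact ⟨⟨hm.aestronglyMeasurable, lt_of_le_of_lt h2 (ENNReal.mul_lt_top ENNReal.coe_lt_top hf.2)⟩,
    h2⟩

end

end FracLP

namespace FracLP

noncomputable section

variable {n : ℕ} {B : Type*} [NormedAddCommGroup B] {δ : ℝ}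
theorem lintegral_rpow_le_of_support_subset {f : Rn n → B} {Q : Set (Rn n)} (hQ : MeasurableSet Q)
    (hf : Function.support f ⊆ Q) {M : ℝ≥0∞} (hM : ∀ᵐ y, ‖f y‖ₑ ≤ M) {p : ℝ} (hp : 0 < p) :
    ∫⁻ y, ‖f y‖ₑ ^ p ≤ M ^ p * volume Q := by
  rw [← setLIntegral_const, ← lintegral_indicator hQ]
  refine lintegral_mono_ae ?_
  filter_upwards [hM] with y hy
  by_cases hyQ : y ∈ Q
  · rw [indicator_of_mem hyQ]
    exact ENNReal.rpow_le_rpow hy hp.le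
  · have : f y = 0 := by
      by_contra h
      exact hyQ (hf h)
    simp [this, hp]

theorem lintegral_le_of_support_subset {f : Rn n → B} {Q : Set (Rn n)} (hQ : MeasurableSet Q)
    (hf : Function.support f ⊆ Q) {M : ℝ≥0∞} (hM : ∀ᵐ y, ‖f y‖ₑ ≤ M) :
    ∫⁻ y, ‖f y‖ₑ ≤ M * volume Q := by
  simpa using lintegral_rpow_le_of_support_subset hQ hf hM one_pos

variable {𝕜 : Type*} [RCLike 𝕜] [NormedSpace 𝕜 B] [NormedSpace ℝ B] {C : ℝ≥0}
  {U : (Rn n → B) → Rn n → ℝ≥0∞}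

/-! ### The Hardy space estimate -/

theorem volume_cube_ne_zero (c : Rn n) {r : ℝ} (hr : 0 < r) : volume (cube c r) ≠ 0 := by
  rw [volume_cube c hr.le]
  exact (ENNReal.ofReal_pos.2 (by positivity)).ne'

theorem volume_cube_ne_top (c : Rn n) {r : ℝ} (hr : 0 ≤ r) : volume (cube c r) ≠ ∞ := by
  rw [volume_cube c hr]; exact ENNReal.ofReal_ne_top

/-- Near the cube the L² bound suffices; away from it the mean-zero condition makes U a integrable.
-/
theorem IsCZ.exists_lintegral_atom_le (hn : 0 < n) (hδ : 0 < δ) (hU : IsCZ 𝕜 δ C U)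
    (hI : SmallOnIntegrable U) :
    ∃ C' : ℝ≥0, ∀ a : Rn n → B, IsAtom a → Integrable a ∧ ∫⁻ x, U a x ≤ C' := by
  obtain ⟨C₂, h₂⟩ := hU.exists_strong_bound_of_bounded_support hn hδ hI (p := 2) (by norm_num)
  obtain ⟨C₁, h₁⟩ := hU.exists_lintegral_le
  refine ⟨C₂ + (n ^ n * (unitVol n).toNNReal) + C₁, fun a ha => ?_⟩
  obtain ⟨ham, c, r, hr, hsupp, hbd, hint⟩ := ha
  set V := volume (cube c r) with hV
  have hV0 : V ≠ 0 := volume_cube_ne_zero c hr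
  have hVt : V ≠ ∞ := volume_cube_ne_top c hr.le
  have hQ : MeasurableSet (cube c r) := (isClosed_cube c r).measurableSet
  have hae : ∀ᵐ y, ‖a y‖ₑ ≤ V⁻¹ := by
    rw [eLpNorm_exponent_top] at hbd
    filter_upwards [enorm_ae_le_eLpNormEssSup a volume] with y hy
    exact hy.trans hbd
  have hL1 : ∫⁻ y, ‖a y‖ₑ ≤ 1 :=
    (lintegral_le_of_support_subset hQ hsupp hae).trans (ENNReal.inv_mul_cancel hV0 hVt).le
  have hL2 : V * ∫⁻ y, ‖a y‖ₑ ^ (2 : ℝ) ≤ 1 := by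
    refine (mul_le_mul_right
      (lintegral_rpow_le_of_support_subset hQ hsupp hae two_pos) V).trans (le_of_eq ?_)
    rw [ENNReal.rpow_two]
    calc V * (V⁻¹ ^ 2 * V) = (V * V⁻¹) * (V * V⁻¹) := by ring
      _ = 1 := by rw [ENNReal.mul_inv_cancel hV0 hVt, one_mul]
  have hai : Integrable a := ⟨ham, lt_of_le_of_lt hL1 ENNReal.one_lt_top⟩
  refine ⟨hai, ?_⟩
  have hnr : 0 < (n : ℝ) * r := by positivity
  have hball : ∀ y, a y ≠ 0 → ‖y - c‖ ≤ n * r := fun y hy =>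
    mem_closedBall_iff_norm.1 (cube_subset_closedBall c hr.le (hsupp hy))
  have hint0 : ∫ y, a y = 0 := by
    rw [← hint]
    refine (setIntegral_eq_integral_of_forall_compl_eq_zero fun y hy => ?_).symm
    by_contra h
    exact hy (hsupp h)
  set S : Set (Rn n) := {x | 2 * (n * r) ≤ ‖x - c‖} with hS
  have hSm : MeasurableSet S := measurableSet_le measurable_const (by fun_prop)
  have hfar : ∫⁻ x in S, U a x ≤ C₁ :=
    (h₁ a c (n * r) hai hnr hball hint0).trans ((mul_le_mul_right hL1 _).trans (mul_one _).le)
  -- Takes the place of Cauchy–Schwarz: integrated over a set of measure comparable to V, both terms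
  -- are bounded, since the squared L² norm of an atom is at most 1/V.
  have hpt : ∀ x, U a x ≤ V * U a x ^ (2 : ℝ) + V⁻¹ := fun x => by
    rcases le_total (U a x) V⁻¹ with h | h
    · exact h.trans le_add_self
    · refine le_trans ?_ le_self_add
      rw [ENNReal.rpow_two, sq, ← mul_assoc]
      have h3 : 1 ≤ V * U a x := by
        rw [← ENNReal.mul_inv_cancel hV0 hVt]; gcongr
      calc U a x = 1 * U a x := (one_mul _).symm
        _ ≤ _ := by gcongr
  have hnear : ∫⁻ x in Sᶜ, U a x ≤ C₂ + n ^ n * unitVol n := by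
    have hsub : Sᶜ ⊆ Metric.closedBall c (2 * (n * r)) := fun x hx => by
      have hx : ¬ (2 * (n * r) ≤ ‖x - c‖) := hx
      rw [mem_closedBall_iff_norm]; linarith
    have hm := hU.measurable a (hai.adm hδ.le)
    calc _ ≤ ∫⁻ x in Metric.closedBall c (2 * (n * r)), (V * U a x ^ (2 : ℝ) + V⁻¹) :=
          (lintegral_mono_set hsub).trans (lintegral_mono hpt)
      _ = V * (∫⁻ x in Metric.closedBall c (2 * (n * r)), U a x ^ (2 : ℝ)) +
          V⁻¹ * volume (Metric.closedBall c (2 * (n * r))) := by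
          rw [lintegral_add_right _ measurable_const, setLIntegral_const,
            lintegral_const_mul' _ _ hVt]
      _ ≤ V * (C₂ * ∫⁻ y, ‖a y‖ₑ ^ (2 : ℝ)) + V⁻¹ * (V * (n ^ n * unitVol n)) := by
          gcongr
          · exact (setLIntegral_le_lintegral _ _).trans (h₂ a hai (‖c‖ + n * r) fun y hy => by
              have := norm_sub_norm_le y c
              linarith [hball y hy])
          · rw [volume_closedBall _ (by positivity), hV, volume_cube c hr.le, ← mul_assoc (ENNReal.ofReal _)]
            refine mul_le_mul' ?_ le_rfl
            rw [show (n : ℝ≥0∞) ^ n = ENNReal.ofReal ((n : ℝ) ^ n) by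
              rw [ENNReal.ofReal_pow (by positivity), ENNReal.ofReal_natCast],
              ← ENNReal.ofReal_mul (by positivity), ← mul_pow]
            exact ENNReal.ofReal_le_ofReal (le_of_eq (by ring))
      _ = C₂ * (V * ∫⁻ y, ‖a y‖ₑ ^ (2 : ℝ)) + (V⁻¹ * V) * (n ^ n * unitVol n) := by ring
      _ ≤ C₂ * 1 + 1 * (n ^ n * unitVol n) := by
          gcongr; exact ENNReal.inv_mul_le_one _
      _ = _ := by rw [mul_one, one_mul]
  rw [← lintegral_add_compl _ hSm, add_comm]
  refine (add_le_add hnear hfar).trans (le_of_eq ?_)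
  push_cast
  rw [ENNReal.coe_toNNReal (unitVol_ne_top n)]

theorem IsAtomicDecomp.integrable {f : Rn n → B} {c : ℕ → 𝕜} {a : ℕ → Rn n → B}
    (hf : AEStronglyMeasurable f) (h : IsAtomicDecomp f c a) (ha : ∀ i, Integrable (a i)) :
    Integrable f := by
  have h1 := (tendsto_order.1 h.2.2).2 1 one_pos
  obtain ⟨N, hN⟩ := h1.exists
  have hs : Integrable fun x => ∑ i ∈ Finset.range N, c i • a i x :=
    integrable_finsetSum _ fun i _ => (ha i).smul (c i)
  have hd : Integrable fun x => f x - ∑ i ∈ Finset.range N, c i • a i x :=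
    memLp_one_iff_integrable.1 ⟨hf.sub hs.1, hN.trans ENNReal.one_lt_top⟩
  exact (hd.add hs).congr (Eventually.of_forall fun x => sub_add_cancel _ _)

/-- Countable sublinearity reduces the claim to the uniform atom bound. It holds along every atomic
decomposition, so the infimum may be taken. -/
theorem IsCZ.mapsH1ToL1 (hn : 0 < n) (hδ : 0 < δ) (hU : IsCZ 𝕜 δ C U)
    (hI : SmallOnIntegrable U) : MapsH1ToL1 𝕜 U := by
  obtain ⟨C', hC'⟩ := hU.exists_lintegral_atom_le hn hδ hI
  -- Adding 1 makes the constant nonzero, so that it may be divided out in `ℝ≥0∞`.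
  refine ⟨C' + 1, fun f ⟨hfm, c₀, a₀, h₀⟩ => ?_⟩
  have hfi : Integrable f := h₀.integrable hfm fun i => (hC' _ (h₀.1 i)).1
  have hm := hU.measurable f (hfi.adm hδ.le)
  have key : ∀ (c : ℕ → 𝕜) (a : ℕ → Rn n → B), IsAtomicDecomp f c a →
      eLpNorm (U f) 1 volume ≤ ((C' + 1 : ℝ≥0) : ℝ≥0∞) * ∑' i, ‖c i‖ₑ := by
    intro c a h
    have hai := fun i => (hC' _ (h.1 i)).1
    have hb : ∀ i, Integrable fun y => c i • a i y := fun i => (hai i).smul (c i)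
    have ht := h.2.2
    simp_rw [eLpNorm_one_eq_lintegral_enorm, enorm_sub_rev (f _)] at ht
    rw [eLpNorm_one_eq_lintegral_enorm]
    simp_rw [enorm_eq_self]
    calc ∫⁻ x, U f x ≤ ∫⁻ x, ∑' i, ‖c i‖ₑ * U (a i) x := by
          refine lintegral_mono fun x => (hU.tsum_le hδ hb hfi ht x).trans (le_of_eq ?_)
          exact tsum_congr fun i => hU.smul (c i) (a i) ((hai i).adm hδ.le) x
      _ = ∑' i, ‖c i‖ₑ * ∫⁻ x, U (a i) x := by
          rw [lintegral_tsum fun i =>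
            ((hU.measurable _ ((hai i).adm hδ.le)).const_mul _).aemeasurable]
          exact tsum_congr fun i => lintegral_const_mul' _ _ enorm_ne_top
      _ ≤ ∑' i, ‖c i‖ₑ * ((C' + 1 : ℝ≥0) : ℝ≥0∞) := by
          refine ENNReal.tsum_le_tsum fun i => mul_le_mul_right ((hC' _ (h.1 i)).2.trans ?_) _
          exact_mod_cast le_self_add
      _ = _ := by rw [ENNReal.tsum_mul_right, mul_comm]
  refine ⟨⟨hm.aestronglyMeasurable, (key c₀ a₀ h₀).trans_lt
    (ENNReal.mul_lt_top ENNReal.coe_lt_top ?_)⟩, ?_⟩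
  · have : Summable fun i => ‖c₀ i‖₊ := by
      rw [← NNReal.summable_coe]; exact h₀.2.1
    exact (ENNReal.tsum_coe_ne_top_iff_summable.2 this).lt_top
  · rw [mul_comm, ← ENNReal.div_le_iff_le_mul (Or.inl (by simp)) (Or.inl ENNReal.coe_ne_top)]
    refine le_iInf₂ fun c a => le_iInf fun h => ?_
    rw [ENNReal.div_le_iff_le_mul (Or.inl (by simp)) (Or.inl ENNReal.coe_ne_top), mul_comm]
    exact key c a h

end

end FracLP

namespace FracLP

noncomputable section

variable {n : ℕ} {B : Type*} [NormedAddCommGroup B] {δ : ℝ} {U : (Rn n → B) → Rn n → ℝ≥0∞}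

/-! ### The global estimates imply the local weak type estimate -/

/-- A diagonal shift by 2L in each coordinate. On this companion box the size estimate makes U f
bounded, which fixes constants that BMO does not see and supplies room for a compensating mass. -/
theorem exists_separated_hbox (hn : 0 < n) (a : Rn n) {L : ℝ} (hL : 0 < L) : ∃ a' : Rn n,
    (∀ x ∈ hbox a' L, ∀ y ∈ hbox a L, L ≤ ‖x - y‖) ∧ hbox a' L ⊆ cube (boxCenter a L) (3 * L) ∧
      hbox a L ⊆ cube (boxCenter a L) (3 * L) := by
  refine ⟨WithLp.toLp 2 fun i => a i + 2 * L, fun x hx y hy => ?_, fun x hx i => ?_,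
    fun x hx i => ?_⟩
  · have h1 := hx ⟨0, hn⟩
    have h2 := hy ⟨0, hn⟩
    refine le_trans ?_ (abs_apply_le_norm (x - y) ⟨0, hn⟩)
    refine le_trans ?_ (le_abs_self _)
    simp only [PiLp.sub_apply] at *
    linarith [h1.1, h2.2]
  · have h1 := hx i
    simp only [boxCenter] at *
    rw [abs_le]; constructor <;> linarith [h1.1, h1.2]
  · have h1 := hx i
    simp only [boxCenter] at *
    rw [abs_le]; constructor <;> linarith [h1.1, h1.2]

theorem volume_cube_three_mul (a : Rn n) {L : ℝ} (hL : 0 < L) :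
    volume (cube (boxCenter a L) (3 * L)) = 6 ^ n * volume (hbox a L) := by
  rw [volume_cube _ (by positivity), volume_hbox a hL.le,
    show (6 : ℝ≥0∞) ^ n = ENNReal.ofReal (6 ^ n) by rw [ENNReal.ofReal_pow (by norm_num)]; simp,
    ← ENNReal.ofReal_mul (by positivity), ← mul_pow]
  congr 2; ring

theorem memLp_top_of_support_subset_hbox {f : Rn n → B} (hf : AEStronglyMeasurable f) {M : ℝ}
    (hM : ∀ᵐ y, ‖f y‖ ≤ M) : MemLp f ∞ volume ∧ eLpNorm f ∞ volume ≤ ENNReal.ofReal M :=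
  ⟨memLp_top_of_bound hf M hM, by
    rw [eLpNorm_exponent_top]; exact eLpNormEssSup_le_of_ae_bound hM⟩

theorem hasCompactSupport_of_support_subset_hbox {f : Rn n → B} {a : Rn n} {L : ℝ} (hL : 0 < L)
    (hf : Function.support f ⊆ hbox a L) : HasCompactSupport f :=
  HasCompactSupport.intro (isCompact_closedBall (boxCenter a L) (n * L)) fun x hx => by
    by_contra h
    exact hx (hbox_subset_closedBall a hL.le (hf h))

theorem ae_enorm_le {f : Rn n → B} {M : ℝ} (hM : ∀ᵐ y, ‖f y‖ ≤ M) :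
    ∀ᵐ y, ‖f y‖ₑ ≤ ENNReal.ofReal M := by
  filter_upwards [hM] with y hy
  rw [← ofReal_norm]; exact ENNReal.ofReal_le_ofReal hy

theorem volume_hbox_ne_zero (a : Rn n) {L : ℝ} (hL : 0 < L) : volume (hbox a L) ≠ 0 := by
  rw [volume_hbox a hL.le]; exact (ENNReal.ofReal_pos.2 (by positivity)).ne'

theorem volume_hbox_ne_top (a : Rn n) {L : ℝ} (hL : 0 < L) : volume (hbox a L) ≠ ∞ := by
  rw [volume_hbox a hL.le]; exact ENNReal.ofReal_ne_top

theorem integrable_of_support_subset_hbox {f : Rn n → B} (hf : AEStronglyMeasurable f) {a : Rn n}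
    {L : ℝ} (hL : 0 < L) (hs : Function.support f ⊆ hbox a L) {M : ℝ} (hM : ∀ᵐ y, ‖f y‖ ≤ M) :
    Integrable f :=
  ⟨hf, (lintegral_le_of_support_subset (measurableSet_hbox a L) hs (ae_enorm_le hM)).trans_lt
    (ENNReal.mul_lt_top ENNReal.ofReal_lt_top (volume_hbox_ne_top a hL).lt_top)⟩

theorem weakOnBounded_of_mapsL1ToWeakL1 (h : MapsL1ToWeakL1 U) : WeakOnBounded U := by
  obtain ⟨C, hC⟩ := h
  refine ⟨C, fun a L hL f M hM hf hs hb s hs0 => ?_⟩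
  have hfi := integrable_of_support_subset_hbox hf hL hs hb
  have h1 := (hC f (memLp_one_iff_integrable.2 hfi)).2 s.toNNReal (by simpa using hs0)
  rw [eLpNorm_one_eq_lintegral_enorm] at h1
  change ENNReal.ofReal s * volume {x | ENNReal.ofReal s < U f x} ≤ _ at h1
  have h2 : ENNReal.ofReal s ≠ 0 := by simpa using hs0
  have h3 := lintegral_le_of_support_subset (measurableSet_hbox a L) hs (ae_enorm_le hb)
  rw [ENNReal.ofReal_div_of_pos hs0]
  refine (measure_mono inter_subset_right).trans ?_
  rw [mul_comm, ← ENNReal.le_div_iff_mul_le (Or.inl h2) (Or.inl ENNReal.ofReal_ne_top)] at h1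
  refine h1.trans ?_
  calc _ ≤ C * (ENNReal.ofReal M * volume (hbox a L)) / ENNReal.ofReal s := by gcongr
    _ = _ := by rw [ENNReal.div_eq_inv_mul, ENNReal.div_eq_inv_mul]; ring

theorem weakOnBounded_of_mapsLpToLp {p : ℝ} (hp : 1 < p) (h : MapsLpToLp U p) :
    WeakOnBounded U := by
  obtain ⟨C, hC⟩ := h
  have hp0 : 0 < p := by linarith
  have hp00 : ENNReal.ofReal p ≠ 0 := by simpa using hp0
  refine ⟨C, fun a L hL f M hM hf hs hb s hs0 => ?_⟩
  set V := volume (hbox a L) with hV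
  set x : ℝ≥0∞ := C * ENNReal.ofReal (M / s) with hx
  -- Chebyshev yields x^p, which is at most x when x ≤ 1. When x ≥ 1 the claim is trivial, as the
  -- set lies in the box.
  rcases le_total 1 x with h1 | h1
  · calc _ ≤ V := measure_mono inter_subset_left
      _ = 1 * V := (one_mul _).symm
      _ ≤ x * V := by gcongr
  have hs' : ENNReal.ofReal s ≠ 0 := by simpa using hs0
  have hfp := lintegral_rpow_le_of_support_subset (measurableSet_hbox a L) hs (ae_enorm_le hb) hp0
  have hfL : eLpNorm f (ENNReal.ofReal p) volume ≤ (ENNReal.ofReal M ^ p * V) ^ (1 / p) := by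
    rw [eLpNorm_eq_lintegral_rpow_enorm_toReal hp00 ENNReal.ofReal_ne_top,
      ENNReal.toReal_ofReal hp0.le]
    exact ENNReal.rpow_le_rpow hfp (by positivity)
  have hmem : MemLp f (ENNReal.ofReal p) volume := ⟨hf, hfL.trans_lt
    (ENNReal.rpow_lt_top_of_nonneg (by positivity) (ENNReal.mul_ne_top
      (ENNReal.rpow_ne_top_of_nonneg hp0.le ENNReal.ofReal_ne_top) (volume_hbox_ne_top a hL)))⟩
  obtain ⟨hUm, hUb⟩ := hC f hmem
  have hmarkov := mul_meas_ge_le_pow_eLpNorm' volume hp00 ENNReal.ofReal_ne_top hUm.1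
    (ENNReal.ofReal s)
  rw [ENNReal.toReal_ofReal hp0.le] at hmarkov
  simp only [enorm_eq_self] at hmarkov
  have hsp : ENNReal.ofReal s ^ p ≠ 0 := by simp [hs', hp0]
  have hsp' : ENNReal.ofReal s ^ p ≠ ∞ := ENNReal.rpow_ne_top_of_nonneg hp0.le ENNReal.ofReal_ne_top
  have h2 : eLpNorm (U f) (ENNReal.ofReal p) volume ^ p ≤
      (C : ℝ≥0∞) ^ p * (ENNReal.ofReal M ^ p * V) := by
    calc _ ≤ (C * (ENNReal.ofReal M ^ p * V) ^ (1 / p)) ^ p :=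
          ENNReal.rpow_le_rpow (hUb.trans (by gcongr)) hp0.le
      _ = _ := by
          rw [ENNReal.mul_rpow_of_nonneg _ _ hp0.le, ← ENNReal.rpow_mul, one_div_mul_cancel hp0.ne',
            ENNReal.rpow_one]
  calc volume (hbox a L ∩ {x | ENNReal.ofReal s < U f x})
      ≤ volume {x | ENNReal.ofReal s ≤ U f x} := measure_mono fun z hz =>
        (show ENNReal.ofReal s < U f z from hz.2).le
    _ ≤ (C : ℝ≥0∞) ^ p * (ENNReal.ofReal M ^ p * V) / ENNReal.ofReal s ^ p := by
        rw [ENNReal.le_div_iff_mul_le (Or.inl hsp) (Or.inl hsp'), mul_comm]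
        exact hmarkov.trans h2
    _ = x ^ p * V := by
        rw [hx, ENNReal.mul_rpow_of_nonneg _ _ hp0.le, ENNReal.ofReal_div_of_pos hs0,
          ENNReal.div_rpow_of_nonneg _ _ hp0.le, ENNReal.div_eq_inv_mul, ENNReal.div_eq_inv_mul]
        ring
    _ ≤ x * V := by
        gcongr
        calc x ^ p ≤ x ^ (1 : ℝ) := ENNReal.rpow_le_rpow_of_exponent_ge h1 hp.le
          _ = x := ENNReal.rpow_one x

variable {𝕜 : Type*} [RCLike 𝕜] [NormedSpace 𝕜 B] [NormedSpace ℝ B] {C : ℝ≥0}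

/-- Chebyshev, with M = 0 treated apart, so that the integral bound is needed only for M > 0 and
atoms may be normalized by M. -/
theorem IsCZ.weakOnBounded_of_lintegral_le (hδ : 0 < δ) (hU : IsCZ 𝕜 δ C U) {C' : ℝ≥0}
    (h : ∀ (a : Rn n) (L : ℝ), 0 < L → ∀ (f : Rn n → B) (M : ℝ), 0 < M →
      AEStronglyMeasurable f → Function.support f ⊆ hbox a L → (∀ᵐ y, ‖f y‖ ≤ M) →
      ∫⁻ x in hbox a L, U f x ≤ C' * ENNReal.ofReal M * volume (hbox a L)) :
    WeakOnBounded U := by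
  refine ⟨C', fun a L hL f M hM hf hsupp hb s hs => ?_⟩
  rcases hM.eq_or_lt with rfl | hM
  · have h0 : U f = U fun _ => 0 := by
      refine hU.congr f _ ((integrable_of_support_subset_hbox hf hL hsupp hb).adm hδ.le) ?_
      filter_upwards [hb] with y hy
      exact norm_le_zero_iff.1 hy
    have h1 : hbox a L ∩ {x | ENNReal.ofReal s < U f x} = ∅ := by
      ext x
      rw [h0]
      simp [hU.zero hδ]
    rw [h1]; simp
  have hm := hU.measurable f ((integrable_of_support_subset_hbox hf hL hsupp hb).adm hδ.le)
  have hs' : ENNReal.ofReal s ≠ 0 := by simpa using hs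
  have h1 := mul_meas_ge_le_lintegral (μ := volume.restrict (hbox a L)) hm (ENNReal.ofReal s)
  rw [mul_comm, ← ENNReal.le_div_iff_mul_le (Or.inl hs') (Or.inl ENNReal.ofReal_ne_top),
    Measure.restrict_apply' (measurableSet_hbox a L)] at h1
  calc _ ≤ volume ({x | ENNReal.ofReal s ≤ U f x} ∩ hbox a L) :=
        measure_mono fun x hx =>
          ⟨(show ENNReal.ofReal s < U f x from hx.2).le, hx.1⟩
    _ ≤ C' * ENNReal.ofReal M * volume (hbox a L) / ENNReal.ofReal s :=
        h1.trans (by gcongr; exact h a L hL f M hM hf hsupp hb)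
    _ = _ := by
        rw [ENNReal.ofReal_div_of_pos hs, ENNReal.div_eq_inv_mul, ENNReal.div_eq_inv_mul]; ring

theorem IsCZ.le_of_separated (hU : IsCZ 𝕜 δ C U) {a : Rn n} {L : ℝ} (hL : 0 < L)
    {f : Rn n → B} (hf : AEStronglyMeasurable f) (hs : Function.support f ⊆ hbox a L) {M : ℝ}
    (hM : ∀ᵐ y, ‖f y‖ ≤ M) {x : Rn n} (hx : ∀ y ∈ hbox a L, L ≤ ‖x - y‖) :
    U f x ≤ C * ENNReal.ofReal M := by
  have hfi := integrable_of_support_subset_hbox hf hL hs hM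
  refine (hU.size f hfi x L hL fun y hy => hx y (hs hy)).trans ?_
  have h3 := lintegral_le_of_support_subset (measurableSet_hbox a L) hs (ae_enorm_le hM)
  rw [volume_hbox a hL.le] at h3
  calc _ ≤ C * ENNReal.ofReal (L ^ (-(n : ℝ))) *
        (ENNReal.ofReal M * ENNReal.ofReal (L ^ n)) := by gcongr
    _ = C * ENNReal.ofReal M * ENNReal.ofReal (L ^ (-(n : ℝ)) * L ^ n) := by
        rw [ENNReal.ofReal_mul (by positivity)]; ring
    _ = _ := by
        rw [Real.rpow_neg hL.le, Real.rpow_natCast, inv_mul_cancel₀ (by positivity),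
          ENNReal.ofReal_one, mul_one]

theorem lintegral_cube_le_bmoSeminorm {F : Type*} [NormedAddCommGroup F] [NormedSpace ℝ F]
    (f : Rn n → F) (c : Rn n) {r : ℝ} (hr : 0 < r) :
    ∫⁻ x in cube c r, ‖f x - ⨍ y in cube c r, f y‖ₑ ≤ bmoSeminorm f * volume (cube c r) := by
  have h1 : (volume (cube c r))⁻¹ * ∫⁻ x in cube c r, ‖f x - ⨍ y in cube c r, f y‖ₑ ≤
      bmoSeminorm f := le_iSup_of_le c (le_iSup₂_of_le r hr le_rfl)
  have h0 := volume_cube_ne_zero c hr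
  have ht := volume_cube_ne_top c hr.le
  calc _ = (volume (cube c r) * (volume (cube c r))⁻¹) *
        ∫⁻ x in cube c r, ‖f x - ⨍ y in cube c r, f y‖ₑ := by
        rw [ENNReal.mul_inv_cancel h0 ht, one_mul]
    _ = (volume (cube c r))⁻¹ * (∫⁻ x in cube c r, ‖f x - ⨍ y in cube c r, f y‖ₑ) *
        volume (cube c r) := by ring
    _ ≤ _ := by gcongr

/-- The BMO bound controls U f - v for the average v over a cube containing both boxes. On the
companion box U f is at most C M, which bounds v; hence U f has bounded mean on the original box. -/
theorem IsCZ.weakOnBounded_of_mapsLinftycToBMO (hn : 0 < n) (hδ : 0 < δ) (hU : IsCZ 𝕜 δ C U)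
    (h : MapsLinftycToBMO U) : WeakOnBounded U := by
  obtain ⟨C₁, hC₁⟩ := h
  refine hU.weakOnBounded_of_lintegral_le hδ (C' := C₁ * 6 ^ n + (C₁ * 6 ^ n + C))
    fun a L hL f M hM hf hs hb => ?_
  obtain ⟨hmem, hle⟩ := memLp_top_of_support_subset_hbox hf hb
  obtain ⟨hfin, -, hbmo⟩ := hC₁ f hmem (hasCompactSupport_of_support_subset_hbox hL hs)
  obtain ⟨a', hsep, hsub', hsub⟩ := exists_separated_hbox hn a hL
  set V := volume (hbox a L) with hV
  have hV' : volume (hbox a' L) = V := by rw [hV, volume_hbox _ hL.le, volume_hbox _ hL.le]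
  set F : Rn n → ℝ := fun x => (U f x).toReal with hF
  have hm := hU.measurable f ((integrable_of_support_subset_hbox hf hL hs hb).adm hδ.le)
  have hFm : Measurable F := hm.ennreal_toReal
  set v : ℝ := ⨍ y in cube (boxCenter a L) (3 * L), F y with hv
  have hcube : ∫⁻ x in cube (boxCenter a L) (3 * L), ‖F x - v‖ₑ ≤
      C₁ * 6 ^ n * ENNReal.ofReal M * V := by
    refine (lintegral_cube_le_bmoSeminorm F _ (by positivity)).trans ?_
    rw [volume_cube_three_mul a hL]
    calc _ ≤ C₁ * ENNReal.ofReal M * (6 ^ n * V) := by gcongr; exact hbmo.trans (by gcongr)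
      _ = _ := by ring
  have hFe : ∀ x, ‖F x‖ₑ ≤ U f x := fun x => by
    rw [Real.enorm_of_nonneg ENNReal.toReal_nonneg]; exact ENNReal.ofReal_toReal_le
  -- The constant v is integrated over the companion box.
  have hv' : ‖v‖ₑ * V ≤ C₁ * 6 ^ n * ENNReal.ofReal M * V + C * ENNReal.ofReal M * V := by
    calc ‖v‖ₑ * V = ∫⁻ x in hbox a' L, ‖v‖ₑ := by rw [setLIntegral_const, hV']
      _ ≤ ∫⁻ x in hbox a' L, (‖F x - v‖ₑ + C * ENNReal.ofReal M) := by
          refine setLIntegral_mono' (measurableSet_hbox _ _) fun x hx => ?_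
          have e : ‖v‖ₑ ≤ ‖F x - v‖ₑ + ‖F x‖ₑ := by
            calc ‖v‖ₑ = ‖F x - (F x - v)‖ₑ := by rw [sub_sub_cancel]
              _ ≤ ‖F x‖ₑ + ‖F x - v‖ₑ := enorm_sub_le
              _ = _ := add_comm _ _
          exact e.trans (add_le_add le_rfl ((hFe x).trans
            (hU.le_of_separated hL hf hs hb fun y hy => hsep x hx y hy)))
      _ = (∫⁻ x in hbox a' L, ‖F x - v‖ₑ) + C * ENNReal.ofReal M * V := by
          rw [lintegral_add_right _ measurable_const, setLIntegral_const, hV']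
      _ ≤ _ := by gcongr; exact (lintegral_mono_set hsub').trans hcube
  calc ∫⁻ x in hbox a L, U f x = ∫⁻ x in hbox a L, ‖F x‖ₑ := by
        refine lintegral_congr_ae (ae_restrict_of_ae ?_)
        filter_upwards [hfin] with x hx
        rw [Real.enorm_of_nonneg ENNReal.toReal_nonneg, ENNReal.ofReal_toReal hx.ne]
    _ ≤ ∫⁻ x in hbox a L, (‖F x - v‖ₑ + ‖v‖ₑ) := lintegral_mono fun x => by
        calc ‖F x‖ₑ = ‖(F x - v) + v‖ₑ := by rw [sub_add_cancel]
          _ ≤ _ := enorm_add_le _ _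
    _ = (∫⁻ x in hbox a L, ‖F x - v‖ₑ) + ‖v‖ₑ * V := by
        rw [lintegral_add_right _ measurable_const, setLIntegral_const]
    _ ≤ C₁ * 6 ^ n * ENNReal.ofReal M * V +
        (C₁ * 6 ^ n * ENNReal.ofReal M * V + C * ENNReal.ofReal M * V) := by
        gcongr
        exact (lintegral_mono_set hsub).trans hcube
    _ = _ := by push_cast; ring

theorem memH1_smul_atom [IsScalarTower ℝ 𝕜 B] {a : Rn n → B} (ha : IsAtom a) {r : ℝ}
    (hr : 0 ≤ r) : MemH1 𝕜 (fun y => r • a y) ∧ h1Norm 𝕜 (fun y => r • a y) ≤ ENNReal.ofReal r := by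
  have hdec : IsAtomicDecomp (𝕜 := 𝕜) (fun y => r • a y) (fun i => if i = 0 then (r : 𝕜) else 0)
      fun _ => a := by
    refine ⟨fun _ => ha, ?_, ?_⟩
    · refine summable_of_ne_finset_zero (s := {0}) fun i hi => ?_
      rw [Finset.mem_singleton] at hi
      simp [hi]
    · refine tendsto_const_nhds.congr' ?_
      filter_upwards [eventually_ge_atTop 1] with N hN
      have h0 : (fun x => r • a x - ∑ i ∈ Finset.range N, (if i = 0 then (r : 𝕜) else 0) • a x) =
          fun _ => 0 := by
        ext x
        rw [Finset.sum_eq_single_of_mem 0 (Finset.mem_range.2 hN) fun i _ hi => by simp [hi],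
          if_pos rfl, ← RCLike.algebraMap_eq_ofReal, algebraMap_smul, sub_self]
      rw [h0]
      simp
  refine ⟨⟨ha.1.const_smul r, _, _, hdec⟩, (iInf₂_le_of_le _ _ (iInf_le _ hdec)).trans ?_⟩
  rw [tsum_eq_single 0 fun i hi => by simp [hi], if_pos rfl, ← ofReal_norm,
    RCLike.norm_ofReal, abs_of_nonneg hr]

/-- Placing the mean of f on the companion box and subtracting it produces a multiple of an atom.
The added function w contributes at most C M on the original box, by the size estimate. -/
theorem IsCZ.weakOnBounded_of_mapsH1ToL1 [IsScalarTower ℝ 𝕜 B] [CompleteSpace B] (hn : 0 < n)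
    (hδ : 0 < δ) (hU : IsCZ 𝕜 δ C U) (h : MapsH1ToL1 𝕜 U) : WeakOnBounded U := by
  obtain ⟨C₁, hC₁⟩ := h
  refine hU.weakOnBounded_of_lintegral_le hδ (C' := C₁ * 6 ^ n + C)
    fun a L hL f M hM hf hs hb => ?_
  obtain ⟨a', hsep, hsub', hsub⟩ := exists_separated_hbox hn a hL
  set V := volume (hbox a L) with hV
  have hV0 : V ≠ 0 := volume_hbox_ne_zero a hL
  have hVt : V ≠ ∞ := volume_hbox_ne_top a hL
  have hV' : volume (hbox a' L) = V := by rw [hV, volume_hbox _ hL.le, volume_hbox _ hL.le]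
  have hfi := integrable_of_support_subset_hbox hf hL hs hb
  set v : B := ⨍ y in hbox a L, f y with hv
  have hvM : ‖v‖ ≤ M := by
    have h1 := enorm_setAverage_le f (hbox a L)
    have h2 : ‖v‖ₑ ≤ ENNReal.ofReal M := by
      refine h1.trans ?_
      calc _ ≤ V⁻¹ * (ENNReal.ofReal M * V) := by
            gcongr
            exact (setLIntegral_le_lintegral _ _).trans
              (lintegral_le_of_support_subset (measurableSet_hbox a L) hs (ae_enorm_le hb))
        _ = ENNReal.ofReal M * (V⁻¹ * V) := by ring
        _ = _ := by rw [ENNReal.inv_mul_cancel hV0 hVt, mul_one]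
    rwa [← ofReal_norm, ENNReal.ofReal_le_ofReal_iff hM.le] at h2
  set w : Rn n → B := (hbox a' L).indicator fun _ => v with hw
  have hms' := measurableSet_hbox a' L
  have hwm : AEStronglyMeasurable w := aestronglyMeasurable_const.indicator hms'
  have hws : Function.support w ⊆ hbox a' L := support_indicator_subset
  have hwb : ∀ᵐ y, ‖w y‖ ≤ M := Eventually.of_forall fun y =>
    (norm_indicator_le_norm_self _ _).trans hvM
  have hwi := integrable_of_support_subset_hbox hwm hL hws hwb
  set Q := cube (boxCenter a L) (3 * L) with hQ
  have hVQ : volume Q = 6 ^ n * V := volume_cube_three_mul a hL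
  have hVQr : volume Q = ENNReal.ofReal ((2 * (3 * L)) ^ n) := volume_cube _ (by positivity)
  -- M times the volume of the large cube: the normalization that makes (f - w)/r an atom.
  set r : ℝ := M * (2 * (3 * L)) ^ n with hr
  have hr0 : 0 < r := by positivity
  have hsuppg : ∀ y, f y - w y ≠ 0 → y ∈ Q := fun y hy => by
    by_contra hyQ
    have h1 : f y = 0 := by by_contra h1; exact hyQ (hsub (hs h1))
    have h2 : w y = 0 := by by_contra h2; exact hyQ (hsub' (hws h2))
    exact hy (by rw [h1, h2, sub_zero])
  have hint : ∫ y, (f y - w y) = 0 := by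
    rw [integral_sub hfi hwi, hw, integral_indicator hms', setIntegral_const, hv, setAverage_eq,
      Measure.real, Measure.real, hV', ← hV, smul_inv_smul₀ (ENNReal.toReal_pos hV0 hVt).ne',
      setIntegral_eq_integral_of_forall_compl_eq_zero, sub_self]
    intro y hy
    by_contra h1
    exact hy (hs h1)
  have hatom : IsAtom fun y => r⁻¹ • (f y - w y) := by
    refine ⟨(hf.sub hwm).const_smul _, boxCenter a L, 3 * L, by positivity, fun y hy =>
      hsuppg y fun h0 => hy (by simp [h0]), ?_, ?_⟩
    · rw [eLpNorm_exponent_top, ← hQ, hVQr, ← ENNReal.ofReal_inv_of_pos (by positivity)]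
      refine eLpNormEssSup_le_of_ae_bound ?_
      filter_upwards [hb] with y hy
      -- The supports are disjoint, so the bound is M rather than 2M.
      have h1 : ‖f y - w y‖ ≤ M := by
        by_cases hy' : y ∈ hbox a' L
        · have h2 : f y = 0 := by
            by_contra h2
            have := hsep y hy' y (hs h2)
            rw [sub_self, norm_zero] at this
            linarith
          rw [h2, zero_sub, norm_neg]
          exact (norm_indicator_le_norm_self _ _).trans hvM
        · rw [hw, indicator_of_notMem hy', sub_zero]; exact hy
      rw [norm_smul, Real.norm_of_nonneg (by positivity)]
      calc _ ≤ r⁻¹ * M := by gcongr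
        _ = _ := by rw [hr]; field_simp
    · rw [setIntegral_eq_integral_of_forall_compl_eq_zero, integral_smul, hint, smul_zero]
      intro y hy
      by_contra h1
      exact hy (hsuppg y fun h0 => h1 (by simp [h0]))
  obtain ⟨hmem, hnorm⟩ := memH1_smul_atom (𝕜 := 𝕜) hatom hr0.le
  simp only [smul_inv_smul₀ hr0.ne'] at hmem hnorm
  have h1 := (hC₁ _ hmem).2
  rw [eLpNorm_one_eq_lintegral_enorm] at h1
  simp only [enorm_eq_self] at h1
  have hpt : ∀ x ∈ hbox a L, U f x ≤ U (fun y => f y - w y) x + C * ENNReal.ofReal M :=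
    fun x hx => by
    have h2 := hU.add_le (fun y => f y - w y) w ((hfi.sub hwi).adm hδ.le) (hwi.adm hδ.le) x
    simp only [sub_add_cancel] at h2
    refine h2.trans (add_le_add le_rfl (hU.le_of_separated hL hwm hws hwb fun y hy => ?_))
    rw [norm_sub_rev]
    exact hsep y hy x hx
  calc _ ≤ ∫⁻ x in hbox a L, (U (fun y => f y - w y) x + C * ENNReal.ofReal M) :=
        setLIntegral_mono' (measurableSet_hbox a L) hpt
    _ = (∫⁻ x in hbox a L, U (fun y => f y - w y) x) + C * ENNReal.ofReal M * V := by
        rw [lintegral_add_right _ measurable_const, setLIntegral_const]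
    _ ≤ C₁ * ENNReal.ofReal r + C * ENNReal.ofReal M * V := by
        gcongr
        exact (setLIntegral_le_lintegral _ _).trans (h1.trans (by gcongr))
    _ = _ := by
        rw [hr, ENNReal.ofReal_mul hM.le, ← hVQr, hVQ]
        push_cast
        ring

end

end FracLP

namespace FracLP

noncomputable section

variable {n : ℕ}

/-! ### Averages and functions of bounded mean oscillation -/

section Averages

variable {F : Type*} [NormedAddCommGroup F] [NormedSpace ℝ F]

theorem setAverage_sub_const [CompleteSpace F] {f : Rn n → F} {Q : Set (Rn n)}
    (hf : IntegrableOn f Q)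
    (h0 : volume Q ≠ 0) (ht : volume Q ≠ ∞) (c : F) :
    ⨍ x in Q, (f x - c) = (⨍ x in Q, f x) - c := by
  have hc : IntegrableOn (fun _ : Rn n => c) Q := integrableOn_const ht
  rw [setAverage_eq, setAverage_eq, integral_sub hf hc, setIntegral_const, smul_sub,
    inv_smul_smul₀]
  exact (ENNReal.toReal_pos h0 ht).ne'

theorem enorm_setAverage_sub_le [CompleteSpace F] {f : Rn n → F} {Q : Set (Rn n)}
    (hf : IntegrableOn f Q)
    (h0 : volume Q ≠ 0) (ht : volume Q ≠ ∞) (c : F) :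
    ‖(⨍ x in Q, f x) - c‖ₑ ≤ (volume Q)⁻¹ * ∫⁻ x in Q, ‖f x - c‖ₑ := by
  rw [← setAverage_sub_const hf h0 ht]
  exact enorm_setAverage_le (fun x => f x - c) Q

theorem lintegral_sub_setAverage_le_of_const [CompleteSpace F] {f : Rn n → F} {Q : Set (Rn n)}
    (hf : IntegrableOn f Q) (h0 : volume Q ≠ 0) (ht : volume Q ≠ ∞) (c : F) :
    ∫⁻ x in Q, ‖f x - ⨍ y in Q, f y‖ₑ ≤ 2 * ∫⁻ x in Q, ‖f x - c‖ₑ := by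
  refine le_trans (le_of_eq ?_) (lintegral_sub_setAverage_le (fun x => f x - c) Q)
  rw [setAverage_sub_const hf h0 ht]
  simp only [sub_sub_sub_cancel_right]

theorem isCompact_cube (c : Rn n) {r : ℝ} (hr : 0 ≤ r) : IsCompact (cube c r) :=
  Metric.isCompact_of_isClosed_isBounded (isClosed_cube c r)
    (Metric.isBounded_closedBall.subset (cube_subset_closedBall c hr))

/-- The averages of a `BMO` function over the dyadic dilates of a cube drift at most linearly. -/
theorem enorm_setAverage_sub_setAverage_le [CompleteSpace F] {f : Rn n → F}
    (hf : LocallyIntegrable f) (c : Rn n) {r : ℝ} (hr : 0 < r) (j : ℕ) :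
    ‖(⨍ x in cube c r, f x) - ⨍ x in cube c (2 ^ j * r), f x‖ₑ ≤ j * (2 ^ n * bmoSeminorm f) := by
  induction j with
  | zero => simp
  | succ j ih =>
    set s : ℝ := 2 ^ j * r with hs
    have hs0 : 0 < s := by positivity
    have hs2 : (2 : ℝ) ^ (j + 1) * r = 2 * s := by rw [hs, pow_succ]; ring
    rw [hs2]
    set v := ⨍ x in cube c (2 * s), f x with hv
    have h0 := volume_cube_ne_zero c hs0
    have ht := volume_cube_ne_top c hs0.le
    have hvol : volume (cube c (2 * s)) = 2 ^ n * volume (cube c s) := by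
      rw [volume_cube c hs0.le, volume_cube c (by positivity),
        show (2 : ℝ≥0∞) ^ n = ENNReal.ofReal (2 ^ n) by
          rw [ENNReal.ofReal_pow (by norm_num)]; simp, ← ENNReal.ofReal_mul (by positivity),
        ← mul_pow]
    have hsub : cube c s ⊆ cube c (2 * s) := fun x hx i => (hx i).trans (by linarith)
    have h1 : ‖(⨍ x in cube c s, f x) - v‖ₑ ≤ 2 ^ n * bmoSeminorm f := by
      refine (enorm_setAverage_sub_le (hf.integrableOn_isCompact (isCompact_cube c hs0.le)) h0 ht v).trans ?_
      calc _ ≤ (volume (cube c s))⁻¹ * (bmoSeminorm f * (2 ^ n * volume (cube c s))) := by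
            gcongr
            rw [← hvol]
            exact (lintegral_mono_set hsub).trans (lintegral_cube_le_bmoSeminorm f c (by positivity))
        _ = ((volume (cube c s))⁻¹ * volume (cube c s)) * (2 ^ n * bmoSeminorm f) := by ring
        _ = _ := by rw [ENNReal.inv_mul_cancel h0 ht, one_mul]
    calc _ ≤ ‖(⨍ x in cube c r, f x) - ⨍ x in cube c s, f x‖ₑ + ‖(⨍ x in cube c s, f x) - v‖ₑ := by
          rw [← sub_add_sub_cancel (⨍ x in cube c r, f x) (⨍ x in cube c s, f x) v]
          exact enorm_add_le _ _
      _ ≤ j * (2 ^ n * bmoSeminorm f) + 2 ^ n * bmoSeminorm f := add_le_add ih h1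
      _ = _ := by push_cast; ring

theorem lintegral_sub_setAverage_dilate_le [CompleteSpace F] {f : Rn n → F}
    (hf : LocallyIntegrable f) (c : Rn n) {r : ℝ} (hr : 0 < r) (j : ℕ) :
    ∫⁻ x in cube c (2 ^ j * r), ‖f x - ⨍ y in cube c r, f y‖ₑ ≤
      (1 + j * 2 ^ n) * bmoSeminorm f * volume (cube c (2 ^ j * r)) := by
  set v := ⨍ x in cube c (2 ^ j * r), f x with hv
  calc _ ≤ ∫⁻ x in cube c (2 ^ j * r), (‖f x - v‖ₑ + ‖(⨍ y in cube c r, f y) - v‖ₑ) :=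
        lintegral_mono fun x => by
          rw [← sub_sub_sub_cancel_right (f x) _ v]
          exact enorm_sub_le
    _ = (∫⁻ x in cube c (2 ^ j * r), ‖f x - v‖ₑ) +
        ‖(⨍ y in cube c r, f y) - v‖ₑ * volume (cube c (2 ^ j * r)) := by
        rw [lintegral_add_right _ measurable_const, setLIntegral_const]
    _ ≤ bmoSeminorm f * volume (cube c (2 ^ j * r)) +
        j * (2 ^ n * bmoSeminorm f) * volume (cube c (2 ^ j * r)) := by
        gcongr
        · exact lintegral_cube_le_bmoSeminorm f c (by positivity)
        · exact enorm_setAverage_sub_setAverage_le hf c hr j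
    _ = _ := by ring

end Averages

/-! ### From oscillation in measure to mean oscillation -/

/-- A layer-cake formula with steps of length 2κ, the increment of level in `good_lambda`. -/
theorem ofReal_le_tsum_indicator {κ : ℝ} (hκ : 0 < κ) (t : ℝ) :
    ENNReal.ofReal t ≤ ENNReal.ofReal κ + ∑' k : ℕ,
      (if κ + 2 * κ * k < t then ENNReal.ofReal (2 * κ) else 0) := by
  set N : ℕ := ⌈(t - κ) / (2 * κ)⌉₊ with hN
  have h1 : ∀ k ∈ Finset.range N,
      (if κ + 2 * κ * k < t then ENNReal.ofReal (2 * κ) else 0) = ENNReal.ofReal (2 * κ) := by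
    intro k hk
    have h2 := Nat.lt_ceil.1 (Finset.mem_range.1 hk)
    rw [lt_div_iff₀ (by positivity)] at h2
    rw [if_pos (by linarith)]
  have h3 := Nat.le_ceil ((t - κ) / (2 * κ))
  rw [div_le_iff₀ (by positivity)] at h3
  calc ENNReal.ofReal t ≤ ENNReal.ofReal (κ + N * (2 * κ)) :=
        ENNReal.ofReal_le_ofReal (by linarith)
    _ = ENNReal.ofReal κ + ∑ k ∈ Finset.range N,
        (if κ + 2 * κ * k < t then ENNReal.ofReal (2 * κ) else 0) := by
        rw [Finset.sum_congr rfl h1, Finset.sum_const, Finset.card_range, nsmul_eq_mul,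
          ENNReal.ofReal_add hκ.le (by positivity), ENNReal.ofReal_mul (by positivity),
          ENNReal.ofReal_natCast]
    _ ≤ _ := by gcongr; exact ENNReal.sum_le_tsum _

/-- The John--Strömberg inequality: if on each box `F` differs from a constant by more than `κ` on a
small fraction only, then the mean oscillation of `F` is at most a multiple of `κ`. -/
theorem exists_lintegral_sub_le_of_oscillation {F : Rn n → ℝ} (hF : Measurable F) {κ : ℝ}
    (hκ : 0 < κ) {ε : ℝ≥0∞} (hε : ε < 1 / 2) (hε' : 2 ^ (n + 1) * ε ≤ 1 / 2)
    (hosc : ∀ (b : Rn n) (l : ℝ), 0 < l →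
      ∃ c : ℝ, volume (hbox b l ∩ {y | κ < |F y - c|}) ≤ ε * volume (hbox b l))
    (a : Rn n) {L : ℝ} (hL : 0 < L) :
    ∃ c : ℝ, ∫⁻ x in hbox a L, ‖F x - c‖ₑ ≤ ENNReal.ofReal (5 * κ) * volume (hbox a L) := by
  obtain ⟨c₀, hc₀⟩ := hosc a L hL
  refine ⟨c₀, ?_⟩
  set V := volume (hbox a L) with hV
  have hFm : Measurable fun x => |F x - c₀| := by fun_prop
  -- For lam ≥ κ the level set fills at most half of the box by the choice of c₀, so `good_lambda`
  -- with G the whole space halves the measure at each step.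
  have hstep : ∀ lam, κ ≤ lam → volume (hbox a L ∩ {y | lam + 2 * κ < |F y - c₀|}) ≤
      1 / 2 * volume (hbox a L ∩ {y | lam < |F y - c₀|}) := by
    intro lam hlam
    have h := good_lambda hFm (G := univ) (κ := κ) (lam := lam) hε (fun b l hl _ => by
      obtain ⟨c, hc⟩ := hosc b l hl
      -- The oscillation hypothesis for F passes to |F - c₀| by the reverse triangle inequality.
      refine ⟨|c - c₀|, (measure_mono ?_).trans hc⟩
      intro y hy
      refine ⟨hy.1, show κ < |F y - c| from lt_of_lt_of_le hy.2 ((abs_abs_sub_abs_le_abs_sub _ _).trans (le_of_eq ?_))⟩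
      congr 1; ring) a hL ((measure_mono (inter_subset_inter_right _ fun y hy =>
        lt_of_le_of_lt hlam hy)).trans (hc₀.trans (by
          rw [ENNReal.div_eq_inv_mul]
          gcongr
          rw [← one_div]; exact hε.le)))
    rw [inter_univ] at h
    exact h.trans (by gcongr)
  have hgeo : ∀ k : ℕ, volume (hbox a L ∩ {y | κ + 2 * κ * k < |F y - c₀|}) ≤ (1 / 2) ^ k * V := by
    intro k
    induction k with
    | zero => simpa using measure_mono inter_subset_left
    | succ k ih =>
      have h := hstep (κ + 2 * κ * k) (by have : 0 ≤ 2 * κ * k := by positivity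
                                          linarith)
      rw [show κ + 2 * κ * k + 2 * κ = κ + 2 * κ * ((k + 1 : ℕ) : ℝ) by push_cast; ring] at h
      refine h.trans ((mul_le_mul_right ih _).trans (le_of_eq ?_))
      rw [pow_succ]; ring
  have hms : ∀ k : ℕ, MeasurableSet {y | κ + 2 * κ * k < |F y - c₀|} := fun k =>
    measurableSet_lt measurable_const hFm
  calc ∫⁻ x in hbox a L, ‖F x - c₀‖ₑ
      ≤ ∫⁻ x in hbox a L, (ENNReal.ofReal κ + ∑' k : ℕ,
        {y | κ + 2 * κ * k < |F y - c₀|}.indicator (fun _ => ENNReal.ofReal (2 * κ)) x) := by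
        refine lintegral_mono fun x => ?_
        rw [← ofReal_norm, Real.norm_eq_abs]
        refine (ofReal_le_tsum_indicator hκ _).trans (le_of_eq ?_)
        simp only [indicator_apply, mem_ofPred_eq]
    _ = ENNReal.ofReal κ * V + ∑' k : ℕ, ENNReal.ofReal (2 * κ) *
        volume (hbox a L ∩ {y | κ + 2 * κ * k < |F y - c₀|}) := by
        rw [lintegral_add_left measurable_const, setLIntegral_const, lintegral_tsum fun k =>
          (measurable_const.indicator (hms k)).aemeasurable]
        congr 1
        refine tsum_congr fun k => ?_
        rw [lintegral_indicator_const (hms k), Measure.restrict_apply (hms k), inter_comm]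
    _ ≤ ENNReal.ofReal κ * V + ∑' k : ℕ, ENNReal.ofReal (2 * κ) * ((1 / 2) ^ k * V) := by
        gcongr with k; exact hgeo k
    -- κ from the bottom layer, plus 2κ times the geometric sum 2.
    _ = ENNReal.ofReal (5 * κ) * V := by
        rw [ENNReal.tsum_mul_left, ENNReal.tsum_mul_right, one_div, ENNReal.tsum_geometric,
          ENNReal.one_sub_inv_two, inv_inv, ENNReal.ofReal_mul (by norm_num),
          ENNReal.ofReal_mul (by norm_num)]
        simp only [ENNReal.ofReal_ofNat]
        ring

end

end FracLP

namespace FracLP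

noncomputable section

variable {n : ℕ} {B : Type*} [NormedAddCommGroup B] {δ : ℝ}
variable {𝕜 : Type*} [RCLike 𝕜] [NormedSpace 𝕜 B] [NormedSpace ℝ B] {C : ℝ≥0}
  {U : (Rn n → B) → Rn n → ℝ≥0∞}

/-! ### The BMO estimate -/

/-- The difference of `g` and its translate can be treated by truncation when `g` differs from an
integrable function by a constant. -/
theorem IsCZ.le_liminf_sub_translate (hU : IsCZ 𝕜 δ C U) (hδ : 0 < δ) {g : Rn n → B}
    (hg : Integrable g) (c : B) (h x : Rn n) :
    U (fun y => g y - g (y + h)) x ≤ liminf (fun k : ℕ => U (fun y =>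
      (Metric.closedBall (0 : Rn n) k).indicator (fun y => g y - c) y -
        (Metric.closedBall (0 : Rn n) k).indicator (fun y => g y - c) (y + h)) x) atTop := by
  set S : ℕ → Set (Rn n) := fun k => Metric.closedBall 0 k with hS
  have hSm : ∀ k, MeasurableSet (S k) := fun k => Metric.isClosed_closedBall.measurableSet
  have hT : ∀ k, MeasurableSet ((fun y => y + h) ⁻¹' S k) := fun k =>
    (measurable_add_const h) (hSm k)
  have hgt : Integrable fun y => g (y + h) := hg.comp_add_right h
  have hc : Adm δ fun _ : Rn n => c := MemLp.adm hδ le_top (memLp_top_const c)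
  have hG : Adm δ fun y => g y - c := (hg.adm hδ.le).sub hc
  have hGt : Adm δ fun y => g (y + h) - c := (hgt.adm hδ.le).sub hc
  have hw := measurable_wgt n δ
  refine hU.lsc _ _ ((hg.sub hgt).adm hδ.le)
    (fun k => (hG.indicator (hSm k)).sub (hGt.indicator (hT k))) ?_ x
  have h1 := hG.tendsto_indicator hSm eventually_mem_closedBall
  have h2 := hGt.tendsto_indicator hT fun y => eventually_mem_closedBall (y + h)
  have h3 := h1.add h2
  rw [add_zero] at h3
  refine tendsto_of_tendsto_of_tendsto_of_le_of_le tendsto_const_nhds h3 (fun _ => zero_le)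
    fun k => ?_
  change _ ≤ (∫⁻ y, _) + ∫⁻ y, _
  have hAE : AEMeasurable fun y => ‖(S k).indicator (fun y => g y - c) y - (g y - c)‖ₑ *
      ENNReal.ofReal (wgt n δ y) :=
    ((hG.1.indicator (hSm k)).sub hG.1).enorm.mul hw.ennreal_ofReal.aemeasurable
  rw [← lintegral_add_left' hAE]
  refine lintegral_mono fun y => ?_
  change _ ≤ ‖(S k).indicator (fun y => g y - c) y - (g y - c)‖ₑ * _ +
    ‖(S k).indicator (fun y => g y - c) (y + h) - (g (y + h) - c)‖ₑ * _
  rw [← add_mul]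
  gcongr
  -- The constant c cancels in the difference; this is why g may be replaced by g - c before
  -- truncating.
  have e : ∀ u v w z : B, u - v - (w - z) = (u - (w - c)) - (v - (z - c)) := fun u v w z => by abel
  exact le_trans (le_of_eq (congrArg _ (e _ _ _ _))) enorm_sub_le

/-- A difference of translates ignores constants, so regularity is applied to g - c, which vanishes
near x. Its mass on dyadic balls grows by at most a factor j + 1, the drift of BMO averages, which
the tail estimate tolerates. Since g - c need not be integrable, truncations are used. -/
theorem IsCZ.sub_translate_le_of_bmo [CompleteSpace B] (hδ : 0 < δ)
    (hU : IsCZ 𝕜 δ C U) : ∃ D : ℝ, 0 ≤ D ∧ ∀ (f : Rn n → B) (β : ℝ), 0 < β → Integrable f →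
      bmoSeminorm f ≤ ENNReal.ofReal β → ∀ (x : Rn n) (r : ℝ), 0 < r → ∀ g : Rn n → B,
      Integrable g → (∀ y, g y = f y ∨ g y = ⨍ z in cube x (3 * r), f z) →
      (∀ y, ‖x - y‖ < 2 * r → g y = ⨍ z in cube x (3 * r), f z) → ∀ h, ‖h‖ ≤ r →
        U (fun y => g y - g (y + h)) x ≤ ENNReal.ofReal (D * β) := by
  obtain ⟨Ct, hCt, htail⟩ := exists_tail_le n
  -- The drift satisfies 1 + (j+1)2^n ≤ 2·2^n (j+1); the factor 6^n compares the dilated cube with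
  -- (2^j · 2r)^n.
  refine ⟨C * (Ct * (2 * 2 ^ n * 6 ^ n)), by positivity,
    fun f β hβ hf hbmo x r hr g hg hgf hgc h hh => ?_⟩
  set c := ⨍ z in cube x (3 * r), f z with hc
  refine (hU.le_liminf_sub_translate hδ hg c h x).trans ?_
  refine (liminf_le_liminf (Eventually.of_forall fun k => ?_)).trans
    (liminf_const (f := atTop) (ENNReal.ofReal _)).le
  set S := Metric.closedBall (0 : Rn n) k with hS
  have hSm : MeasurableSet S := Metric.isClosed_closedBall.measurableSet
  set φ : Rn n → B := S.indicator fun y => g y - c with hφ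
  have hφi : Integrable φ := by
    refine IntegrableOn.integrable_indicator ?_ hSm
    exact hg.integrableOn.sub (integrableOn_const measure_closedBall_lt_top.ne)
  have hφs : ∀ y, φ y ≠ 0 → 2 * r ≤ ‖x - y‖ := fun y hy => by
    by_contra hno
    refine hy ?_
    rw [hφ]
    by_cases hyS : y ∈ S
    · rw [indicator_of_mem hyS, hgc y (not_le.1 hno), sub_self]
    · rw [indicator_of_notMem hyS]
  have hφf : ∀ y, ‖φ y‖ₑ ≤ ‖f y - c‖ₑ := fun y => by
    refine (enorm_indicator_le_enorm_self _ _).trans ?_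
    rcases hgf y with h | h <;> rw [h]
    simp
  refine (hU.reg φ hφi x h r hr hh hφs).trans ?_
  have hset : MeasurableSet {y | 2 * r ≤ ‖x - y‖} :=
    measurableSet_le measurable_const (by fun_prop)
  have hmain : ∫⁻ y, ‖φ y‖ₑ * ENNReal.ofReal (‖x - y‖ ^ (-((n : ℝ) + 1 / 2))) ≤
      ENNReal.ofReal (Ct * (2 * 2 ^ n * 6 ^ n * β) * (2 * r) ^ (-(1 / 2) : ℝ)) := by
    refine le_trans ?_ (htail (fun y => ‖f y - c‖ₑ) x (2 * r) (2 * 2 ^ n * 6 ^ n * β)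
      (by positivity) (by positivity) fun j => ?_)
    · rw [← lintegral_indicator hset]
      refine lintegral_mono fun y => ?_
      by_cases hy : φ y = 0
      · simp [hy]
      · rw [indicator_of_mem (by exact hφs y hy)]
        gcongr
        exact hφf y
    · have hsub : Metric.closedBall x (2 ^ (j + 1) * (2 * r)) ⊆ cube x (2 ^ (j + 1) * (3 * r)) :=
        (Metric.closedBall_subset_closedBall (mul_le_mul_of_nonneg_left (by linarith)
          (by positivity))).trans (ball_subset_cube x _)
      refine (lintegral_mono_set hsub).trans ((lintegral_sub_setAverage_dilate_le
        hf.locallyIntegrable x (by positivity) (j + 1)).trans ?_)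
      rw [volume_cube x (by positivity)]
      calc _ ≤ (1 + ((j + 1 : ℕ) : ℝ≥0∞) * 2 ^ n) * ENNReal.ofReal β *
            ENNReal.ofReal ((2 * (2 ^ (j + 1) * (3 * r))) ^ n) := by gcongr
        _ = ENNReal.ofReal ((1 + (j + 1) * 2 ^ n) * β * (2 * (2 ^ (j + 1) * (3 * r))) ^ n) := by
            have e : ENNReal.ofReal (1 + (j + 1) * 2 ^ n) =
                1 + ((j + 1 : ℕ) : ℝ≥0∞) * 2 ^ n := by
              rw [ENNReal.ofReal_add (by norm_num) (by positivity),
                ENNReal.ofReal_mul (by positivity), ENNReal.ofReal_pow (by norm_num),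
                ENNReal.ofReal_one, show (j : ℝ) + 1 = ((j + 1 : ℕ) : ℝ) by push_cast; ring,
                ENNReal.ofReal_natCast, ENNReal.ofReal_ofNat]
            rw [ENNReal.ofReal_mul (by positivity), ENNReal.ofReal_mul (by positivity), e]
        _ ≤ _ := by
            refine ENNReal.ofReal_le_ofReal ?_
            have h1 : (2 * (2 ^ (j + 1) * (3 * r))) ^ n = 6 ^ n * (2 ^ j * (2 * r)) ^ n := by
              rw [← mul_pow]; congr 1; ring
            have h2 : (1 : ℝ) ≤ 2 ^ n := one_le_pow₀ (by norm_num)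
            have h3 : (1 : ℝ) + (j + 1) * 2 ^ n ≤ 2 * 2 ^ n * (j + 1) := by
              nlinarith [(Nat.cast_nonneg j : (0 : ℝ) ≤ j)]
            rw [h1]
            calc _ ≤ 2 * 2 ^ n * (j + 1) * β * (6 ^ n * (2 ^ j * (2 * r)) ^ n) := by gcongr
              _ = _ := by ring
  calc _ ≤ C * ENNReal.ofReal (r ^ (1 / 2 : ℝ)) *
        ENNReal.ofReal (Ct * (2 * 2 ^ n * 6 ^ n * β) * (2 * r) ^ (-(1 / 2) : ℝ)) := by gcongr
    _ ≤ _ := by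
        rw [← ENNReal.ofReal_coe_nnreal, ← ENNReal.ofReal_mul (by positivity),
          ← ENNReal.ofReal_mul (by positivity)]
        refine ENNReal.ofReal_le_ofReal ?_
        have h3 : (2 * r) ^ (-(1 / 2) : ℝ) ≤ r ^ (-(1 / 2) : ℝ) :=
          Real.rpow_le_rpow_of_nonpos hr (by linarith) (by norm_num)
        have h4 : r ^ (1 / 2 : ℝ) * r ^ (-(1 / 2) : ℝ) = 1 := by
          rw [← Real.rpow_add hr]; norm_num
        calc _ ≤ C * r ^ (1 / 2 : ℝ) * (Ct * (2 * 2 ^ n * 6 ^ n * β) * r ^ (-(1 / 2) : ℝ)) := by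
              gcongr
          _ = C * (Ct * (2 * 2 ^ n * 6 ^ n)) * β * (r ^ (1 / 2 : ℝ) * r ^ (-(1 / 2) : ℝ)) := by
              ring
          _ = _ := by rw [h4, mul_one]

/-- On the dilated box f is replaced by its average instead of by zero. The near part f - c then has
mean at most β, and the far part is constant around the centre. -/
theorem IsCZ.exists_oscillation_le_of_bmo [CompleteSpace B] (hn : 0 < n) (hδ : 0 < δ)
    (hU : IsCZ 𝕜 δ C U) (hI : SmallOnIntegrable U) {ε : ℝ} (hε : 0 < ε) :
    ∃ K : ℝ, 0 < K ∧ ∀ (f : Rn n → B) (β R : ℝ), 0 < β → Integrable f → (∀ y, f y ≠ 0 → ‖y‖ ≤ R) →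
      bmoSeminorm f ≤ ENNReal.ofReal β → ∀ (b : Rn n) (l : ℝ), 0 < l →
      ∃ c : ℝ, volume (hbox b l ∩ {y | K * β < |(U f y).toReal - c|}) ≤
        ENNReal.ofReal ε * volume (hbox b l) := by
  obtain ⟨D, hD, hfar⟩ := hU.sub_translate_le_of_bmo hδ
  obtain ⟨K, hK, hosc⟩ := hU.exists_oscillation_le hn hδ hI hε hD
  refine ⟨K, hK, fun f β R hβ hf hR hbmo b l hl => ?_⟩
  set x := boxCenter b l with hx
  have hnl : (0 : ℝ) < n * l := by positivity
  set c := ⨍ z in cube x (3 * (n * l)), f z with hc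
  have hms := measurableSet_starBox b l
  have hae : starBox b l =ᵐ[volume] cube x (3 * (n * l)) := by
    have := hbox_ae_eq_cube (starCorner b l) (L := 6 * (n * l)) (by positivity)
    rwa [boxCenter_starCorner, show 6 * (n * l) / 2 = 3 * (n * l) by ring] at this
  have hSt : volume (starBox b l) ≠ ∞ := volume_hbox_ne_top _ (by positivity)
  set f₀ : Rn n → B := (starBox b l).indicator fun y => f y - c with hf₀
  have hf₀i : Integrable f₀ :=
    IntegrableOn.integrable_indicator (hf.integrableOn.sub (integrableOn_const hSt)) hms
  set g : Rn n → B := fun y => f y - f₀ y with hg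
  have hgi : Integrable g := hf.sub hf₀i
  have hg_in : ∀ y ∈ starBox b l, g y = c := fun y hy => by
    simp only [hg, hf₀, indicator_of_mem hy, sub_sub_cancel]
  have hg_out : ∀ y ∉ starBox b l, g y = f y := fun y hy => by
    simp only [hg, hf₀, indicator_of_notMem hy, sub_zero]
  have hfg : (fun y => f₀ y + g y) = f := funext fun y => add_sub_cancel _ _
  have hfar' := hfar f β hβ hf hbmo x (n * l) hnl g hgi
    (fun y => by
      by_cases hy : y ∈ starBox b l
      · exact Or.inr (hg_in y hy)
      · exact Or.inl (hg_out y hy))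
    (fun y hy => hg_in y (by
      by_contra h
      exact absurd hy (not_lt.2 (le_norm_sub_of_notMem_starBox hn b hl h))))
  have hmass : ∫⁻ y, ‖f₀ y‖ₑ ≤ ENNReal.ofReal β * volume (starBox b l) := by
    simp_rw [hf₀, enorm_indicator_eq_indicator_enorm]
    rw [lintegral_indicator hms, setLIntegral_congr hae, measure_congr hae]
    exact (lintegral_cube_le_bmoSeminorm f x (by positivity)).trans (by gcongr)
  have hgR : ∀ y, g y ≠ 0 → ‖y‖ ≤ max R (‖x‖ + 6 * n ^ 2 * l) := fun y hy => by
    by_cases hyS : y ∈ starBox b l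
    · have h1 := mem_closedBall_iff_norm.1 (starBox_subset_closedBall b hl hyS)
      have h2 := norm_sub_norm_le y x
      exact le_max_of_le_right (by linarith)
    · rw [hg_out y hyS] at hy
      exact le_max_of_le_left (hR y hy)
  -- The size estimate is unavailable, as g need not vanish near x. But U g is finite almost
  -- everywhere, so at some point of the box, and the oscillation bound carries this to the centre.
  have hfin : U g x ≠ ∞ := by
    intro htop
    have hnull := hI.ae_ne_top hgi hgR
    refine volume_hbox_ne_zero b hl (measure_mono_null (fun y hy => ?_) hnull)
    intro hy2
    have h1 := hU.le_translate_add hδ hgi x (y - x)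
    rw [htop, add_sub_cancel] at h1
    refine absurd h1 (not_le.2 (ENNReal.add_lt_top.2 ⟨Ne.lt_top hy2, ?_⟩))
    exact (hfar' (y - x) (mem_closedBall_iff_norm.1
      (hbox_subset_closedBall b hl.le hy))).trans_lt ENNReal.ofReal_lt_top
  have := hosc b l hl f₀ g β hβ hf₀i hgi support_indicator_subset hmass hfin hfar'
  rw [hfg] at this
  exact ⟨_, this⟩

theorem hbox_sub_ae_eq_cube (c : Rn n) {r : ℝ} (hr : 0 < r) :
    hbox (WithLp.toLp 2 fun i => c i - r) (2 * r) =ᵐ[volume] cube c r := by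
  have h := hbox_ae_eq_cube (WithLp.toLp 2 fun i => c i - r) (L := 2 * r) (by positivity)
  have hc : boxCenter (WithLp.toLp 2 fun i => c i - r) (2 * r) = c := by
    ext i
    simp [boxCenter]
  rwa [hc, mul_div_cancel_left₀ r two_ne_zero] at h

theorem locallyIntegrable_of_lintegral_sub_hbox_ne_top {F : Rn n → ℝ} (hF : Measurable F)
    (h : ∀ (a : Rn n) (L : ℝ), 0 < L → ∃ c : ℝ, ∫⁻ x in hbox a L, ‖F x - c‖ₑ ≠ ∞) :
    LocallyIntegrable F := by
  refine (locallyIntegrable_iff).2 fun K hK => ?_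
  obtain ⟨R, hR⟩ := hK.isBounded.exists_norm_le
  have hL : 0 < max R 0 + 1 := by positivity
  obtain ⟨c, hc⟩ := h (WithLp.toLp 2 fun _ => -(max R 0 + 1)) (2 * (max R 0 + 1)) (by positivity)
  have hsub : K ⊆ hbox (WithLp.toLp 2 fun _ => -(max R 0 + 1)) (2 * (max R 0 + 1)) := fun x hx =>
    mem_centralBox_of_norm_lt (by linarith [hR x hx, le_max_left R 0])
  have h1 : IntegrableOn (fun x => F x - c)
      (hbox (WithLp.toLp 2 fun _ => -(max R 0 + 1)) (2 * (max R 0 + 1))) :=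
    ⟨(hF.sub_const c).aestronglyMeasurable, hc.lt_top⟩
  have h2 := h1.add (integrableOn_const (C := c) (volume_hbox_ne_top _ (by positivity)))
  refine IntegrableOn.mono_set (h2.congr_fun (fun x _ => ?_) (measurableSet_hbox _ _)) hsub
  simp

theorem IsCZ.mapsBMOcToBMO [CompleteSpace B] (hn : 0 < n) (hδ : 0 < δ) (hU : IsCZ 𝕜 δ C U)
    (hI : SmallOnIntegrable U) : MapsBMOcToBMO U := by
  -- The value ε = 2^{-n-2} gives 2^{n+1} ε = 1/2.
  obtain ⟨K, hK, hosc⟩ := hU.exists_oscillation_le_of_bmo hn hδ hI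
    (ε := (1 / 2) ^ (n + 2)) (by positivity)
  -- 5K comes from the John–Strömberg step, doubled when an arbitrary constant is replaced by the
  -- average.
  refine ⟨(10 * K).toNNReal, fun f hf hfc => ?_⟩
  have hfi : Integrable f := (integrableOn_iff_integrable_of_support_subset (subset_tsupport f)).1
    (hf.1.integrableOn_isCompact hfc)
  obtain ⟨R, hR⟩ := hfc.isCompact.isBounded.exists_norm_le
  have hR' : ∀ y, f y ≠ 0 → ‖y‖ ≤ R := fun y hy => hR y (subset_tsupport f hy)
  set F : Rn n → ℝ := fun x => (U f x).toReal with hF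
  have hFm : Measurable F := (hU.measurable f (hfi.adm hδ.le)).ennreal_toReal
  have hhalf : ENNReal.ofReal ((1 / 2) ^ (n + 2)) = (1 / 2) ^ (n + 2) := by
    rw [ENNReal.ofReal_pow (by norm_num), ENNReal.ofReal_div_of_pos (by norm_num)]
    simp
  have hε : ENNReal.ofReal ((1 / 2) ^ (n + 2)) < 1 / 2 := by
    rw [show (1 / 2 : ℝ≥0∞) = ENNReal.ofReal (1 / 2) by
      rw [ENNReal.ofReal_div_of_pos (by norm_num)]; simp]
    refine (ENNReal.ofReal_lt_ofReal_iff (by norm_num)).2 ?_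
    exact pow_lt_self_of_lt_one₀ (by norm_num) (by norm_num) (by omega)
  have hε' : 2 ^ (n + 1) * ENNReal.ofReal ((1 / 2) ^ (n + 2)) ≤ 1 / 2 := by
    rw [hhalf, pow_succ (1 / 2 : ℝ≥0∞) (n + 1), ← mul_assoc, ← mul_pow, one_div,
      ENNReal.mul_inv_cancel (by simp) (by simp), one_pow, one_mul]
  have hmean : ∀ β : ℝ, 0 < β → bmoSeminorm f ≤ ENNReal.ofReal β → ∀ (a : Rn n) (L : ℝ), 0 < L →
      ∃ c : ℝ, ∫⁻ x in hbox a L, ‖F x - c‖ₑ ≤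
        ENNReal.ofReal (5 * (K * β)) * volume (hbox a L) := fun β hβ hle a L hL =>
    exists_lintegral_sub_le_of_oscillation hFm (by positivity) hε hε'
      (fun b l hl => hosc f β R hβ hfi hR' hle b l hl) a hL
  have hloc : LocallyIntegrable F := by
    refine locallyIntegrable_of_lintegral_sub_hbox_ne_top hFm fun a L hL => ?_
    obtain ⟨c, hc⟩ := hmean ((bmoSeminorm f).toReal + 1) (by positivity)
      ((ENNReal.ofReal_toReal hf.2.ne).symm.le.trans (ENNReal.ofReal_le_ofReal (by linarith))) a L hL
    exact ⟨c, ne_top_of_le_ne_top (ENNReal.mul_ne_top ENNReal.ofReal_ne_top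
      (volume_hbox_ne_top a hL)) hc⟩
  have hbmo : ∀ β : ℝ, 0 < β → bmoSeminorm f ≤ ENNReal.ofReal β →
      bmoSeminorm F ≤ ENNReal.ofReal (10 * K * β) := by
    intro β hβ hle
    refine iSup_le fun c => iSup₂_le fun r hr => ?_
    have h0 := volume_cube_ne_zero c hr
    have ht := volume_cube_ne_top c hr.le
    obtain ⟨v, hv⟩ := hmean β hβ hle (WithLp.toLp 2 fun i => c i - r) (2 * r) (by positivity)
    rw [setLIntegral_congr (hbox_sub_ae_eq_cube c hr),
      measure_congr (hbox_sub_ae_eq_cube c hr)] at hv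
    calc _ ≤ (volume (cube c r))⁻¹ * (2 * (ENNReal.ofReal (5 * (K * β)) * volume (cube c r))) := by
          gcongr
          exact (lintegral_sub_setAverage_le_of_const
            (hloc.integrableOn_isCompact (isCompact_cube c hr.le)) h0 ht v).trans (by gcongr)
      _ = ((volume (cube c r))⁻¹ * volume (cube c r)) * (2 * ENNReal.ofReal (5 * (K * β))) := by
          ring
      _ = 2 * ENNReal.ofReal (5 * (K * β)) := by rw [ENNReal.inv_mul_cancel h0 ht, one_mul]
      _ = _ := by
          rw [← ENNReal.ofReal_ofNat, ← ENNReal.ofReal_mul (by norm_num)]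
          congr 1; ring
  -- The estimates require β > 0; approaching the seminorm from above also covers the value zero.
  have hfinal : bmoSeminorm F ≤ ((10 * K).toNNReal : ℝ≥0∞) * bmoSeminorm f := by
    set s := (bmoSeminorm f).toReal with hs
    have hseq : ∀ k : ℕ, bmoSeminorm F ≤ ENNReal.ofReal (10 * K * (s + 1 / ((k : ℝ) + 1))) :=
      fun k => hbmo _ (by positivity) ((ENNReal.ofReal_toReal hf.2.ne).symm.le.trans
        (ENNReal.ofReal_le_ofReal (le_add_of_nonneg_right (by positivity))))
    have hlim : Tendsto (fun k : ℕ => ENNReal.ofReal (10 * K * (s + 1 / ((k : ℝ) + 1)))) atTop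
        (𝓝 (ENNReal.ofReal (10 * K * (s + 0)))) :=
      ENNReal.tendsto_ofReal ((tendsto_const_nhds.add
        tendsto_one_div_add_atTop_nhds_zero_nat).const_mul _)
    refine (ge_of_tendsto' hlim hseq).trans (le_of_eq ?_)
    rw [add_zero, ENNReal.ofReal_mul (by positivity), ENNReal.ofReal_toReal hf.2.ne]
    rfl
  refine ⟨?_, ⟨hloc, hfinal.trans_lt (ENNReal.mul_lt_top ENNReal.coe_lt_top hf.2)⟩, hfinal⟩
  filter_upwards [hI.ae_ne_top hfi hR'] with x hx
  exact hx.lt_top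

/-- Bounded functions lie in BMO, with seminorm at most twice the supremum norm. -/
theorem mapsLinftycToBMO_of_mapsBMOcToBMO (h : MapsBMOcToBMO U) : MapsLinftycToBMO U := by
  obtain ⟨C, hC⟩ := h
  refine ⟨C * 2, fun f hf hfc => ?_⟩
  have hli : LocallyIntegrable f := hf.locallyIntegrable le_top
  have hle : bmoSeminorm f ≤ 2 * eLpNorm f ∞ volume := by
    refine iSup_le fun c => iSup₂_le fun r hr => ?_
    have h0 := volume_cube_ne_zero c hr
    have ht := volume_cube_ne_top c hr.le
    have h1 : ∫⁻ x in cube c r, ‖f x‖ₑ ≤ eLpNorm f ∞ volume * volume (cube c r) := by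
      rw [← setLIntegral_const, eLpNorm_exponent_top]
      exact lintegral_mono_ae (ae_restrict_of_ae (enorm_ae_le_eLpNormEssSup f volume))
    calc _ ≤ (volume (cube c r))⁻¹ * (2 * (eLpNorm f ∞ volume * volume (cube c r))) := by
          gcongr
          exact (lintegral_sub_setAverage_le f (cube c r)).trans (by gcongr)
      _ = ((volume (cube c r))⁻¹ * volume (cube c r)) * (2 * eLpNorm f ∞ volume) := by ring
      _ = _ := by rw [ENNReal.inv_mul_cancel h0 ht, one_mul]
  obtain ⟨h1, h2, h3⟩ := hC f ⟨hli, hle.trans_lt (ENNReal.mul_lt_top (by simp) hf.2)⟩ hfc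
  refine ⟨h1, h2, h3.trans ?_⟩
  calc _ ≤ (C : ℝ≥0∞) * (2 * eLpNorm f ∞ volume) := by gcongr
    _ = _ := by push_cast; ring

end

end FracLP

/-! ### The equivalence. -/

theorem theorem5p1 {𝕜 : Type*} [RCLike 𝕜] {B : Type*} [NormedAddCommGroup B]
    [NormedSpace 𝕜 B] [NormedSpace ℝ B] [IsScalarTower ℝ 𝕜 B] [CompleteSpace B]
    (n : ℕ) (hn : 0 < n) (q α : ℝ) (hq : 1 < q) (hα : 0 < α)
    (U : (FracLP.Rn n → B) → FracLP.Rn n → ℝ≥0∞)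
    (hU : U = FracLP.gFun 𝕜 q α ∨ U = FracLP.areaFun 𝕜 q α) :
    [FracLP.MapsLinftycToBMO U,
      FracLP.MapsH1ToL1 𝕜 U,
      ∀ p : ℝ, 1 < p → FracLP.MapsLpToLp U p,
      ∃ p : ℝ, 1 < p ∧ FracLP.MapsLpToLp U p,
      FracLP.MapsBMOcToBMO U,
      FracLP.MapsL1ToWeakL1 U].TFAE := by
  obtain ⟨δ, hδ, C, hCZ⟩ := FracLP.exists_isCZ hn hq hα hU
  have hI : FracLP.WeakOnBounded U → FracLP.SmallOnIntegrable U := hCZ.smallOnIntegrable hn hδ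
  -- The weak type (1,1) statement is the hub: 1, 2 and 4 reach it through `WeakOnBounded`, and 3, 2
  -- and 5 follow from it by the same route, with 3 → 4 and 5 → 1 immediate.
  tfae_have 1 → 6 := fun h =>
    hCZ.mapsL1ToWeakL1 hn hδ (hI (hCZ.weakOnBounded_of_mapsLinftycToBMO hn hδ h))
  tfae_have 2 → 6 := fun h =>
    hCZ.mapsL1ToWeakL1 hn hδ (hI (hCZ.weakOnBounded_of_mapsH1ToL1 hn hδ h))
  tfae_have 4 → 6 := fun ⟨_, hp, h⟩ =>
    hCZ.mapsL1ToWeakL1 hn hδ (hI (FracLP.weakOnBounded_of_mapsLpToLp hp h))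
  tfae_have 6 → 3 := fun h _ hp =>
    hCZ.mapsLpToLp hn hδ (hI (FracLP.weakOnBounded_of_mapsL1ToWeakL1 h)) hp
  tfae_have 3 → 4 := fun h => ⟨2, one_lt_two, h 2 one_lt_two⟩
  tfae_have 6 → 2 := fun h =>
    hCZ.mapsH1ToL1 hn hδ (hI (FracLP.weakOnBounded_of_mapsL1ToWeakL1 h))
  tfae_have 6 → 5 := fun h =>
    hCZ.mapsBMOcToBMO hn hδ (hI (FracLP.weakOnBounded_of_mapsL1ToWeakL1 h))
  tfae_have 5 → 1 := FracLP.mapsLinftycToBMO_of_mapsBMOcToBMO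
  tfae_finish
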